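/- **Setting.** Let $W\subset\mathbb R^d$ be a non-empty open set (spacetime), $\Omega(W)$ its differential forms, regarded as functions on $T[1]W$, and let $\mathcal M$ be a coordinate domain of an $\mathbb N_0$-graded manifold: finitely many coordinates $q^\alpha$ of degrees $|\alpha|\in\{0,\dots,p\}$, those of degree $0$ ranging over an open subset of some $\mathbb R^n$; functions on $\mathcal M$ are graded commutative polynomials in the coordinates of positive degree with smooth functions of the degree-zero coordinates as coefficients. Let $\partial_\alpha=\partial/\partial q^\alpha$ be the left derivatives and $Q=Q^\alpha\partial_\alpha$ a vector field of degree $+1$ on $\mathcal M$. A gauge field is a family of forms $A^\alpha\in\Omega^{|\alpha|}(W)$ (the $0$-forms taking values in the body of $\mathcal M$), with field strengths $F^\alpha=\mathrm dA^\alpha-Q^\alpha(A)$. Let $\mathcal A$ be the graded commutative algebra generated by symbols $A^\alpha,\mathrm dA^\alpha$ over $\Omega(W)$ (with smooth functions of the $A^\alpha$ of degree $0$ allowed), with its differential $\mathrm d$, and let $\mathcal I\subset\mathcal A$ be the ideal generated by the $F^\alpha$. For parameters $\varepsilon=(\varepsilon^\alpha)$, $\varepsilon^\alpha\in\Omega^{|\alpha|-1}(W)$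 (so $\varepsilon^\alpha=0$ if $|\alpha|=0$), consider $$\delta_\varepsilon A^\alpha=\delta^{(0)}_\varepsilon A^\alpha+O^\alpha_\varepsilon,\qquad \delta^{(0)}_\varepsilon A^\alpha=\mathrm d\varepsilon^\alpha+\varepsilon^\beta\,V^\alpha_\beta(A),$$ with functions $V^\alpha_\beta$ on $\mathcal M$ of degree $|\alpha|-|\beta|+1$ and elements $O^\alpha_\varepsilon\in\mathcal I$ of degree $|\alpha|$, extended to a derivation $\delta_\varepsilon$ of $\mathcal A$ that commutes with $\mathrm d$ and vanishes on $\Omega(W)$. On $T[1]W\times\mathcal M$ put $Q_{tot}=\mathrm d+Q$, and regard $\delta^{(0)}_\varepsilon$ as the vertical vector field $(\mathrm d\varepsilon^\alpha+\varepsilon^\beta V^\alpha_\beta)\partial_\alpha$. **Theorem.** Assume $d\ge p+1$. (1) If $Q^2=0$, then the following are equivalent: (a) $\delta_\varepsilon\mathcal I\subset\mathcal I$ for all $\varepsilon$; (b) $\delta_\varepsilon F^\alpha|_{F=0}=0$: for all $\varepsilon$, all gauge fields $A$ and all $\sigma\in W$, if all $F^\beta$ vanish at $\sigma$ then so do all $\delta_\varepsilon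 F^\alpha$; (c) the coefficients of the gauge transformations are those of $Q$: $V^\alpha_\beta=\partial_\beta Q^\alpha$ for all $\alpha$ and all $\beta$ with $|\beta|\ge1$; (d) $\delta^{(0)}_\varepsilon=[Q_{tot},\varepsilon^\alpha\partial_\alpha]$ for all $\varepsilon$; (e) for every $\varepsilon$ there is a vertical vector field $\epsilon$ of degree $-1$ on $T[1]W\times\mathcal M$ with $\delta^{(0)}_\varepsilon=[Q_{tot},\epsilon]$; (f) for every $\varepsilon$ there is such an $\epsilon$ for which $\delta_\varepsilon A^\alpha$ agrees with $[Q_{tot},\epsilon]q^\alpha$, evaluated on $A$, modulo $\mathcal I$, for all $\alpha$. (2) If $O^\alpha_\varepsilon=0$ for all $\varepsilon,\alpha$, then, without assuming $Q^2=0$, conditions (a) and (b) are equivalent to each other, to "$Q^2=0$ and (c)", and to "$Q^2=0$ and (e)"; in particular, (a) implies $Q^2=0$ and the generalized Bianchi identities $\mathrm d\mathcal I\subset\mathcal I$. -/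

import Mathlib

open TopologicalSpace
open scoped TensorProduct ContDiff

noncomputable section

/-! ## Smooth functions on an open subset of a coordinate space -/

/-- The algebra of smooth real functions on an open set `U` of `ℝ^B`. -/
def smoothFns {B : Type} [Fintype B] (U : Opens (B → ℝ)) : Subalgebra ℝ (U → ℝ) where
  carrier := {f | ContDiffOn ℝ ∞ (Function.extend Subtype.val f 0) (U : Set (B → ℝ))}
  mul_mem' := by
    intro f g hf hg
    refine (hf.mul hg).congr ?_
    intro x hx
    have h := fun k : U → ℝ => Subtype.val_injective.extend_apply k (0 : (B → ℝ) → ℝ) ⟨x, hx⟩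
    simp only at h
    simp [h]
  add_mem' := by
    intro f g hf hg
    refine (hf.add hg).congr ?_
    intro x hx
    have h := fun k : U → ℝ => Subtype.val_injective.extend_apply k (0 : (B → ℝ) → ℝ) ⟨x, hx⟩
    simp only at h
    simp [h]
  algebraMap_mem' := by
    intro r
    refine (contDiffOn_const (c := r)).congr ?_
    intro x hx
    have h := fun k : U → ℝ => Subtype.val_injective.extend_apply k (0 : (B → ℝ) → ℝ) ⟨x, hx⟩
    simp only at h
    simp [h]

theorem extend_eqOn {B : Type} [Fintype B] (U : Opens (B → ℝ)) (f : U → ℝ)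
    {x : B → ℝ} (hx : x ∈ U) : Function.extend Subtype.val f 0 x = f ⟨x, hx⟩ :=
  Subtype.val_injective.extend_apply f (0 : (B → ℝ) → ℝ) ⟨x, hx⟩

theorem smooth_differentiableAt {B : Type} [Fintype B] {U : Opens (B → ℝ)} (f : smoothFns U)
    (x : U) : DifferentiableAt ℝ (Function.extend Subtype.val (f : U → ℝ) 0) (x : B → ℝ) :=
  ((f.2 : ContDiffOn ℝ ∞ _ _).contDiffAt (U.isOpen.mem_nhds x.2)).differentiableAt (by simp)

open Classical in
/-- The partial derivative `∂/∂x^i` on smooth functions. -/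
def smoothPd {B : Type} [Fintype B] {U : Opens (B → ℝ)} (i : B) :
    smoothFns U →ₗ[ℝ] smoothFns U where
  toFun f := ⟨fun x => fderiv ℝ (Function.extend Subtype.val (f : U → ℝ) 0) (x : B → ℝ)
      (Pi.single i 1), by
    have h1 : ContDiffOn ℝ ∞ (fun x : B → ℝ =>
        fderiv ℝ (Function.extend Subtype.val (f : U → ℝ) 0) x (Pi.single i 1))
        (U : Set (B → ℝ)) :=
      ((f.2 : ContDiffOn ℝ ∞ _ _).fderiv_of_isOpen U.isOpen (by simp)).clm_apply
        contDiffOn_const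
    exact h1.congr fun x hx => extend_eqOn U _ hx⟩
  map_add' f g := by
    ext x
    have h : Function.extend Subtype.val ((f + g : smoothFns U) : U → ℝ) 0 =ᶠ[nhds (x : B → ℝ)]
        Function.extend Subtype.val (f : U → ℝ) 0 + Function.extend Subtype.val (g : U → ℝ) 0 := by
      filter_upwards [U.isOpen.mem_nhds x.2] with y hy
      simp [extend_eqOn U _ hy]
    change fderiv ℝ (Function.extend Subtype.val ((f + g : smoothFns U) : U → ℝ) 0) (x : B → ℝ)
      (Pi.single i 1) = _
    rw [h.fderiv_eq, fderiv_add (smooth_differentiableAt f x) (smooth_differentiableAt g x)]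
    rfl
  map_smul' r f := by
    ext x
    have h : Function.extend Subtype.val ((r • f : smoothFns U) : U → ℝ) 0 =ᶠ[nhds (x : B → ℝ)]
        r • Function.extend Subtype.val (f : U → ℝ) 0 := by
      filter_upwards [U.isOpen.mem_nhds x.2] with y hy
      simp [extend_eqOn U _ hy]
    change fderiv ℝ (Function.extend Subtype.val ((r • f : smoothFns U) : U → ℝ) 0) (x : B → ℝ)
      (Pi.single i 1) = _
    rw [h.fderiv_eq, fderiv_const_smul (smooth_differentiableAt f x)]
    rfl

/-- The coordinate `x^i` as a smooth function. -/
def smoothCoord {B : Type} [Fintype B] {U : Opens (B → ℝ)} (i : B) : smoothFns U :=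
  ⟨fun x => (x : B → ℝ) i, by
    have h1 : ContDiffOn ℝ ∞ (fun x : B → ℝ => x i) (U : Set (B → ℝ)) :=
      (contDiff_apply ℝ ℝ i).contDiffOn
    exact h1.congr fun x hx => extend_eqOn U _ hx⟩

/-- Evaluation of smooth functions at a point. -/
def smoothEval {B : Type} [Fintype B] {U : Opens (B → ℝ)} (x : U) : smoothFns U →ₐ[ℝ] ℝ :=
  (Pi.evalAlgHom ℝ (fun _ : U => ℝ) x).comp (smoothFns U).val

/-- Pullback of smooth functions along the coordinate projection `x ↦ x ∘ j`. -/
def smoothPull {B B' : Type} [Fintype B] [Fintype B'] {U : Opens (B → ℝ)} {U' : Opens (B' → ℝ)}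
    (j : B → B') (hU : ∀ x ∈ U', x ∘ j ∈ U) : smoothFns U →ₐ[ℝ] smoothFns U' where
  toFun f := ⟨fun x => (f : U → ℝ) ⟨(x : B' → ℝ) ∘ j, hU x x.2⟩, by
    have h0 : ContDiff ℝ ∞ (fun x : B' → ℝ => x ∘ j) :=
      contDiff_pi.2 fun i => contDiff_apply ℝ ℝ (j i)
    have h1 : ContDiffOn ℝ ∞ (fun x : B' → ℝ =>
        Function.extend Subtype.val (f : U → ℝ) 0 (x ∘ j)) (U' : Set (B' → ℝ)) :=
      (f.2 : ContDiffOn ℝ ∞ _ _).comp h0.contDiffOn hU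
    refine h1.congr fun x hx => ?_
    rw [extend_eqOn U' _ hx, extend_eqOn U _ (hU x hx)]⟩
  map_one' := rfl
  map_mul' _ _ := rfl
  map_zero' := rfl
  map_add' _ _ := rfl
  commutes' _ := rfl

/-! ## Coordinate domains of N-manifolds -/

/-- A coordinate domain of an N-manifold (a non-negatively graded manifold): coordinates `x^i`
(`i : B`) of degree `0`, ranging over an open set `U`, finitely many coordinates of positive even
degree (indexed by `E`), and finitely many coordinates of odd degree (indexed by `O`). -/
structure GradedDomain where
  B : Type
  E : Type
  O : Type
  [finB : Fintype B]
  [finE : Fintype E]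
  [finO : Fintype O]
  degE : E → ℕ
  degO : O → ℕ
  degE_pos : ∀ e, 0 < degE e
  degE_even : ∀ e, Even (degE e)
  degO_odd : ∀ o, Odd (degO o)
  U : Opens (B → ℝ)

namespace GradedDomain

attribute [instance] finB finE finO

/-- The index set of all coordinates `q^α`. -/
abbrev Coord (D : GradedDomain) : Type := D.B ⊕ (D.E ⊕ D.O)

/-- The degree `|α|` of the coordinate `q^α`. -/
def deg (D : GradedDomain) : D.Coord → ℕ
  | .inl _ => 0
  | .inr (.inl e) => D.degE e
  | .inr (.inr o) => D.degO o

/-- The part of the function algebra generated by the coordinates of positive degree: polynomials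
in the even ones tensor the exterior algebra in the odd ones. -/
abbrev Fiber (D : GradedDomain) : Type :=
  MvPolynomial D.E ℝ ⊗[ℝ] ExteriorAlgebra ℝ (D.O →₀ ℝ)

/-- The graded commutative algebra of functions on a graded domain: smooth functions of the
degree zero coordinates, tensor polynomials in the coordinates of positive even degree, tensor the
exterior algebra in the odd coordinates. -/
def Fn (D : GradedDomain) : Type := smoothFns D.U ⊗[ℝ] D.Fiber

instance (D : GradedDomain) : Ring D.Fn := inferInstanceAs (Ring (smoothFns D.U ⊗[ℝ] D.Fiber))

instance (D : GradedDomain) : Algebra ℝ D.Fn :=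
  inferInstanceAs (Algebra ℝ (smoothFns D.U ⊗[ℝ] D.Fiber))

/-- The coordinate `q^α` as a function. -/
def q (D : GradedDomain) : D.Coord → D.Fn
  | .inl i => (smoothCoord i : smoothFns D.U) ⊗ₜ[ℝ] (1 : D.Fiber)
  | .inr (.inl e) => (1 : smoothFns D.U) ⊗ₜ[ℝ]
      ((MvPolynomial.X e ⊗ₜ[ℝ] (1 : ExteriorAlgebra ℝ (D.O →₀ ℝ)) : D.Fiber))
  | .inr (.inr o) => (1 : smoothFns D.U) ⊗ₜ[ℝ]
      (((1 : MvPolynomial D.E ℝ) ⊗ₜ[ℝ] ExteriorAlgebra.ι ℝ (Finsupp.single o 1) : D.Fiber))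

/-- The left partial derivative `∂_α = ∂/∂q^α`. For an odd coordinate it is the contraction of the
exterior algebra; no signs arise from the other two tensor factors, which are even. -/
def pd (D : GradedDomain) : D.Coord → (D.Fn →ₗ[ℝ] D.Fn)
  | .inl i => (LinearMap.rTensor D.Fiber (smoothPd i) :
      smoothFns D.U ⊗[ℝ] D.Fiber →ₗ[ℝ] smoothFns D.U ⊗[ℝ] D.Fiber)
  | .inr (.inl e) => (LinearMap.lTensor (smoothFns D.U)
      (LinearMap.rTensor (ExteriorAlgebra ℝ (D.O →₀ ℝ))
        (MvPolynomial.pderiv (R := ℝ) e).toLinearMap) :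
      smoothFns D.U ⊗[ℝ] D.Fiber →ₗ[ℝ] smoothFns D.U ⊗[ℝ] D.Fiber)
  | .inr (.inr o) => (LinearMap.lTensor (smoothFns D.U)
      (LinearMap.lTensor (MvPolynomial D.E ℝ)
        (CliffordAlgebra.contractLeft (Q := (0 : QuadraticForm ℝ (D.O →₀ ℝ)))
          (Finsupp.lapply o))) :
      smoothFns D.U ⊗[ℝ] D.Fiber →ₗ[ℝ] smoothFns D.U ⊗[ℝ] D.Fiber)

/-- The value of a function at a point `x` of the body, an element of the fibre algebra. -/
def evalAt (D : GradedDomain) (x : D.U) : D.Fn →ₐ[ℝ] D.Fiber :=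
  (Algebra.TensorProduct.lid ℝ D.Fiber).toAlgHom.comp
    (Algebra.TensorProduct.map (smoothEval x) (AlgHom.id ℝ D.Fiber) :
      smoothFns D.U ⊗[ℝ] D.Fiber →ₐ[ℝ] ℝ ⊗[ℝ] D.Fiber)

/-- A vector field `v = v^α ∂_α`, given by its (left) components `v^α`. -/
abbrev VectorField (D : GradedDomain) : Type := D.Coord → D.Fn

/-- The operator `f ↦ v^α ∂_α f` on functions given by a vector field. -/
def act {D : GradedDomain} (v : D.VectorField) : D.Fn →ₗ[ℝ] D.Fn :=
  ∑ α, (LinearMap.mulLeft ℝ (v α)).comp (D.pd α)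

/-- The Euler vector field `|α| q^α ∂_α`. -/
def euler (D : GradedDomain) : D.VectorField := fun α => (D.deg α : ℝ) • D.q α

/-- `f` is homogeneous of degree `k` (for `k < 0` this means `f = 0`). -/
def IsHomog {D : GradedDomain} (k : ℤ) (f : D.Fn) : Prop := act D.euler f = (k : ℝ) • f

/-- The vector field `v` has degree `k`, i.e. it raises the degree of functions by `k`. -/
def HasDegree {D : GradedDomain} (v : D.VectorField) (k : ℤ) : Prop :=
  ∀ α, IsHomog ((D.deg α : ℤ) + k) (v α)

/-- The graded commutator of two vector fields of odd degree, as an operator on functions. -/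
def oddBracket {D : GradedDomain} (v w : D.VectorField) : D.Fn →ₗ[ℝ] D.Fn :=
  act v ∘ₗ act w + act w ∘ₗ act v

/-- The condition `v² = 0` for an odd vector field. -/
def SquareZero {D : GradedDomain} (v : D.VectorField) : Prop := act v ∘ₗ act v = 0

/-! ## Coordinate projections, products and shifted tangent bundles -/

/-- A projection of `D'` to `D` that forgets some of the coordinates. -/
structure Proj (D D' : GradedDomain) where
  jB : D.B → D'.B
  jE : D.E → D'.E
  jO : D.O → D'.O
  mem : ∀ x ∈ D'.U, x ∘ jB ∈ D.U

/-- Pullback of functions along a coordinate projection. -/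
def Proj.pull {D D' : GradedDomain} (π : Proj D D') : D.Fn →ₐ[ℝ] D'.Fn :=
  (Algebra.TensorProduct.map (smoothPull π.jB π.mem)
    (Algebra.TensorProduct.map (MvPolynomial.rename π.jE)
      (ExteriorAlgebra.map (Finsupp.lmapDomain ℝ ℝ π.jO))) :
    smoothFns D.U ⊗[ℝ] D.Fiber →ₐ[ℝ] smoothFns D'.U ⊗[ℝ] D'.Fiber)

/-- The product of two graded domains. -/
def prod (D D' : GradedDomain) : GradedDomain where
  B := D.B ⊕ D'.B
  E := D.E ⊕ D'.E
  O := D.O ⊕ D'.O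
  degE := Sum.elim D.degE D'.degE
  degO := Sum.elim D.degO D'.degO
  degE_pos := by rintro (e | e); exacts [D.degE_pos e, D'.degE_pos e]
  degE_even := by rintro (e | e); exacts [D.degE_even e, D'.degE_even e]
  degO_odd := by rintro (o | o); exacts [D.degO_odd o, D'.degO_odd o]
  U := ⟨{x | x ∘ Sum.inl ∈ D.U ∧ x ∘ Sum.inr ∈ D'.U}, by
    have h1 : Continuous fun x : D.B ⊕ D'.B → ℝ => x ∘ (Sum.inl : D.B → D.B ⊕ D'.B) :=
      continuous_pi fun i => continuous_apply _
    have h2 : Continuous fun x : D.B ⊕ D'.B → ℝ => x ∘ (Sum.inr : D'.B → D.B ⊕ D'.B) :=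
      continuous_pi fun i => continuous_apply _
    exact (D.U.isOpen.preimage h1).inter (D'.U.isOpen.preimage h2)⟩

/-- The projection of a product to its first factor. -/
def fst (D D' : GradedDomain) : Proj D (D.prod D') where
  jB := Sum.inl
  jE := Sum.inl
  jO := Sum.inl
  mem := fun _ hx => hx.1

/-- The projection of a product to its second factor. -/
def snd (D D' : GradedDomain) : Proj D' (D.prod D') where
  jB := Sum.inr
  jE := Sum.inr
  jO := Sum.inr
  mem := fun _ hx => hx.2

/-- The coordinates of the first factor, as coordinates of the product. -/
def inFst (D D' : GradedDomain) : D.Coord → (D.prod D').Coord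
  | .inl i => .inl (.inl i)
  | .inr (.inl e) => .inr (.inl (.inl e))
  | .inr (.inr o) => .inr (.inr (.inl o))

/-- The coordinates of the second factor, as coordinates of the product. -/
def inSnd (D D' : GradedDomain) : D'.Coord → (D.prod D').Coord
  | .inl i => .inl (.inr i)
  | .inr (.inl e) => .inr (.inl (.inr e))
  | .inr (.inr o) => .inr (.inr (.inr o))

/-- The vector field on a product with components `v` along the coordinates of the first factor
and components `w` along the coordinates of the second factor. -/
def join (D D' : GradedDomain) (v : D.Coord → (D.prod D').Fn) (w : D'.Coord → (D.prod D').Fn) :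
    (D.prod D').VectorField
  | .inl (.inl i) => v (.inl i)
  | .inl (.inr i) => w (.inl i)
  | .inr (.inl (.inl e)) => v (.inr (.inl e))
  | .inr (.inl (.inr e)) => w (.inr (.inl e))
  | .inr (.inr (.inl o)) => v (.inr (.inr o))
  | .inr (.inr (.inr o)) => w (.inr (.inr o))

/-- The vector field `v + w` on a product, for vector fields `v`, `w` on the two factors. -/
def sumField {D D' : GradedDomain} (v : D.VectorField) (w : D'.VectorField) :
    (D.prod D').VectorField :=
  join D D' (fun α => (fst D D').pull (v α)) (fun β => (snd D D').pull (w β))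

/-- The shifted tangent bundle `T[1]D`, with coordinates `q^α` and `dq^α`, where `dq^α` has degree
`|α| + 1`. -/
def T1 (D : GradedDomain) : GradedDomain where
  B := D.B
  E := D.E ⊕ D.O
  O := D.O ⊕ (D.B ⊕ D.E)
  degE := Sum.elim D.degE (fun o => D.degO o + 1)
  degO := Sum.elim D.degO (Sum.elim (fun _ => 1) (fun e => D.degE e + 1))
  degE_pos := by rintro (e | o); exacts [D.degE_pos e, Nat.succ_pos _]
  degE_even := by rintro (e | o); exacts [D.degE_even e, (D.degO_odd o).add_one]
  degO_odd := by rintro (o | i | e); exacts [D.degO_odd o, odd_one, (D.degE_even e).add_one]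
  U := D.U

/-- The coordinate `q^α` of `T[1]D`. -/
def qT (D : GradedDomain) : D.Coord → D.T1.Coord
  | .inl i => .inl i
  | .inr (.inl e) => .inr (.inl (.inl e))
  | .inr (.inr o) => .inr (.inr (.inl o))

/-- The coordinate `dq^α` of `T[1]D`. -/
def dqT (D : GradedDomain) : D.Coord → D.T1.Coord
  | .inl i => .inr (.inr (.inr (.inl i)))
  | .inr (.inl e) => .inr (.inr (.inr (.inr e)))
  | .inr (.inr o) => .inr (.inl (.inr o))

/-- The vector field on `T[1]D` with components `v` along the `q^α` and `w` along the `dq^α`. -/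
def joinT (D : GradedDomain) {R : Type} (v w : D.Coord → R) : D.T1.Coord → R
  | .inl i => v (.inl i)
  | .inr (.inl (.inl e)) => v (.inr (.inl e))
  | .inr (.inl (.inr o)) => w (.inr (.inr o))
  | .inr (.inr (.inl o)) => v (.inr (.inr o))
  | .inr (.inr (.inr (.inl i))) => w (.inl i)
  | .inr (.inr (.inr (.inr e))) => w (.inr (.inl e))

/-- The de Rham vector field `dq^α ∂/∂q^α` on `T[1]D`. -/
def deRham (D : GradedDomain) : D.T1.VectorField :=
  D.joinT (fun α => D.T1.q (D.dqT α)) (fun _ => 0)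

/-- An open subset of `ℝ^d` as a graded domain without coordinates of positive degree. -/
def ofOpen {d : ℕ} (W : Opens (Fin d → ℝ)) : GradedDomain where
  B := Fin d
  E := Empty
  O := Empty
  degE := Empty.elim
  degO := Empty.elim
  degE_pos := fun e => e.elim
  degE_even := fun e => e.elim
  degO_odd := fun o => o.elim
  U := W

end GradedDomain

/-! ## Higher gauge theories -/

namespace HigherGauge

open GradedDomain

/-- Differential forms on the spacetime `W`, i.e. functions on `T[1]W`. The exterior derivative
is `act (ofOpen W).deRham`. -/
abbrev Forms {d : ℕ} (W : Opens (Fin d → ℝ)) : Type := (ofOpen W).T1.Fn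

/-- The exterior derivative on `W`. -/
def extD {d : ℕ} (W : Opens (Fin d → ℝ)) : Forms W →ₗ[ℝ] Forms W := act (ofOpen W).deRham

/-- The total space `M × T[1]W` of the trivial Q-bundle over `T[1]W` with fibre `M`. -/
abbrev Tot (M : GradedDomain) {d : ℕ} (W : Opens (Fin d → ℝ)) : GradedDomain :=
  M.prod (ofOpen W).T1

/-- The vector field `Q_tot = Q + d` on `M × T[1]W`. -/
def Qtot {M : GradedDomain} {d : ℕ} (W : Opens (Fin d → ℝ)) (Q : M.VectorField) :
    (Tot M W).VectorField :=
  sumField Q (ofOpen W).deRham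

/-- A vector field on `M × T[1]W` is vertical if it has no components along `T[1]W`. -/
def IsVertical {M : GradedDomain} {d : ℕ} {W : Opens (Fin d → ℝ)}
    (v : (Tot M W).VectorField) : Prop :=
  ∀ μ, v (inSnd M (ofOpen W).T1 μ) = 0

/-- The graded domain `T[1]M × T[1]W`, with coordinates `A^α`, `dA^α` and the coordinates of
`T[1]W`. -/
abbrev Jet (M : GradedDomain) {d : ℕ} (W : Opens (Fin d → ℝ)) : GradedDomain :=
  M.T1.prod (ofOpen W).T1

/-- The graded commutative algebra generated by abstract elements `A^α` and `dA^α`, with smooth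
functions of the degree zero `A^i` and with differential forms on `W` as coefficients. -/
abbrev Alg (M : GradedDomain) {d : ℕ} (W : Opens (Fin d → ℝ)) : Type := (Jet M W).Fn

/-- The exterior derivative on `Alg M W`: it sends `A^α` to `dA^α` and is the exterior derivative
on the coefficient forms. -/
def dAlg (M : GradedDomain) {d : ℕ} (W : Opens (Fin d → ℝ)) : Alg M W →ₗ[ℝ] Alg M W :=
  act (sumField M.deRham (ofOpen W).deRham)

/-- The projection `T[1]M × T[1]W → M × T[1]W`. -/
def jetToTot (M : GradedDomain) {d : ℕ} (W : Opens (Fin d → ℝ)) : Proj (Tot M W) (Jet M W) where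
  jB := id
  jE := Sum.map Sum.inl id
  jO := Sum.map Sum.inl id
  mem := fun _ hx => hx

/-- The gauge field `A^α` as an element of the algebra. -/
def genA (M : GradedDomain) {d : ℕ} (W : Opens (Fin d → ℝ)) (α : M.Coord) : Alg M W :=
  (Jet M W).q (inFst M.T1 (ofOpen W).T1 (M.qT α))

/-- The generator `dA^α` of the algebra. -/
def genDA (M : GradedDomain) {d : ℕ} (W : Opens (Fin d → ℝ)) (α : M.Coord) : Alg M W :=
  (Jet M W).q (inFst M.T1 (ofOpen W).T1 (M.dqT α))

/-- A function on `M`, evaluated on the gauge fields. -/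
def onFields (M : GradedDomain) {d : ℕ} (W : Opens (Fin d → ℝ)) : M.Fn →ₐ[ℝ] Alg M W :=
  (jetToTot M W).pull.comp (fst M (ofOpen W).T1).pull

/-- The field strength `F^α = dA^α - Q^α(A)`. -/
def fieldStrength {M : GradedDomain} {d : ℕ} (W : Opens (Fin d → ℝ)) (Q : M.VectorField)
    (α : M.Coord) : Alg M W :=
  genDA M W α - onFields M W (Q α)

/-- The field strength ideal. The algebra is graded commutative and the generators are homogeneous
when `Q` has degree one, so that the left ideal they generate is the two-sided one. -/
def fieldIdeal {M : GradedDomain} {d : ℕ} (W : Opens (Fin d → ℝ)) (Q : M.VectorField) :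
    Ideal (Alg M W) :=
  Ideal.span (Set.range (fieldStrength W Q))

/-- The generalized Bianchi identities: the field strength ideal is a differential ideal. -/
def Bianchi {M : GradedDomain} {d : ℕ} (W : Opens (Fin d → ℝ)) (Q : M.VectorField) : Prop :=
  ∀ G ∈ fieldIdeal W Q, dAlg M W G ∈ fieldIdeal W Q

/-- Gauge parameters: differential forms `ε^α` on `W` of degree `|α| - 1` (so `ε^α = 0` if
`|α| = 0`). -/
structure GaugeParam (M : GradedDomain) {d : ℕ} (W : Opens (Fin d → ℝ)) where
  form : M.Coord → Forms W
  homog : ∀ α, IsHomog ((M.deg α : ℤ) - 1) (form α)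

/-- A differential form on `W`, as a function on `M × T[1]W`. -/
def formToTot (M : GradedDomain) {d : ℕ} (W : Opens (Fin d → ℝ)) :
    Forms W →ₐ[ℝ] (Tot M W).Fn :=
  (snd M (ofOpen W).T1).pull

/-- The principal part `dε^α + ε^β V^α_β` of the gauge transformations with coefficient functions
`V^α_β` (written `V α β`), as a vertical vector field on `M × T[1]W`. -/
def principal {M : GradedDomain} {d : ℕ} {W : Opens (Fin d → ℝ)} (V : M.Coord → M.Coord → M.Fn)
    (ε : GaugeParam M W) : (Tot M W).VectorField :=
  join M (ofOpen W).T1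
    (fun α => formToTot M W (extD W (ε.form α)) +
      ∑ β, formToTot M W (ε.form β) * (fst M (ofOpen W).T1).pull (V α β))
    (fun _ => 0)

/-- Possible additional terms `O(F)`: for every gauge parameter and every `α` an element of the
field strength ideal of degree `|α|`. -/
structure IdealTerms {M : GradedDomain} {d : ℕ} (W : Opens (Fin d → ℝ)) (Q : M.VectorField) where
  term : GaugeParam M W → M.Coord → Alg M W
  mem : ∀ ε α, term ε α ∈ fieldIdeal W Q
  homog : ∀ ε α, IsHomog (M.deg α : ℤ) (term ε α)

/-- The absence of additional terms. -/
def noTerms {M : GradedDomain} {d : ℕ} (W : Opens (Fin d → ℝ)) (Q : M.VectorField) :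
    IdealTerms W Q where
  term := fun _ _ => 0
  mem := fun _ _ => Ideal.zero_mem _
  homog := fun _ _ => by simp [IsHomog]

/-- The variation `δ_ε A^α = dε^α + ε^β V^α_β(A) + O(F)`. -/
def variation {M : GradedDomain} {d : ℕ} {W : Opens (Fin d → ℝ)} {Q : M.VectorField}
    (V : M.Coord → M.Coord → M.Fn) (T : IdealTerms W Q) (ε : GaugeParam M W) (α : M.Coord) :
    Alg M W :=
  (jetToTot M W).pull (principal V ε (inFst M (ofOpen W).T1 α)) + T.term ε α

/-- The gauge transformation `δ_ε`, as a derivation of the algebra: it is given by `variation` on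
`A^α`, commutes with `d` on `A^α`, and vanishes on the differential forms on `W`. -/
def gaugeTrafo {M : GradedDomain} {d : ℕ} {W : Opens (Fin d → ℝ)} {Q : M.VectorField}
    (V : M.Coord → M.Coord → M.Fn) (T : IdealTerms W Q) (ε : GaugeParam M W) :
    Alg M W →ₗ[ℝ] Alg M W :=
  act (join M.T1 (ofOpen W).T1
    (M.joinT (fun α => variation V T ε α) (fun α => dAlg M W (variation V T ε α)))
    (fun _ => 0))

/-- The gauge transformations preserve the field strength ideal. -/
def PreservesIdeal {M : GradedDomain} {d : ℕ} {W : Opens (Fin d → ℝ)} {Q : M.VectorField}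
    (V : M.Coord → M.Coord → M.Fn) (T : IdealTerms W Q) : Prop :=
  ∀ ε : GaugeParam M W, ∀ G ∈ fieldIdeal W Q, gaugeTrafo V T ε G ∈ fieldIdeal W Q

/-- A configuration of the gauge fields on `W`, given through the evaluation of the elements of the
algebra on it: a degree preserving morphism of algebras that commutes with `d` and is the identity
on the differential forms on `W`. It is determined by the forms `A^α` of degree `|α|` that are the
images of the generators, and these are arbitrary (with the scalar fields taking values in the
body of `M`). -/
structure FieldConfig (M : GradedDomain) {d : ℕ} (W : Opens (Fin d → ℝ)) where
  hom : Alg M W →ₐ[ℝ] Forms W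
  map_homog : ∀ (k : ℤ) (G : Alg M W), IsHomog k G → IsHomog k (hom G)
  map_d : ∀ G, hom (dAlg M W G) = extD W (hom G)
  map_form : ∀ η : Forms W, hom ((snd M.T1 (ofOpen W).T1).pull η) = η

/-- `δ_ε F^α |_{F = 0} = 0`: for all gauge parameters and all field configurations whose field
strengths vanish at a point, the gauge variations of the field strengths vanish there, too. -/
def VanishesOnShell {M : GradedDomain} {d : ℕ} {W : Opens (Fin d → ℝ)} {Q : M.VectorField}
    (V : M.Coord → M.Coord → M.Fn) (T : IdealTerms W Q) : Prop :=
  ∀ (ε : GaugeParam M W) (a : FieldConfig M W) (σ : (ofOpen W).T1.U),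
    (∀ β, (ofOpen W).T1.evalAt σ (a.hom (fieldStrength W Q β)) = 0) →
    ∀ α, (ofOpen W).T1.evalAt σ (a.hom (gaugeTrafo V T ε (fieldStrength W Q α))) = 0

/-- The coefficients `V^α_β` of the gauge transformations agree with the coefficients
`∂_β Q^α` of `Q`, for all `β` with `|β| ≥ 1`. -/
def CoeffsAgree {M : GradedDomain} (Q : M.VectorField) (V : M.Coord → M.Coord → M.Fn) : Prop :=
  ∀ α β, 1 ≤ M.deg β → V α β = M.pd β (Q α)

/-- The vertical vector field `ε^α ∂_α` on `M × T[1]W`. -/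
def paramField {M : GradedDomain} {d : ℕ} {W : Opens (Fin d → ℝ)} (ε : GaugeParam M W) :
    (Tot M W).VectorField :=
  join M (ofOpen W).T1 (fun α => formToTot M W (ε.form α)) (fun _ => 0)

/-- The principal part with parameter `ε` is the inner automorphism `[Q_tot, ε^α ∂_α]`. -/
def IsInnerByParam {M : GradedDomain} {d : ℕ} (W : Opens (Fin d → ℝ)) (Q : M.VectorField)
    (V : M.Coord → M.Coord → M.Fn) : Prop :=
  ∀ ε : GaugeParam M W, act (principal V ε) = oddBracket (Qtot W Q) (paramField ε)

/-- For every parameter the principal part is some vertical inner automorphism `[Q_tot, v]`, with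
`v` a vertical vector field of degree `-1`. -/
def IsInner {M : GradedDomain} {d : ℕ} (W : Opens (Fin d → ℝ)) (Q : M.VectorField)
    (V : M.Coord → M.Coord → M.Fn) : Prop :=
  ∀ ε : GaugeParam M W, ∃ v : (Tot M W).VectorField, IsVertical v ∧ HasDegree v (-1) ∧
    act (principal V ε) = oddBracket (Qtot W Q) v

/-- For every parameter the gauge transformation is, up to terms in the field strength ideal, some
vertical inner automorphism `[Q_tot, v]`, with `v` a vertical vector field of degree `-1`. -/
def IsInnerModIdeal {M : GradedDomain} {d : ℕ} {W : Opens (Fin d → ℝ)} {Q : M.VectorField}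
    (V : M.Coord → M.Coord → M.Fn) (T : IdealTerms W Q) : Prop :=
  ∀ ε : GaugeParam M W, ∃ v : (Tot M W).VectorField, IsVertical v ∧ HasDegree v (-1) ∧
    ∀ α, variation V T ε α - (jetToTot M W).pull (oddBracket (Qtot W Q) v
      ((Tot M W).q (inFst M (ofOpen W).T1 α))) ∈ fieldIdeal W Q

end HigherGauge

end

/-! Everything turns on one formula. If d maps the terms `O^α_ε` into the ideal I of field
strengths, then modulo I `δF^α ≡ dε^β (V^α_β - ∂_β Q^α) + ε^β (± Q V^α_β - V^γ_β ∂_γ Q^α)`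
(`gaugeTrafo_fieldStrength_sub_mem`). The proviso holds by the Bianchi identities when `Q² = 0`, and
trivially when there are no such terms; this is what keeps part (2) from assuming the `Q² = 0` that
it proves.

Sufficiency is formal. Since `dA^α = F^α + Q^α(A)`, the differential d is `Q_tot` up to I
(`dAlg_jetToTot`), and `Q² = 0` makes I a differential ideal (`bianchi`). If `δA` is `[Q_tot, v]`
modulo I, then `[Q_tot, v]` commutes with `Q_tot` because `Q_tot² = 0`, so δ commutes with `Q_tot`
modulo I, and hence δF lies in I (`preservesIdeal_of_isInnerModIdeal`).

Necessity evaluates the formula at a point σ. There are gauge fields with any prescribed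
constant-coefficient values at σ and with F = 0 at σ, because `dA(σ)` can be adjusted independently
of `A(σ)` (`exists_fieldConfig_onShell`). A parameter that vanishes at σ and whose differential
there is a monomial of length |β| isolates `V^α_β - ∂_β Q^α`; a constant monomial of length |β| - 1
then isolates `∂_β(Q Q^α)`. What is left is that a function f on M vanishes if `dσ^J f(a) = 0` for
all values a. This holds as soon as |J| + deg f ≤ d (`eq_zero_of_pointMap`): shifting one coordinate
by a monomial of square zero in unused differentials turns f into one of its derivatives, and the
degree drops. In both cases the budget is |α| + 1 ≤ p + 1 ≤ d.

The function algebra is only graded commutative, so the sign rules, the Leibniz rule and the chain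
rule are obtained by induction over generators (`Fn.induction`). Degrees are eigenvalues of the
Euler field, and independence of eigenspaces shows that there is nothing in negative degree, that
degree zero consists of smooth functions, and that degree determines parity. -/

noncomputable section

/-! ### Calculus of smooth functions on the body -/

section Smooth

variable {B B' : Type} [Fintype B] [Fintype B'] {U : Opens (B → ℝ)} {U' : Opens (B' → ℝ)}

open Classical in
theorem smoothPd_apply (i : B) (f : smoothFns U) (x : U) :
    (smoothPd i f : U → ℝ) x =
      fderiv ℝ (Function.extend Subtype.val (f : U → ℝ) 0) (x : B → ℝ) (Pi.single i 1) := by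
  unfold smoothPd
  simp only [LinearMap.coe_mk, AddHom.coe_mk]

theorem extend_eventuallyEq (f : U → ℝ) (g : (B → ℝ) → ℝ) (hfg : ∀ x : U, f x = g x) (x : U) :
    Function.extend Subtype.val f 0 =ᶠ[nhds (x : B → ℝ)] g := by
  filter_upwards [U.isOpen.mem_nhds x.2] with y hy
  rw [extend_eqOn U _ hy, hfg]

theorem smoothPd_mul (i : B) (f g : smoothFns U) :
    smoothPd i (f * g) = smoothPd i f * g + f * smoothPd i g := by
  classical
  ext x
  have h := extend_eventuallyEq ((f * g : smoothFns U) : U → ℝ)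
    (Function.extend Subtype.val (f : U → ℝ) 0 * Function.extend Subtype.val (g : U → ℝ) 0)
    (fun x => by simp) x
  have hf := extend_eqOn U (f : U → ℝ) x.2
  have hg := extend_eqOn U (g : U → ℝ) x.2
  rw [smoothPd_apply, h.fderiv_eq,
    fderiv_mul (smooth_differentiableAt f x) (smooth_differentiableAt g x), hf, hg]
  simp only [Subalgebra.coe_add, Subalgebra.coe_mul, Pi.add_apply, Pi.mul_apply, smoothPd_apply,
    add_apply, smul_apply, smul_eq_mul]
  ring

/-- As `U` is open, the derivative sees only the germ at `x`, so the extension by zero may be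
replaced by any convenient function that agrees on `U`. -/
theorem smoothPd_of_contDiff (i : B) (f : smoothFns U) (g : (B → ℝ) → ℝ)
    (hfg : ∀ x : U, (f : U → ℝ) x = g x) (x : U) [DecidableEq B] :
    (smoothPd i f : U → ℝ) x = fderiv ℝ g x (Pi.single i 1) := by
  rw [smoothPd_apply, (extend_eventuallyEq (f : U → ℝ) g hfg x).fderiv_eq]
  congr!

theorem smoothPd_coord [DecidableEq B] (i j : B) :
    smoothPd i (smoothCoord j : smoothFns U) = if i = j then 1 else 0 := by
  ext x
  rw [smoothPd_of_contDiff i (smoothCoord j) (fun x => x j) (fun x => rfl) x,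
    show fderiv ℝ (fun x : B → ℝ => x j) x = ContinuousLinearMap.proj j from
      (ContinuousLinearMap.proj (R := ℝ) (φ := fun _ : B => ℝ) j).fderiv]
  simp only [ContinuousLinearMap.proj_apply]
  split_ifs with h
  · subst h; simp
  · simp [Ne.symm h]

theorem smoothPd_algebraMap (i : B) (r : ℝ) : smoothPd i (algebraMap ℝ (smoothFns U) r) = 0 := by
  classical
  ext x
  rw [smoothPd_of_contDiff i _ (fun _ => r) (fun x => rfl) x]
  simp

theorem smoothPd_one (i : B) : smoothPd i (1 : smoothFns U) = 0 := by
  rw [← map_one (algebraMap ℝ (smoothFns U)), smoothPd_algebraMap]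

/-- Both sides are the second Fréchet derivative on two basis vectors, which is symmetric for smooth
functions. -/
theorem smoothPd_comm (i j : B) (f : smoothFns U) :
    smoothPd i (smoothPd j f) = smoothPd j (smoothPd i f) := by
  classical
  ext x
  set F := Function.extend Subtype.val (f : U → ℝ) 0 with hF
  have hc : ContDiffAt ℝ ∞ F x := (f.2 : ContDiffOn ℝ ∞ _ _).contDiffAt (U.isOpen.mem_nhds x.2)
  have key : ∀ i j : B, (smoothPd i (smoothPd j f) : U → ℝ) x =
      fderiv ℝ (fderiv ℝ F) x (Pi.single i 1) (Pi.single j 1) := by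
    intro i j
    rw [smoothPd_of_contDiff i (smoothPd j f) (fun y => fderiv ℝ F y (Pi.single j 1))
      (fun y => by rw [smoothPd_apply]) x]
    have hd : DifferentiableAt ℝ (fderiv ℝ F) x :=
      (hc.fderiv_right (m := 1) (by norm_cast)).differentiableAt (by simp)
    rw [fderiv_clm_apply hd (differentiableAt_const _)]
    simp
  rw [key, key]
  exact (hc.isSymmSndFDerivAt (by simp; exact WithTop.coe_le_coe.2 le_top)).eq _ _

/-- Composition of smooth functions with the smooth map with components `b`. -/
def smoothComp (b : B → smoothFns U') (hb : ∀ y : U', (fun i => (b i : U' → ℝ) y) ∈ U) :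
    smoothFns U →ₐ[ℝ] smoothFns U' where
  toFun f := ⟨fun y => (f : U → ℝ) ⟨fun i => (b i : U' → ℝ) y, hb y⟩, by
    have h0 : ContDiffOn ℝ ∞ (fun y : B' → ℝ => fun i =>
        Function.extend Subtype.val (b i : U' → ℝ) 0 y) (U' : Set (B' → ℝ)) :=
      contDiffOn_pi.2 fun i => (b i).2
    have hm : ∀ y (hy : y ∈ U'), (fun i => Function.extend Subtype.val (b i : U' → ℝ) 0 y) =
        fun i => (b i : U' → ℝ) ⟨y, hy⟩ := fun y hy => funext fun i => extend_eqOn U' _ hy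
    have h1 : ContDiffOn ℝ ∞ (fun y : B' → ℝ => Function.extend Subtype.val (f : U → ℝ) 0
        (fun i => Function.extend Subtype.val (b i : U' → ℝ) 0 y)) (U' : Set (B' → ℝ)) :=
      (f.2 : ContDiffOn ℝ ∞ _ _).comp h0 fun y hy => by
        change _ ∈ U
        rw [hm y hy]
        exact hb ⟨y, hy⟩
    refine h1.congr fun y hy => ?_
    rw [extend_eqOn U' _ hy, hm y hy, extend_eqOn U _ (hb ⟨y, hy⟩)]⟩
  map_one' := rfl
  map_mul' _ _ := rfl
  map_zero' := rfl
  map_add' _ _ := rfl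
  commutes' _ := rfl

theorem smoothComp_apply (b : B → smoothFns U') (hb : ∀ y : U', (fun i => (b i : U' → ℝ) y) ∈ U)
    (f : smoothFns U) (y : U') : (smoothComp b hb f : U' → ℝ) y =
      (f : U → ℝ) ⟨fun i => (b i : U' → ℝ) y, hb y⟩ := rfl

theorem smoothComp_coord (b : B → smoothFns U') (hb : ∀ y : U', (fun i => (b i : U' → ℝ) y) ∈ U)
    (i : B) : smoothComp b hb (smoothCoord i) = b i := rfl

/-- The chain rule. -/
theorem smoothPd_comp (b : B → smoothFns U') (hb : ∀ y : U', (fun i => (b i : U' → ℝ) y) ∈ U)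
    (f : smoothFns U) (j : B') : smoothPd j (smoothComp b hb f) =
      ∑ i, smoothPd j (b i) * smoothComp b hb (smoothPd i f) := by
  classical
  ext y
  set F := Function.extend Subtype.val (f : U → ℝ) 0 with hF
  set G : (B' → ℝ) → B → ℝ := fun y i => Function.extend Subtype.val (b i : U' → ℝ) 0 y with hG
  have hm : ∀ y (hy : y ∈ U'), G y = fun i => (b i : U' → ℝ) ⟨y, hy⟩ :=
    fun y hy => funext fun i => extend_eqOn U' _ hy
  have e : Function.extend Subtype.val (smoothComp b hb f : U' → ℝ) 0 =ᶠ[nhds (y : B' → ℝ)]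
      F ∘ G := by
    filter_upwards [U'.isOpen.mem_nhds y.2] with z hz
    rw [extend_eqOn U' _ hz, Function.comp, hm z hz, hF, extend_eqOn U _ (hb ⟨z, hz⟩)]
    rfl
  have hGy : G y = fun i => (b i : U' → ℝ) y := hm y y.2
  have dF : DifferentiableAt ℝ F (G y) := by
    rw [hGy]; exact smooth_differentiableAt f ⟨_, hb y⟩
  have dGi : ∀ i, DifferentiableAt ℝ (fun z => G z i) (y : B' → ℝ) :=
    fun i => smooth_differentiableAt (b i) y
  have dG : DifferentiableAt ℝ G y := differentiableAt_pi.2 dGi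
  rw [smoothPd_apply, e.fderiv_eq, fderiv_comp _ dF dG]
  -- This is the `j`-th column of the Jacobian of `G`; applying the linear map `fderiv ℝ F` to it
  -- term by term gives the chain rule.
  have hs : fderiv ℝ G y (Pi.single j 1) =
      ∑ i, ((smoothPd j (b i) : U' → ℝ) y) • (Pi.single i 1 : B → ℝ) := by
    ext i
    rw [fderiv_pi dGi]
    simp [Pi.single_apply]
    rw [smoothPd_apply]
  have hval : ((∑ i, smoothPd j (b i) * smoothComp b hb (smoothPd i f) : smoothFns U') : U' → ℝ) y
      = ∑ i, (smoothPd j (b i) : U' → ℝ) y * (smoothComp b hb (smoothPd i f) : U' → ℝ) y := by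
    simp
  rw [hval]
  simp only [ContinuousLinearMap.comp_apply]
  have hsum : (fderiv ℝ F (G y)) ((fderiv ℝ G y) (Pi.single j 1)) =
      ∑ i, ((smoothPd j (b i) : U' → ℝ) y) • fderiv ℝ F (G y) (Pi.single i 1) := by
    rw [hs, map_sum]
    simp
  convert hsum using 1
  refine Finset.sum_congr rfl fun i _ => ?_
  rw [smul_eq_mul, hGy, smoothComp_apply, smoothPd_apply i f]

end Smooth

/-! ### Koszul signs -/

/-- The sign `(-1)^(m * n)`. -/
def koszulSign (m n : ℤ) : ℝ := if Even m ∨ Even n then 1 else -1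

theorem koszulSign_comm (m n : ℤ) : koszulSign m n = koszulSign n m := by
  simp only [koszulSign, or_comm]

theorem koszulSign_add_left (a b n : ℤ) :
    koszulSign (a + b) n = koszulSign a n * koszulSign b n := by
  by_cases ha : Even a <;> by_cases hb : Even b <;> by_cases hn : Even n <;>
    simp [koszulSign, Int.even_add, ha, hb, hn]

theorem koszulSign_add_right (n a b : ℤ) :
    koszulSign n (a + b) = koszulSign n a * koszulSign n b := by
  rw [koszulSign_comm, koszulSign_add_left, koszulSign_comm a, koszulSign_comm b]

theorem koszulSign_mul_self (m n : ℤ) : koszulSign m n * koszulSign m n = 1 := by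
  by_cases h : Even m ∨ Even n <;> simp [koszulSign, h]

theorem koszulSign_zero_left (n : ℤ) : koszulSign 0 n = 1 := by simp [koszulSign]

theorem koszulSign_zero_right (n : ℤ) : koszulSign n 0 = 1 := by simp [koszulSign]

theorem koszulSign_one_one : koszulSign 1 1 = -1 := by simp [koszulSign]

/-! ### Generators of the function algebra -/

namespace GradedDomain

variable {D : GradedDomain}

/-- A smooth function of the coordinates of degree zero, as a function on `D`. -/
def emb (D : GradedDomain) : smoothFns D.U →ₐ[ℝ] D.Fn :=
  (Algebra.TensorProduct.includeLeft : smoothFns D.U →ₐ[ℝ] smoothFns D.U ⊗[ℝ] D.Fiber)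

/-- The tensor product of a smooth function and an element of the fibre algebra. -/
def pure (s : smoothFns D.U) (m : MvPolynomial D.E ℝ) (x : ExteriorAlgebra ℝ (D.O →₀ ℝ)) : D.Fn :=
  (s ⊗ₜ[ℝ] ((m ⊗ₜ[ℝ] x : D.Fiber)) : smoothFns D.U ⊗[ℝ] D.Fiber)

theorem emb_eq (s : smoothFns D.U) : D.emb s = pure s 1 1 := rfl

theorem q_inl (i : D.B) : D.q (.inl i) = D.emb (smoothCoord i) := rfl

theorem q_even (e : D.E) : D.q (.inr (.inl e)) = pure 1 (MvPolynomial.X e) 1 := rfl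

theorem q_odd (o : D.O) :
    D.q (.inr (.inr o)) = pure 1 1 (ExteriorAlgebra.ι ℝ (Finsupp.single o 1)) := rfl

theorem pure_mul_pure (s s' : smoothFns D.U) (m m' : MvPolynomial D.E ℝ)
    (x x' : ExteriorAlgebra ℝ (D.O →₀ ℝ)) :
    pure s m x * pure s' m' x' = pure (s * s') (m * m') (x * x') := by
  change ((s ⊗ₜ[ℝ] ((m ⊗ₜ[ℝ] x : D.Fiber)) : smoothFns D.U ⊗[ℝ] D.Fiber)) *
    (s' ⊗ₜ[ℝ] ((m' ⊗ₜ[ℝ] x' : D.Fiber)) : smoothFns D.U ⊗[ℝ] D.Fiber) = _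
  rw [Algebra.TensorProduct.tmul_mul_tmul, Algebra.TensorProduct.tmul_mul_tmul]
  rfl

theorem pure_zero_left (m : MvPolynomial D.E ℝ) (x : ExteriorAlgebra ℝ (D.O →₀ ℝ)) :
    pure (0 : smoothFns D.U) m x = 0 := TensorProduct.zero_tmul _ _

theorem pure_zero_mid (s : smoothFns D.U) (x : ExteriorAlgebra ℝ (D.O →₀ ℝ)) :
    pure s (0 : MvPolynomial D.E ℝ) x = 0 := by
  unfold pure
  rw [TensorProduct.zero_tmul]; exact TensorProduct.tmul_zero _ _

theorem pure_zero_right (s : smoothFns D.U) (m : MvPolynomial D.E ℝ) :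
    pure s m (0 : ExteriorAlgebra ℝ (D.O →₀ ℝ)) = 0 := by
  unfold pure
  rw [TensorProduct.tmul_zero]; exact TensorProduct.tmul_zero _ _

theorem pure_add_left (s s' : smoothFns D.U) (m : MvPolynomial D.E ℝ)
    (x : ExteriorAlgebra ℝ (D.O →₀ ℝ)) : pure (s + s') m x = pure s m x + pure s' m x :=
  TensorProduct.add_tmul _ _ _

theorem pure_add_mid (s : smoothFns D.U) (m m' : MvPolynomial D.E ℝ)
    (x : ExteriorAlgebra ℝ (D.O →₀ ℝ)) : pure s (m + m') x = pure s m x + pure s m' x := by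
  unfold pure
  rw [TensorProduct.add_tmul]; exact TensorProduct.tmul_add _ _ _

theorem pure_add_right (s : smoothFns D.U) (m : MvPolynomial D.E ℝ)
    (x x' : ExteriorAlgebra ℝ (D.O →₀ ℝ)) : pure s m (x + x') = pure s m x + pure s m x' := by
  unfold pure
  rw [TensorProduct.tmul_add]; exact TensorProduct.tmul_add _ _ _

theorem pure_smul_mid (s : smoothFns D.U) (r : ℝ) (m : MvPolynomial D.E ℝ)
    (x : ExteriorAlgebra ℝ (D.O →₀ ℝ)) : pure s (r • m) x = pure (r • s) m x := by
  have h : (((r • m) ⊗ₜ[ℝ] x : D.Fiber)) = r • (m ⊗ₜ[ℝ] x) := rfl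
  unfold pure
  rw [h]
  exact (TensorProduct.smul_tmul r s _).symm

theorem pure_smul_right (s : smoothFns D.U) (r : ℝ) (m : MvPolynomial D.E ℝ)
    (x : ExteriorAlgebra ℝ (D.O →₀ ℝ)) : pure s m (r • x) = pure (r • s) m x := by
  rw [← pure_smul_mid]
  unfold pure
  rw [TensorProduct.smul_tmul]

theorem pure_neg_right (s : smoothFns D.U) (m : MvPolynomial D.E ℝ)
    (x : ExteriorAlgebra ℝ (D.O →₀ ℝ)) : pure s m (-x) = -pure s m x := by
  rw [eq_neg_iff_add_eq_zero, ← pure_add_right, neg_add_cancel, pure_zero_right]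

theorem pure_induction {p : D.Fn → Prop} (hadd : ∀ f g, p f → p g → p (f + g))
    (hp : ∀ s m x, p (pure s m x)) (f : D.Fn) : p f := by
  refine TensorProduct.induction_on (R := ℝ) (M := smoothFns D.U) (N := D.Fiber) f ?_ ?_ hadd
  · have := hp 0 0 0
    rwa [pure_zero_left] at this
  · intro s y
    refine TensorProduct.induction_on y ?_ (fun m x => hp s m x) ?_
    · have := hp s 0 0
      rw [pure_zero_right] at this
      rw [TensorProduct.tmul_zero]
      exact this
    · intro a b ha hb
      rw [TensorProduct.tmul_add]
      exact hadd _ _ ha hb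

/-- Functions are generated by the smooth functions and the coordinates of positive degree. -/
theorem Fn.induction {p : D.Fn → Prop} (hadd : ∀ f g, p f → p g → p (f + g))
    (hemb : ∀ s, p (D.emb s)) (hq : ∀ (α : D.E ⊕ D.O) f, p f → p (D.q (.inr α) * f))
    (f : D.Fn) : p f := by
  refine pure_induction hadd (fun s m x => ?_) f
  induction m using MvPolynomial.induction_on generalizing s with
  | C a =>
    induction x using CliffordAlgebra.left_induction generalizing s a with
    | algebraMap r =>
      rw [MvPolynomial.C_eq_smul_one, Algebra.algebraMap_eq_smul_one, pure_smul_mid,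
        pure_smul_right]
      exact hemb _
    | add x y hx hy => rw [pure_add_right]; exact hadd _ _ (hx _ _) (hy _ _)
    -- The hypothesis `hq` concerns single coordinates, so `v` is expanded in the basis. Its
    -- coefficients are absorbed into the smooth factor, which is why `s` is generalized.
    | ι_mul x v hx =>
      induction v using Finsupp.induction_linear generalizing s with
      | zero =>
        rw [map_zero, zero_mul, pure_zero_right]
        simpa using hemb 0
      | add v w hv hw => rw [map_add, add_mul, pure_add_right]; exact hadd _ _ (hv _) (hw _)
      | single o r =>
        have := hq (.inr o) _ (hx a (r • s))
        rw [q_odd, pure_mul_pure, one_mul, one_mul, ← pure_smul_right] at this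
        rwa [show Finsupp.single o r = r • Finsupp.single o (1 : ℝ) by simp, map_smul,
          smul_mul_assoc]
  | add m m' h h' => rw [pure_add_mid]; exact hadd _ _ (h _) (h' _)
  | mul_X m e h =>
    have := hq (.inl e) _ (h s)
    rwa [q_even, pure_mul_pure, one_mul, one_mul, mul_comm] at this

/-- Algebra homomorphisms of functions are determined by their values on the generators. -/
theorem Fn.hom_ext {R : Type*} [Ring R] [Algebra ℝ R] {φ ψ : D.Fn →ₐ[ℝ] R}
    (hemb : ∀ s, φ (D.emb s) = ψ (D.emb s))
    (hq : ∀ α : D.E ⊕ D.O, φ (D.q (.inr α)) = ψ (D.q (.inr α))) : φ = ψ := by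
  ext f
  refine Fn.induction (p := fun f => φ f = ψ f) (fun f g hf hg => ?_) hemb (fun α f hf => ?_) f
  · rw [map_add, map_add, hf, hg]
  · rw [map_mul, map_mul, hf, hq]

/-! ### Parity -/

/-- The parity automorphism. -/
def par (D : GradedDomain) : D.Fn →ₐ[ℝ] D.Fn :=
  (Algebra.TensorProduct.map (AlgHom.id ℝ _)
    (Algebra.TensorProduct.map (AlgHom.id ℝ _) CliffordAlgebra.involute) :
    smoothFns D.U ⊗[ℝ] D.Fiber →ₐ[ℝ] smoothFns D.U ⊗[ℝ] D.Fiber)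

theorem par_pure (s : smoothFns D.U) (m : MvPolynomial D.E ℝ)
    (x : ExteriorAlgebra ℝ (D.O →₀ ℝ)) :
    D.par (pure s m x) = pure s m (CliffordAlgebra.involute x) := rfl

theorem par_emb (s : smoothFns D.U) : D.par (D.emb s) = D.emb s := by
  rw [emb_eq, par_pure, map_one]

theorem par_q (α : D.Coord) : D.par (D.q α) = koszulSign 1 (D.deg α) • D.q α := by
  rcases α with i | e | o
  · rw [q_inl, par_emb]; simp [deg, koszulSign]
  · rw [q_even, par_pure, map_one]
    simp [deg, koszulSign, D.degE_even e]
  · rw [q_odd, par_pure]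
    have h : ¬ Even (D.degO o) := by simpa using D.degO_odd o
    have h2 := CliffordAlgebra.involute_ι (Q := (0 : QuadraticForm ℝ (D.O →₀ ℝ)))
      (Finsupp.single o 1)
    change pure 1 1 (CliffordAlgebra.involute (CliffordAlgebra.ι _ _)) = _
    rw [h2, pure_neg_right]
    simp [deg, koszulSign, h]

theorem par_par (f : D.Fn) : D.par (D.par f) = f := by
  refine Fn.induction (p := fun f => D.par (D.par f) = f) (fun f g hf hg => ?_) (fun s => ?_)
    (fun α f hf => ?_) f
  · rw [map_add, map_add, hf, hg]
  · rw [par_emb, par_emb]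
  · rw [map_mul, map_mul, hf, par_q, map_smul, par_q, smul_smul, koszulSign_mul_self, one_smul]

/-- The `n`-th power of the parity automorphism. -/
def tw (D : GradedDomain) (n : ℤ) : D.Fn →ₐ[ℝ] D.Fn := if Even n then AlgHom.id ℝ _ else D.par

theorem tw_zero (f : D.Fn) : D.tw 0 f = f := by simp [tw]

theorem tw_tw (m n : ℤ) (f : D.Fn) : D.tw m (D.tw n f) = D.tw (m + n) f := by
  by_cases hm : Even m <;> by_cases hn : Even n <;>
    simp [tw, hm, hn, Int.even_add, par_par]

/-- `f` has the parity of the integer `n`. -/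
def HasPar (n : ℤ) (f : D.Fn) : Prop := D.par f = koszulSign 1 n • f

/-- On elements of definite parity the twist is a Koszul sign. Writing signs as twists allows
Leibniz and commutation rules for arbitrary elements, without splitting them into even and odd
parts. -/
theorem HasPar.tw {n : ℤ} {f : D.Fn} (h : HasPar n f) (m : ℤ) :
    D.tw m f = koszulSign m n • f := by
  by_cases hm : Even m
  · simp [GradedDomain.tw, hm, koszulSign]
  · simp only [GradedDomain.tw, hm, if_false]
    rw [h]
    simp [koszulSign, hm]

theorem hasPar_q (α : D.Coord) : HasPar (D.deg α) (D.q α) := par_q α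

theorem hasPar_emb (s : smoothFns D.U) : HasPar 0 (D.emb s) := by
  simp [HasPar, par_emb, koszulSign]

theorem HasPar.mul {m n : ℤ} {f g : D.Fn} (hf : HasPar m f) (hg : HasPar n g) :
    HasPar (m + n) (f * g) := by
  unfold HasPar at *
  rw [map_mul, hf, hg, koszulSign_add_right, smul_mul_smul_comm]

theorem HasPar.add {n : ℤ} {f g : D.Fn} (hf : HasPar n f) (hg : HasPar n g) :
    HasPar n (f + g) := by
  unfold HasPar at *
  rw [map_add, hf, hg, smul_add]

theorem HasPar.smul {n : ℤ} {f : D.Fn} (r : ℝ) (hf : HasPar n f) : HasPar n (r • f) := by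
  unfold HasPar at *
  rw [map_smul, hf, smul_comm]

theorem hasPar_zero (n : ℤ) : HasPar n (0 : D.Fn) := by simp [HasPar]

theorem ι_mul_eq_involute_mul {V : Type*} [AddCommGroup V] [Module ℝ V] (v : V)
    (x : ExteriorAlgebra ℝ V) : ExteriorAlgebra.ι ℝ v * x =
      CliffordAlgebra.involute x * ExteriorAlgebra.ι ℝ v := by
  induction x using CliffordAlgebra.left_induction with
  | algebraMap r => rw [AlgHom.commutes, Algebra.commutes]
  | add x y hx hy => rw [mul_add, hx, hy, map_add, add_mul]
  | ι_mul x w hx =>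
    have h : ExteriorAlgebra.ι ℝ v * ExteriorAlgebra.ι ℝ w =
        -(ExteriorAlgebra.ι ℝ w * ExteriorAlgebra.ι ℝ v) :=
      eq_neg_of_add_eq_zero_left (ExteriorAlgebra.ι_add_mul_swap v w)
    rw [map_mul, CliffordAlgebra.involute_ι, ← mul_assoc]
    change ExteriorAlgebra.ι ℝ v * ExteriorAlgebra.ι ℝ w * x = _
    rw [h, neg_mul, mul_assoc, hx]
    simp only [neg_mul, mul_assoc]

theorem emb_mul (s : smoothFns D.U) (g : D.Fn) : D.emb s * g = g * D.emb s := by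
  refine pure_induction (p := fun g => D.emb s * g = g * D.emb s) (fun f g hf hg => ?_)
    (fun s' m x => ?_) g
  · rw [mul_add, add_mul, hf, hg]
  · rw [emb_eq, pure_mul_pure, pure_mul_pure, mul_comm s]; simp

theorem q_mul (α : D.Coord) (g : D.Fn) : D.q α * g = D.tw (D.deg α) g * D.q α := by
  rcases α with i | e | o
  · rw [q_inl, emb_mul]; simp [deg, tw_zero]
  · have : Even (D.deg (.inr (.inl e)) : ℤ) := by simpa [deg] using D.degE_even e
    simp only [tw, this, if_true, AlgHom.id_apply]
    refine pure_induction (p := fun g => _ * g = g * _) (fun f g hf hg => ?_)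
      (fun s' m x => ?_) g
    · rw [mul_add, add_mul, hf, hg]
    · rw [q_even, pure_mul_pure, pure_mul_pure, mul_comm m]; simp
  · have : ¬ Even (D.deg (.inr (.inr o)) : ℤ) := by simpa [deg] using D.degO_odd o
    simp only [tw, this, if_false]
    refine pure_induction (p := fun g => _ * g = D.par g * _) (fun f g hf hg => ?_)
      (fun s' m x => ?_) g
    · rw [mul_add, map_add, add_mul, hf, hg]
    · rw [q_odd, par_pure, pure_mul_pure, pure_mul_pure, ι_mul_eq_involute_mul]; simp

/-- Up to a factor 2 these are the even part of `f`, which is central, and the odd part, which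
commutes up to the parity automorphism. The two claims must be proved together: multiplication by an
odd generator exchanges the two parts. -/
theorem add_par_mul_and_sub_par_mul (f g : D.Fn) : (f + D.par f) * g = g * (f + D.par f) ∧
    (f - D.par f) * g = D.par g * (f - D.par f) := by
  refine Fn.induction (p := fun f => ∀ g, (f + D.par f) * g = g * (f + D.par f) ∧
    (f - D.par f) * g = D.par g * (f - D.par f)) (fun f f' hf hf' g => ?_) (fun s g => ?_)
    (fun α f hf g => ?_) f g
  · have h1 := hf g
    have h2 := hf' g
    rw [map_add]
    constructor
    · rw [add_add_add_comm, add_mul, mul_add, h1.1, h2.1]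
    · rw [add_sub_add_comm, add_mul, mul_add, h1.2, h2.2]
  · rw [par_emb, sub_self, add_mul, mul_add, emb_mul]; simp
  · have hg := hf g
    by_cases hα : Even (D.deg (.inr α) : ℤ)
    · have hq : ∀ g, D.q (.inr α) * g = g * D.q (.inr α) := fun g => by
        rw [q_mul]; simp [tw, hα]
      have hp : D.par (D.q (.inr α)) = D.q (.inr α) := by
        rw [par_q]; simp only [koszulSign, hα, or_true, if_true, one_smul]
      rw [map_mul, hp, ← mul_add, ← mul_sub]
      constructor
      · rw [mul_assoc, hg.1, ← mul_assoc, hq, mul_assoc]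
      · rw [mul_assoc, hg.2, ← mul_assoc, hq, mul_assoc]
    · have hq : ∀ g, D.q (.inr α) * g = D.par g * D.q (.inr α) := fun g => by
        rw [q_mul]; simp [tw, hα]
      have hp : D.par (D.q (.inr α)) = -D.q (.inr α) := by
        rw [par_q]; simp [koszulSign, hα]
      rw [map_mul, hp, neg_mul, ← sub_eq_add_neg, sub_neg_eq_add, ← mul_add, ← mul_sub]
      constructor
      · rw [mul_assoc, hg.2, ← mul_assoc, hq, par_par, mul_assoc]
      · rw [mul_assoc, hg.1, ← mul_assoc, hq, mul_assoc]

/-- Graded commutativity. -/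
theorem HasPar.mul_comm' {n : ℤ} {f : D.Fn} (hf : HasPar n f) (g : D.Fn) :
    f * g = D.tw n g * f := by
  have h2 : ∀ a b : D.Fn, (2 : ℝ) • a = (2 : ℝ) • b → a = b :=
    fun a b h => smul_right_injective _ (two_ne_zero (α := ℝ)) h
  -- For `f` of definite parity one of `f ± par f` is zero and the other is `2f`, so the claim
  -- follows after cancelling 2.
  have h := add_par_mul_and_sub_par_mul f g
  unfold HasPar at hf
  by_cases hn : Even n
  · have : D.par f = f := by rw [hf]; simp [koszulSign, hn]
    rw [this] at h
    apply h2
    simp only [GradedDomain.tw, hn, if_true, AlgHom.id_apply]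
    simpa [two_smul, add_mul, mul_add] using h.1
  · have : D.par f = -f := by rw [hf]; simp [koszulSign, hn]
    rw [this] at h
    apply h2
    simp only [GradedDomain.tw, hn, if_false]
    simpa [two_smul, add_mul, mul_add] using h.2

theorem HasPar.mul_comm {m n : ℤ} {f g : D.Fn} (hf : HasPar m f) (hg : HasPar n g) :
    f * g = koszulSign m n • (g * f) := by
  rw [hf.mul_comm', hg.tw, smul_mul_assoc]

theorem HasPar.mul_self {n : ℤ} {f : D.Fn} (hf : HasPar n f) (hn : Odd n) : f * f = 0 := by
  have h := hf.mul_comm hf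
  have hn' : ¬ Even n := by simpa using hn
  have h2 : koszulSign n n = -1 := by simp [koszulSign, hn']
  rw [h2, neg_one_smul] at h
  have : (2 : ℝ) • (f * f) = 0 := by rw [two_smul]; nth_rewrite 1 [h]; simp
  exact (smul_eq_zero.1 this).resolve_left two_ne_zero

/-! ### Partial derivatives -/

theorem pd_inl_pure (i : D.B) (s : smoothFns D.U) (m : MvPolynomial D.E ℝ)
    (x : ExteriorAlgebra ℝ (D.O →₀ ℝ)) :
    D.pd (.inl i) (pure s m x) = pure (smoothPd i s) m x := rfl

theorem pd_even_pure (e : D.E) (s : smoothFns D.U) (m : MvPolynomial D.E ℝ)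
    (x : ExteriorAlgebra ℝ (D.O →₀ ℝ)) :
    D.pd (.inr (.inl e)) (pure s m x) = pure s (MvPolynomial.pderiv e m) x := rfl

theorem pd_odd_pure (o : D.O) (s : smoothFns D.U) (m : MvPolynomial D.E ℝ)
    (x : ExteriorAlgebra ℝ (D.O →₀ ℝ)) :
    D.pd (.inr (.inr o)) (pure s m x) =
      pure s m (CliffordAlgebra.contractLeft (Q := (0 : QuadraticForm ℝ (D.O →₀ ℝ)))
        (Finsupp.lapply o) x) := rfl

theorem pd_inl_emb (i : D.B) (s : smoothFns D.U) :
    D.pd (.inl i) (D.emb s) = D.emb (smoothPd i s) := rfl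

theorem pd_inr_emb (α : D.E ⊕ D.O) (s : smoothFns D.U) : D.pd (.inr α) (D.emb s) = 0 := by
  rcases α with e | o
  · rw [emb_eq, pd_even_pure, MvPolynomial.pderiv_one, pure_zero_mid]
  · rw [emb_eq, pd_odd_pure, CliffordAlgebra.contractLeft_one, pure_zero_right]

theorem pd_emb_mul (α : D.Coord) (s : smoothFns D.U) (g : D.Fn) :
    D.pd α (D.emb s * g) = D.pd α (D.emb s) * g + D.emb s * D.pd α g := by
  refine pure_induction (p := fun g => D.pd α (D.emb s * g) = D.pd α (D.emb s) * g +
    D.emb s * D.pd α g) (fun f g hf hg => ?_) (fun s' m x => ?_) g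
  · rw [mul_add, map_add, hf, hg, map_add, mul_add, mul_add]; abel
  · rcases α with i | e | o
    · rw [pd_inl_emb, emb_eq, emb_eq, pure_mul_pure, pd_inl_pure, pd_inl_pure, pure_mul_pure,
        pure_mul_pure, smoothPd_mul, pure_add_left]
    · rw [pd_inr_emb, zero_mul, zero_add, emb_eq, pure_mul_pure, pd_even_pure, pd_even_pure,
        pure_mul_pure, one_mul, one_mul, one_mul]
    · rw [pd_inr_emb, zero_mul, zero_add, emb_eq, pure_mul_pure, pd_odd_pure, pd_odd_pure,
        pure_mul_pure, one_mul, one_mul, one_mul]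

open Classical in
-- The graded Leibniz rule for a generator, from which all further sign rules follow by induction.
-- Only two odd coordinates produce a sign; that case is the product rule for contraction in the
-- exterior algebra.
theorem pd_q_mul (α : D.Coord) (β : D.E ⊕ D.O) (g : D.Fn) :
    D.pd α (D.q (.inr β) * g) = (if α = .inr β then g else 0) +
      koszulSign (D.deg α) (D.deg (.inr β)) • (D.q (.inr β) * D.pd α g) := by
  refine pure_induction (p := fun g => D.pd α (D.q (.inr β) * g) =
    (if α = .inr β then g else 0) +
      koszulSign (D.deg α) (D.deg (.inr β)) • (D.q (.inr β) * D.pd α g))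
    (fun f g hf hg => ?_) (fun s m x => ?_) g
  · rw [mul_add, map_add, hf, hg, map_add, mul_add, smul_add]
    split_ifs <;> abel
  · have he : ∀ e, Even (D.degE e : ℤ) := fun e => by simpa using D.degE_even e
    have ho : ∀ o, ¬ Even (D.degO o : ℤ) := fun o => by simpa using D.degO_odd o
    rcases α with i | e | o <;> rcases β with e' | o'
    · simp only [q_even, pure_mul_pure, pd_inl_pure, one_mul, reduceCtorEq, if_false, zero_add,
        deg, koszulSign, Nat.cast_zero, Even.zero, true_or, if_true, one_smul]
    · simp only [q_odd, pure_mul_pure, pd_inl_pure, one_mul, reduceCtorEq, if_false, zero_add,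
        deg, koszulSign, Nat.cast_zero, Even.zero, true_or, if_true, one_smul]
    · simp only [q_even, pure_mul_pure, pd_even_pure, one_mul,
        deg, koszulSign, he, true_or, if_true, one_smul, MvPolynomial.pderiv_mul, pure_add_mid]
      congr 1
      by_cases h : e = e'
      · subst h; simp
      · rw [MvPolynomial.pderiv_X_of_ne (Ne.symm h), zero_mul, pure_zero_mid]
        simp [h]
    · simp only [q_odd, pure_mul_pure, pd_even_pure, one_mul,
        deg, koszulSign, he, true_or, if_true, one_smul]
      simp
    · simp only [q_even, pure_mul_pure, pd_odd_pure, one_mul,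
        deg, koszulSign, he, or_true, if_true, one_smul]
      simp
    · simp only [q_odd, pure_mul_pure, pd_odd_pure, one_mul,
        deg, koszulSign, ho, or_self, if_false, neg_one_smul]
      have h := CliffordAlgebra.contractLeft_ι_mul (Q := (0 : QuadraticForm ℝ (D.O →₀ ℝ)))
        (d := Finsupp.lapply o) (Finsupp.single o' 1) x
      change pure _ _ (CliffordAlgebra.contractLeft _ (CliffordAlgebra.ι _ _ * x)) = _
      rw [h, sub_eq_add_neg, pure_add_right, pure_neg_right, pure_smul_right]
      congr 1
      by_cases h : o = o'
      · subst h; simp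
      · simp [h, pure_zero_left]

open Classical in
theorem pd_q (α β : D.Coord) : D.pd α (D.q β) = if α = β then 1 else 0 := by
  rcases β with j | β
  · rcases α with i | α
    · rw [q_inl, pd_inl_emb, smoothPd_coord]
      by_cases h : i = j
      · simp [h]
      · simp [h]
    · rw [q_inl, pd_inr_emb]; simp
  · have h := pd_q_mul α β (1 : D.Fn)
    have h1 : D.pd α 1 = 0 := by
      rw [← map_one D.emb]
      rcases α with i | α
      · rw [pd_inl_emb, smoothPd_one, map_zero]
      · rw [pd_inr_emb]
    rw [mul_one, h1, mul_zero, smul_zero, add_zero] at h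
    exact h

theorem pd_mul (α : D.Coord) (f g : D.Fn) :
    D.pd α (f * g) = D.pd α f * g + D.tw (D.deg α) f * D.pd α g := by
  classical
  refine Fn.induction (p := fun f => D.pd α (f * g) = D.pd α f * g + D.tw (D.deg α) f * D.pd α g)
    (fun f f' hf hf' => ?_) (fun s => ?_) (fun β f hf => ?_) f
  · rw [add_mul, map_add, hf, hf', map_add, map_add, add_mul, add_mul]; abel
  · rw [pd_emb_mul, (hasPar_emb s).tw, koszulSign_zero_right, one_smul]
  · rw [mul_assoc, pd_q_mul, hf, pd_q_mul, map_mul, (hasPar_q _).tw]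
    simp only [add_mul, mul_add, smul_add, smul_mul_assoc, mul_assoc]
    split_ifs <;> simp [add_assoc]

theorem pd_pd (α β : D.Coord) (f : D.Fn) :
    D.pd α (D.pd β f) = koszulSign (D.deg α) (D.deg β) • D.pd β (D.pd α f) := by
  classical
  refine Fn.induction (p := fun f => D.pd α (D.pd β f) =
    koszulSign (D.deg α) (D.deg β) • D.pd β (D.pd α f))
    (fun f f' hf hf' => ?_) (fun s => ?_) (fun γ f hf => ?_) f
  · simp only [map_add, hf, hf', smul_add]
  · rcases α with i | α <;> rcases β with j | β
    · simp only [pd_inl_emb]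
      rw [smoothPd_comm]; simp [deg, koszulSign]
    all_goals simp only [pd_inl_emb, pd_inr_emb, map_zero, smul_zero]
  · simp only [pd_q_mul, map_add, map_smul, hf, smul_add]
    by_cases ha : α = .inr γ <;> by_cases hb : β = .inr γ
    · subst ha; subst hb
      simp only [if_true, mul_smul_comm, smul_smul, koszulSign_mul_self, one_smul]
      abel
    · subst ha
      simp only [if_true, hb, if_false, map_zero, smul_zero, mul_smul_comm]
      match_scalars <;> grind [koszulSign_mul_self, koszulSign_comm]
    · subst hb
      simp only [if_true, ha, if_false, map_zero, smul_zero, mul_smul_comm]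
      match_scalars <;> grind [koszulSign_mul_self, koszulSign_comm]
    · simp only [ha, hb, if_false, map_zero, smul_zero, mul_smul_comm, smul_smul, zero_add]
      congr 1
      ring

theorem pd_par (α : D.Coord) (f : D.Fn) :
    D.par (D.pd α f) = koszulSign 1 (D.deg α) • D.pd α (D.par f) := by
  classical
  refine Fn.induction (p := fun f => D.par (D.pd α f) =
    koszulSign 1 (D.deg α) • D.pd α (D.par f)) (fun f f' hf hf' => ?_) (fun s => ?_)
    (fun γ f hf => ?_) f
  · simp only [map_add, hf, hf', smul_add]
  · rcases α with i | α
    · rw [pd_inl_emb, par_emb, par_emb, pd_inl_emb]; simp [deg, koszulSign]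
    · rw [pd_inr_emb, par_emb, pd_inr_emb]; simp
  · rw [map_mul D.par, par_q, smul_mul_assoc, map_smul, pd_q_mul, pd_q_mul, map_add, map_smul,
      map_mul D.par, hf, par_q]
    by_cases h : α = .inr γ
    · subst h
      simp only [if_true, smul_add, smul_smul, koszulSign_mul_self, one_smul, mul_smul_comm,
        smul_mul_assoc]
      congr 2
      grind [koszulSign_mul_self]
    · simp only [h, if_false, map_zero, zero_add, smul_smul, mul_smul_comm, smul_mul_assoc]
      congr 1
      ring

/-! ### Vector fields -/

/-- The components of the vector field `v` have the parities of a vector field of degree `c`. -/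
def FieldPar (c : ℤ) (v : D.VectorField) : Prop := ∀ α, HasPar (D.deg α + c) (v α)

theorem act_apply (v : D.VectorField) (f : D.Fn) : act v f = ∑ α, v α * D.pd α f := by
  simp [act, LinearMap.sum_apply]

theorem act_q (v : D.VectorField) (α : D.Coord) : act v (D.q α) = v α := by
  classical
  simp [act_apply, pd_q]

/-- Each `∂_α` contributes the twist |α|, and moving the coefficient `v α`, of parity |α| + c, past
`f` contributes |α| + c. The parts depending on α cancel. -/
theorem act_mul {c : ℤ} {v : D.VectorField} (hv : FieldPar c v) (f g : D.Fn) :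
    act v (f * g) = act v f * g + D.tw c f * act v g := by
  simp only [act_apply, Finset.sum_mul, Finset.mul_sum, ← Finset.sum_add_distrib]
  refine Finset.sum_congr rfl fun α _ => ?_
  have h : v α * D.tw (D.deg α) f = D.tw c f * v α := by
    rw [(hv α).mul_comm', tw_tw]
    congr 1
    by_cases h1 : Even (D.deg α : ℤ) <;> by_cases h2 : Even c <;> simp [tw, Int.even_add, h1, h2]
  rw [pd_mul, mul_add, ← mul_assoc, ← mul_assoc, h, mul_assoc (D.tw c f)]

theorem act_emb_mul (v : D.VectorField) (s : smoothFns D.U) (g : D.Fn) :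
    act v (D.emb s * g) = act v (D.emb s) * g + D.emb s * act v g := by
  simp only [act_apply, Finset.sum_mul, Finset.mul_sum, ← Finset.sum_add_distrib]
  refine Finset.sum_congr rfl fun α _ => ?_
  rw [pd_emb_mul, mul_add, ← mul_assoc, ← mul_assoc, ← emb_mul s (v α), mul_assoc (D.emb s)]

theorem act_par {c : ℤ} {v : D.VectorField} (hv : FieldPar c v) (f : D.Fn) :
    D.par (act v f) = koszulSign 1 c • act v (D.par f) := by
  simp only [act_apply, map_sum, Finset.smul_sum]
  refine Finset.sum_congr rfl fun α _ => ?_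
  rw [map_mul, hv α, pd_par, smul_mul_smul_comm, koszulSign_add_right, mul_right_comm,
    koszulSign_mul_self, one_mul]

theorem HasPar.act {c n : ℤ} {v : D.VectorField} (hv : FieldPar c v) {f : D.Fn} (h : HasPar n f) :
    HasPar (n + c) (act v f) := by
  unfold HasPar at *
  rw [act_par hv, h, map_smul, smul_smul, koszulSign_add_right, _root_.mul_comm]

theorem act_zero (f : D.Fn) : act (0 : D.VectorField) f = 0 := by
  simp [act_apply]

/-- The Leibniz rule applied to `v^α ∂_α f`: the sign from passing `v^α` and the sign from
exchanging derivatives combine to one that does not depend on α. -/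
theorem pd_act {c : ℤ} {v : D.VectorField} (hv : FieldPar c v) (β : D.Coord) (f : D.Fn) :
    D.pd β (act v f) = act (fun α => D.pd β (v α)) f +
      koszulSign c (D.deg β) • act v (D.pd β f) := by
  simp only [act_apply, map_sum, Finset.smul_sum, ← Finset.sum_add_distrib]
  refine Finset.sum_congr rfl fun α _ => ?_
  rw [pd_mul, (hv α).tw, pd_pd β α, smul_mul_smul_comm, koszulSign_add_right, mul_right_comm,
    koszulSign_comm (D.deg β) (D.deg α), koszulSign_mul_self, one_mul, koszulSign_comm]

/-- The graded commutator of odd vector fields is a vector field. -/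
theorem oddBracket_eq_act {c : ℤ} (hc : Odd c) {v w : D.VectorField} (hv : FieldPar c v)
    (hw : FieldPar c w) :
    oddBracket v w = act (fun α => act v (w α) + act w (v α)) := by
  have hs : ∀ α : D.Coord, koszulSign c (D.deg α + c) = - koszulSign c (D.deg α) := by
    intro α
    have h : ¬ Even c := by simpa using hc
    rw [koszulSign_add_right]
    simp [koszulSign, h]
  ext f
  have e1 : act v (act w f) = act (fun α => act v (w α)) f +
      ∑ α, koszulSign c (D.deg α) • (v α * act w (D.pd α f)) := by
    rw [act_apply v]
    simp only [pd_act hw, mul_add, Finset.sum_add_distrib, mul_smul_comm]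
    congr 1
    simp only [act_apply, Finset.mul_sum, Finset.sum_mul, mul_assoc]
    rw [Finset.sum_comm]
  -- The second-order terms are written with the same factors as in `e1`. Moving `w` past `v^α`
  -- instead of `∂_α` past `w` costs an additional odd-odd sign, so they cancel in the sum.
  have e2 : act w (act v f) = act (fun α => act w (v α)) f -
      ∑ α, koszulSign c (D.deg α) • (v α * act w (D.pd α f)) := by
    rw [act_apply v, map_sum]
    simp only [act_mul hw, (hv _).tw, hs, neg_smul, neg_mul, smul_mul_assoc, ← sub_eq_add_neg,
      Finset.sum_sub_distrib]
    rw [act_apply (fun α => act w (v α))]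
  change act v (act w f) + act w (act v f) = _
  rw [e1, e2]
  simp only [act_apply _ f, add_mul, Finset.sum_add_distrib]
  abel

/-! ### The grading -/

theorem fieldPar_euler : FieldPar 0 D.euler := fun α => by
  rw [add_zero]; exact (hasPar_q α).smul _

theorem isHomog_iff {k : ℤ} {f : D.Fn} : IsHomog k f ↔ act D.euler f = (k : ℝ) • f := Iff.rfl

theorem IsHomog.mul {m n : ℤ} {f g : D.Fn} (hf : IsHomog m f) (hg : IsHomog n g) :
    IsHomog (m + n) (f * g) := by
  rw [isHomog_iff] at *
  rw [act_mul fieldPar_euler, tw_zero, hf, hg, smul_mul_assoc, mul_smul_comm, ← add_smul]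
  push_cast; rfl

theorem IsHomog.add {n : ℤ} {f g : D.Fn} (hf : IsHomog n f) (hg : IsHomog n g) :
    IsHomog n (f + g) := by
  rw [isHomog_iff] at *
  rw [map_add, hf, hg, smul_add]

theorem IsHomog.smul {n : ℤ} {f : D.Fn} (r : ℝ) (hf : IsHomog n f) : IsHomog n (r • f) := by
  rw [isHomog_iff] at *
  rw [map_smul, hf, smul_comm]

theorem IsHomog.sub {n : ℤ} {f g : D.Fn} (hf : IsHomog n f) (hg : IsHomog n g) :
    IsHomog n (f - g) := by
  rw [isHomog_iff] at *
  rw [map_sub, hf, hg, smul_sub]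

theorem isHomog_zero (n : ℤ) : IsHomog n (0 : D.Fn) := by
  rw [isHomog_iff]; simp

theorem IsHomog.sum {ι : Type*} {s : Finset ι} {n : ℤ} {f : ι → D.Fn}
    (h : ∀ i ∈ s, IsHomog n (f i)) : IsHomog n (∑ i ∈ s, f i) := by
  rw [isHomog_iff, map_sum, Finset.smul_sum]
  exact Finset.sum_congr rfl h

theorem isHomog_q (α : D.Coord) : IsHomog (D.deg α) (D.q α) := by
  rw [isHomog_iff, act_q, euler]; norm_cast

theorem isHomog_emb (s : smoothFns D.U) : IsHomog 0 (D.emb s) := by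
  rw [isHomog_iff, act_apply]
  simp only [Int.cast_zero, zero_smul]
  refine Finset.sum_eq_zero fun α _ => ?_
  rcases α with i | α
  · simp [euler, deg]
  · rw [pd_inr_emb, mul_zero]

theorem isHomog_one : IsHomog 0 (1 : D.Fn) := by
  rw [← map_one D.emb]; exact isHomog_emb 1

theorem IsHomog.pd {n : ℤ} {f : D.Fn} (hf : IsHomog n f) (α : D.Coord) :
    IsHomog (n - D.deg α) (D.pd α f) := by
  classical
  rw [isHomog_iff] at *
  have h := pd_act fieldPar_euler α f
  have e : act (fun β => D.pd α (D.euler β)) f = (D.deg α : ℝ) • D.pd α f := by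
    rw [act_apply, Finset.sum_eq_single α]
    · simp [euler, pd_q]
    · intro β _ hβ
      simp [euler, pd_q, hβ.symm]
    · simp
  rw [hf, map_smul, koszulSign_zero_left, one_smul, e] at h
  push_cast
  rw [sub_smul, h]
  simp

theorem IsHomog.act {c n : ℤ} {v : D.VectorField} (hv : HasDegree v c) {f : D.Fn}
    (hf : IsHomog n f) : IsHomog (n + c) (act v f) := by
  rw [act_apply]
  refine IsHomog.sum fun α _ => ?_
  have := (hv α).mul (hf.pd α)
  convert this using 1
  ring

/-- The functions of parity and degree `n`. -/
def parHomog (D : GradedDomain) (n : ℕ) : Submodule ℝ D.Fn where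
  carrier := {f | IsHomog n f ∧ HasPar n f}
  add_mem' := fun hf hg => ⟨hf.1.add hg.1, hf.2.add hg.2⟩
  zero_mem' := ⟨isHomog_zero _, hasPar_zero _⟩
  smul_mem' := fun r _ hf => ⟨hf.1.smul r, hf.2.smul r⟩

/-- A monomial in coordinates of positive degree has a definite degree, and a parity that agrees
with it. With independence of the Euler eigenspaces this spanning statement determines each
homogeneous component. -/
theorem range_sup_iSup_parHomog :
    LinearMap.range D.emb.toLinearMap ⊔ ⨆ n : ℕ, D.parHomog (n + 1) = ⊤ := by
  rw [eq_top_iff]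
  rintro f -
  refine Fn.induction (p := fun f => f ∈ LinearMap.range D.emb.toLinearMap ⊔
    ⨆ n : ℕ, D.parHomog (n + 1)) (fun f g hf hg => Submodule.add_mem _ hf hg)
    (fun s => Submodule.mem_sup_left ⟨s, rfl⟩) (fun α f hf => Submodule.mem_sup_right ?_) f
  obtain ⟨k, hk⟩ : ∃ k, D.deg (.inr α) = k + 1 := Nat.exists_eq_succ_of_ne_zero (by
    rcases α with e | o
    · exact (D.degE_pos e).ne'
    · exact (D.degO_odd o).pos.ne')
  have key : ∀ (n : ℕ) g, g ∈ D.parHomog n →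
      D.q (.inr α) * g ∈ ⨆ n : ℕ, D.parHomog (n + 1) := by
    intro n g hg
    refine Submodule.mem_iSup_of_mem (k + n) ?_
    have h1 := (isHomog_q (D := D) (.inr α)).mul hg.1
    have h2 := (hasPar_q (D := D) (.inr α)).mul hg.2
    rw [hk] at h1 h2
    have e : ((k + 1 : ℕ) : ℤ) + n = ((k + n + 1 : ℕ) : ℤ) := by push_cast; ring
    rw [e] at h1 h2
    exact ⟨h1, h2⟩
  have hle : LinearMap.range D.emb.toLinearMap ⊔ ⨆ n : ℕ, D.parHomog (n + 1) ≤
      (⨆ n : ℕ, D.parHomog (n + 1)).comap (LinearMap.mulLeft ℝ (D.q (.inr α))) := by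
    refine sup_le ?_ (iSup_le fun n g hg => key _ g hg)
    rintro _ ⟨s, rfl⟩
    exact key 0 _ ⟨isHomog_emb s, hasPar_emb s⟩
  exact hle hf

theorem parHomog_le_eigenspace (n : ℕ) : D.parHomog n ≤
    Module.End.eigenspace (act D.euler) (n : ℝ) := fun f hf => by
  rw [Module.End.mem_eigenspace_iff]
  have := hf.1
  rw [isHomog_iff] at this
  exact_mod_cast this

theorem IsHomog.mem_eigenspace {k : ℤ} {f : D.Fn} (hf : IsHomog k f) :
    f ∈ Module.End.eigenspace (R := ℝ) (M := D.Fn) (GradedDomain.act D.euler) (k : ℝ) :=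
  Module.End.mem_eigenspace_iff.2 hf

/-- A part of a homogeneous component that, together with parts of the other homogeneous
components, spans all functions, is the whole homogeneous component. -/
theorem IsHomog.mem_of_sup_eq_top {k : ℤ} {f : D.Fn} (hf : IsHomog k f) {S T : Submodule ℝ D.Fn}
    (hST : S ⊔ T = ⊤) (hS : ∀ g ∈ S, IsHomog k g)
    (hT : T ≤ ⨆ μ ≠ (k : ℝ), Module.End.eigenspace (R := ℝ) (M := D.Fn)
      (GradedDomain.act D.euler) μ) : f ∈ S := by
  obtain ⟨s, hs, t, ht, rfl⟩ := Submodule.mem_sup.1 (hST ▸ Submodule.mem_top (x := f))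
  have h1 : IsHomog k t := by
    have := hf.sub (hS s hs)
    rwa [add_sub_cancel_left] at this
  have h2 := Submodule.disjoint_def.1
    (Module.End.eigenspaces_iSupIndep (R := ℝ) (M := D.Fn) (GradedDomain.act D.euler) (k : ℝ)) t
    h1.mem_eigenspace (hT ht)
  rw [h2, add_zero]
  exact hs

theorem range_emb_le : LinearMap.range D.emb.toLinearMap ≤
    Module.End.eigenspace (R := ℝ) (M := D.Fn) (act D.euler) (0 : ℝ) := by
  rintro _ ⟨s, rfl⟩
  exact_mod_cast (isHomog_emb s).mem_eigenspace

theorem le_iSup_eigenspace_ne {S : Submodule ℝ D.Fn} {μ ν : ℝ} (hμ : μ ≠ ν)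
    (hS : S ≤ Module.End.eigenspace (R := ℝ) (M := D.Fn) (act D.euler) μ) :
    S ≤ ⨆ μ ≠ ν, Module.End.eigenspace (R := ℝ) (M := D.Fn) (act D.euler) μ :=
  hS.trans (le_iSup₂_of_le μ hμ le_rfl)

/-- There are no functions of negative degree. -/
theorem IsHomog.eq_zero_of_neg {k : ℤ} (hk : k < 0) {f : D.Fn} (hf : IsHomog k f) : f = 0 := by
  have h : f ∈ (⊥ : Submodule ℝ D.Fn) := by
    refine hf.mem_of_sup_eq_top (T := ⊤) (by simp) (fun g hg => ?_) ?_
    · rw [(Submodule.mem_bot ℝ).1 hg]; exact isHomog_zero _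
    · rw [← range_sup_iSup_parHomog]
      refine sup_le (le_iSup_eigenspace_ne ?_ range_emb_le)
        (iSup_le fun n => le_iSup_eigenspace_ne ?_ (parHomog_le_eigenspace _))
      · exact_mod_cast hk.ne'
      · exact_mod_cast ne_of_gt (by omega : k < ((n + 1 : ℕ) : ℤ))
  exact (Submodule.mem_bot ℝ).1 h

/-- The functions of degree zero are the smooth functions of the coordinates of degree zero. -/
theorem IsHomog.exists_emb {f : D.Fn} (hf : IsHomog 0 f) : ∃ s, f = D.emb s := by
  have h : f ∈ LinearMap.range D.emb.toLinearMap := by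
    refine hf.mem_of_sup_eq_top range_sup_iSup_parHomog ?_ (iSup_le fun n =>
      le_iSup_eigenspace_ne ?_ (parHomog_le_eigenspace _))
    · rintro _ ⟨s, rfl⟩
      exact isHomog_emb s
    · exact_mod_cast Nat.succ_ne_zero n
  obtain ⟨s, hs⟩ := h
  exact ⟨s, hs.symm⟩

/-- Homogeneity is defined by the Euler field, while sign rules need parity. The link is that the
elements with matching degree and parity already span everything, so they exhaust each eigenspace.
-/
theorem IsHomog.hasPar {k : ℤ} {f : D.Fn} (hf : IsHomog k f) : HasPar k f := by
  rcases lt_trichotomy k 0 with hk | rfl | hk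
  · rw [hf.eq_zero_of_neg hk]; exact hasPar_zero _
  · obtain ⟨s, rfl⟩ := hf.exists_emb
    exact hasPar_emb s
  · obtain ⟨n, rfl⟩ : ∃ n : ℕ, k = ((n + 1 : ℕ) : ℤ) := ⟨(k - 1).toNat, by omega⟩
    refine (hf.mem_of_sup_eq_top (S := D.parHomog (n + 1))
      (T := LinearMap.range D.emb.toLinearMap ⊔ ⨆ m : {m // m ≠ n}, D.parHomog (m + 1)) ?_
      (fun g hg => hg.1) ?_).2
    · rw [eq_top_iff, ← range_sup_iSup_parHomog]
      refine sup_le (le_sup_of_le_right le_sup_left) (iSup_le fun m => ?_)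
      by_cases hm : m = n
      · subst hm; exact le_sup_left
      · exact le_sup_of_le_right (le_sup_of_le_right
          (le_iSup (fun m : {m // m ≠ n} => D.parHomog (m + 1)) ⟨m, hm⟩))
    · refine sup_le (le_iSup_eigenspace_ne ?_ range_emb_le)
        (iSup_le fun m => le_iSup_eigenspace_ne ?_ (parHomog_le_eigenspace _))
      · exact_mod_cast (Nat.succ_ne_zero n).symm
      · have := m.2
        exact_mod_cast (by omega : (m : ℕ) + 1 ≠ n + 1)

theorem HasDegree.fieldPar {c : ℤ} {v : D.VectorField} (hv : HasDegree v c) : FieldPar c v :=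
  fun α => (hv α).hasPar

variable {D' : GradedDomain}

/-! ### Morphisms -/

/-- A homomorphism of function algebras that is induced by a degree preserving smooth map. -/
def IsMorphism (φ : D.Fn →ₐ[ℝ] D'.Fn) : Prop :=
  (∀ α : D.E ⊕ D.O, IsHomog (D.deg (.inr α)) (φ (D.q (.inr α)))) ∧
    ∃ (b : D.B → smoothFns D'.U) (hb : ∀ y : D'.U, (fun i => (b i : D'.U → ℝ) y) ∈ D.U),
      ∀ s, φ (D.emb s) = D'.emb (smoothComp b hb s)

theorem act_emb (v : D.VectorField) (s : smoothFns D.U) :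
    act v (D.emb s) = ∑ i, v (.inl i) * D.emb (smoothPd i s) := by
  rw [act_apply, Fintype.sum_sum_type]
  simp only [pd_inr_emb, mul_zero, Finset.sum_const_zero, add_zero, pd_inl_emb]

theorem IsMorphism.isHomog_q {φ : D.Fn →ₐ[ℝ] D'.Fn} (hφ : IsMorphism φ) (α : D.Coord) :
    IsHomog (D.deg α) (φ (D.q α)) := by
  obtain ⟨h1, b, hb, h2⟩ := hφ
  rcases α with i | α
  · rw [q_inl, h2]; exact isHomog_emb _
  · exact h1 α

/-- The chain rule. -/
theorem IsMorphism.act_map {φ : D.Fn →ₐ[ℝ] D'.Fn} (hφ : IsMorphism φ) {c : ℤ}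
    {v : D'.VectorField} (hv : FieldPar c v) (f : D.Fn) :
    act v (φ f) = ∑ α, act v (φ (D.q α)) * φ (D.pd α f) := by
  classical
  refine Fn.induction (p := fun f => act v (φ f) = ∑ α, act v (φ (D.q α)) * φ (D.pd α f))
    (fun f f' hf hf' => ?_) (fun s => ?_) (fun β f hf => ?_) f
  · simp only [map_add, hf, hf', mul_add, Finset.sum_add_distrib]
  · obtain ⟨h1, b, hb, h2⟩ := hφ
    rw [h2, act_emb, Fintype.sum_sum_type]
    simp only [pd_inr_emb, map_zero, mul_zero, Finset.sum_const_zero, add_zero, pd_inl_emb, q_inl,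
      h2, smoothComp_coord, act_emb, smoothPd_comp, map_sum, map_mul, Finset.mul_sum,
      Finset.sum_mul, mul_assoc]
    rw [Finset.sum_comm]
  -- Commuting the image of `q^β` past `v(φ q^α)` gives the sign of |β|(|α| + c). The twist by `c`
  -- removes the part with `c`, leaving the sign in the Leibniz rule for `∂_α`.
  · have key : ∀ α, D'.tw c (φ (D.q (.inr β))) * act v (φ (D.q α)) =
        koszulSign (D.deg α) (D.deg (.inr β)) •
          (act v (φ (D.q α)) * φ (D.q (.inr β))) := fun α => by
      have h1 := (hφ.isHomog_q α).hasPar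
      have h2 := (hφ.isHomog_q (.inr β)).hasPar
      rw [h2.tw, smul_mul_assoc, h2.mul_comm (h1.act hv), smul_smul]
      congr 1
      rw [koszulSign_add_right]
      grind [koszulSign_mul_self, koszulSign_comm]
    rw [map_mul, act_mul hv, hf]
    simp only [pd_q_mul, map_add, map_smul, map_mul, mul_add, Finset.sum_add_distrib,
      Finset.mul_sum, ← mul_assoc, key]
    congr 1
    · rw [Finset.sum_eq_single (.inr β)]
      · simp
      · intro α _ hα; simp [hα]
      · simp
    · refine Finset.sum_congr rfl fun α _ => ?_
      rw [mul_smul_comm, smul_mul_assoc, mul_assoc]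

theorem IsMorphism.isHomog {φ : D.Fn →ₐ[ℝ] D'.Fn} (hφ : IsMorphism φ) {k : ℤ} {f : D.Fn}
    (hf : IsHomog k f) : IsHomog k (φ f) := by
  rw [isHomog_iff] at *
  rw [hφ.act_map fieldPar_euler, ← map_smul, ← hf, act_apply, map_sum]
  refine Finset.sum_congr rfl fun α _ => ?_
  have := hφ.isHomog_q α
  rw [isHomog_iff] at this
  rw [this, map_mul, euler, map_smul]
  norm_cast

theorem HasPar.of_sub_even {n m : ℤ} {f : D.Fn} (h : HasPar n f) (he : Even (n - m)) :
    HasPar m f := by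
  unfold HasPar at *
  rw [h]
  congr 1
  rw [Int.even_sub] at he
  simp [koszulSign, he]

/-- The condition in the universal property of the exterior algebra, used for the odd generators in
`lift`. -/
theorem odd_linearCombination_sq {ι : Type} (a : ι → D.Fn) (ha : ∀ o, HasPar 1 (a o))
    (v : ι →₀ ℝ) :
    Finsupp.linearCombination ℝ a v * Finsupp.linearCombination ℝ a v = 0 := by
  refine HasPar.mul_self (n := 1) ?_ odd_one
  induction v using Finsupp.induction_linear with
  | zero => rw [map_zero]; exact hasPar_zero _
  | add v w hv hw => rw [map_add]; exact hv.add hw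
  | single o r => rw [Finsupp.linearCombination_single]; exact (ha o).smul r

/-- Evaluation of polynomials needs a commutative target; the images of the even generators lie in
the centre, which is one. -/
theorem mem_center_of_even {n : ℤ} (hn : Even n) {f : D.Fn} (hf : HasPar n f) :
    f ∈ Subalgebra.center ℝ D.Fn := by
  rw [Subalgebra.mem_center_iff]
  intro g
  rw [hf.mul_comm' g]
  simp [GradedDomain.tw, hn]

/-- The morphism with given smooth map of bodies and given images of the coordinates of positive
degree. -/
def lift (b : D.B → smoothFns D'.U) (hb : ∀ y : D'.U, (fun i => (b i : D'.U → ℝ) y) ∈ D.U)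
    (a : D.E ⊕ D.O → D'.Fn) (ha : ∀ α, IsHomog (D.deg (.inr α)) (a α)) : D.Fn →ₐ[ℝ] D'.Fn :=
  (Algebra.TensorProduct.lift (D'.emb.comp (smoothComp b hb))
    (Algebra.TensorProduct.lift
      ((Subalgebra.center ℝ D'.Fn).val.comp (MvPolynomial.aeval fun e =>
        (⟨a (.inl e), mem_center_of_even (by simpa [deg] using D.degE_even e)
          (ha (.inl e)).hasPar⟩ : Subalgebra.center ℝ D'.Fn)))
      (ExteriorAlgebra.lift ℝ ⟨Finsupp.linearCombination ℝ fun o => a (.inr o),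
        odd_linearCombination_sq _ fun o => (ha (.inr o)).hasPar.of_sub_even (by
          obtain ⟨k, hk⟩ := D.degO_odd o
          exact ⟨k, by simp only [deg, hk]; push_cast; ring⟩)⟩)
      (fun m _ => (Subalgebra.mem_center_iff.1 (Subtype.prop _) _).symm))
    (fun s x => emb_mul (smoothComp b hb s) _) :
    smoothFns D.U ⊗[ℝ] D.Fiber →ₐ[ℝ] D'.Fn)

section lift

variable (b : D.B → smoothFns D'.U) (hb : ∀ y : D'.U, (fun i => (b i : D'.U → ℝ) y) ∈ D.U)
    (a : D.E ⊕ D.O → D'.Fn) (ha : ∀ α, IsHomog (D.deg (.inr α)) (a α))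

theorem lift_emb (s : smoothFns D.U) : lift b hb a ha (D.emb s) = D'.emb (smoothComp b hb s) := by
  refine (Algebra.TensorProduct.lift_tmul _ _ _ _ _).trans ?_
  rw [map_one, mul_one]
  rfl

theorem lift_q (α : D.E ⊕ D.O) : lift b hb a ha (D.q (.inr α)) = a α := by
  rcases α with e | o
  · refine (Algebra.TensorProduct.lift_tmul _ _ _ _ _).trans ?_
    rw [map_one, one_mul]
    refine (Algebra.TensorProduct.lift_tmul _ _ _ _ _).trans ?_
    rw [map_one, mul_one]
    simp
  · refine (Algebra.TensorProduct.lift_tmul _ _ _ _ _).trans ?_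
    rw [map_one, one_mul]
    refine (Algebra.TensorProduct.lift_tmul _ _ _ _ _).trans ?_
    rw [map_one, one_mul, ExteriorAlgebra.lift_ι_apply]
    simp

theorem isMorphism_lift : IsMorphism (lift b hb a ha) :=
  ⟨fun α => by rw [lift_q]; exact ha α, b, hb, lift_emb b hb a ha⟩

end lift

/-! ### Pullback along coordinate projections -/

/-- The map of coordinates of a coordinate projection. -/
def Proj.coord (π : Proj D D') : D.Coord → D'.Coord := Sum.map π.jB (Sum.map π.jE π.jO)

theorem Proj.pull_emb (π : Proj D D') (s : smoothFns D.U) :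
    π.pull (D.emb s) = D'.emb (smoothPull π.jB π.mem s) := by
  refine (Algebra.TensorProduct.map_tmul _ _ _ _).trans ?_
  rw [map_one]
  rfl

theorem Proj.pull_q (π : Proj D D') (α : D.Coord) : π.pull (D.q α) = D'.q (π.coord α) := by
  rcases α with i | e | o
  · rw [q_inl, Proj.pull_emb]; rfl
  · refine (Algebra.TensorProduct.map_tmul _ _ _ _).trans ?_
    rw [map_one, Algebra.TensorProduct.map_tmul, map_one, MvPolynomial.rename_X]
    rfl
  · refine (Algebra.TensorProduct.map_tmul _ _ _ _).trans ?_
    rw [map_one, Algebra.TensorProduct.map_tmul, map_one, ExteriorAlgebra.map_apply_ι]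
    simp only [Finsupp.lmapDomain_apply, Finsupp.mapDomain_single]
    rfl

theorem Proj.isMorphism_pull (π : Proj D D') (h : ∀ α, D'.deg (π.coord α) = D.deg α) :
    IsMorphism π.pull :=
  ⟨fun α => by rw [Proj.pull_q, ← h]; exact GradedDomain.isHomog_q _,
    fun i => smoothCoord (π.jB i), fun y => π.mem y y.2, π.pull_emb⟩

theorem Proj.act_pull (π : Proj D D') (h : ∀ α, D'.deg (π.coord α) = D.deg α) {c : ℤ}
    {v : D'.VectorField} (hv : FieldPar c v) (f : D.Fn) :
    act v (π.pull f) = ∑ α, v (π.coord α) * π.pull (D.pd α f) := by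
  rw [(π.isMorphism_pull h).act_map hv]
  simp only [Proj.pull_q, act_q]

/-- Evaluation at a point of the body, as a morphism to functions with constant coefficients. -/
def constAt (D : GradedDomain) (x : D.U) : D.Fn →ₐ[ℝ] D.Fn :=
  (Algebra.TensorProduct.includeRight : D.Fiber →ₐ[ℝ] smoothFns D.U ⊗[ℝ] D.Fiber).comp (D.evalAt x)

theorem evalAt_pure (x : D.U) (s : smoothFns D.U) (m : MvPolynomial D.E ℝ)
    (y : ExteriorAlgebra ℝ (D.O →₀ ℝ)) :
    D.evalAt x (pure s m y) = (s : D.U → ℝ) x • (m ⊗ₜ[ℝ] y : D.Fiber) :=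
  rfl

theorem constAt_pure (x : D.U) (s : smoothFns D.U) (m : MvPolynomial D.E ℝ)
    (y : ExteriorAlgebra ℝ (D.O →₀ ℝ)) :
    D.constAt x (pure s m y) = (s : D.U → ℝ) x • pure 1 m y := by
  change Algebra.TensorProduct.includeRight (D.evalAt x (pure s m y)) = _
  rw [evalAt_pure, map_smul]
  rfl

theorem constAt_emb (x : D.U) (s : smoothFns D.U) :
    D.constAt x (D.emb s) = algebraMap ℝ D.Fn ((s : D.U → ℝ) x) := by
  rw [emb_eq, constAt_pure, Algebra.algebraMap_eq_smul_one, ← map_one D.emb, emb_eq]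

theorem constAt_q (x : D.U) (α : D.E ⊕ D.O) : D.constAt x (D.q (.inr α)) = D.q (.inr α) := by
  rcases α with e | o
  · rw [q_even, constAt_pure]; simp
  · rw [q_odd, constAt_pure]; simp

/-- `constAt` is `evalAt` followed by an inclusion with left inverse `evalAt`. Working with
`constAt` keeps values at a point inside the forms, where they can be multiplied and differentiated.
-/
theorem evalAt_eq_zero_iff (x : D.U) (f : D.Fn) : D.evalAt x f = 0 ↔ D.constAt x f = 0 := by
  have h : ∀ y : D.Fiber, D.evalAt x ((Algebra.TensorProduct.includeRight :
      D.Fiber →ₐ[ℝ] smoothFns D.U ⊗[ℝ] D.Fiber) y) = y := fun y => by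
    refine (?_ : _ = (1 : ℝ) • y).trans (one_smul _ _)
    rfl
  constructor
  · intro hf
    change (Algebra.TensorProduct.includeRight :
      D.Fiber →ₐ[ℝ] smoothFns D.U ⊗[ℝ] D.Fiber) (D.evalAt x f) = 0
    rw [hf, map_zero]
  · intro hf
    rw [← h (D.evalAt x f)]
    change D.evalAt x (D.constAt x f) = 0
    rw [hf, map_zero]

theorem emb_injective : Function.Injective D.emb := by
  intro s t h
  ext x
  have h1 := congrArg (D.evalAt x) h
  rw [emb_eq, emb_eq, evalAt_pure, evalAt_pure] at h1
  have : Nontrivial D.Fiber := inferInstance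
  have h2 : ((1 : MvPolynomial D.E ℝ) ⊗ₜ[ℝ] (1 : ExteriorAlgebra ℝ (D.O →₀ ℝ)) : D.Fiber) ≠ 0 :=
    one_ne_zero (α := D.Fiber)
  exact smul_left_injective ℝ h2 h1

/-! ### Coordinates of products and of shifted tangent bundles -/

theorem inFst_injective : Function.Injective (inFst D D') := by
  rintro (i | e | o) (i' | e' | o') h
  · exact congrArg _ (Sum.inl.inj (Sum.inl.inj h))
  · exact absurd h Sum.inl_ne_inr
  · exact absurd h Sum.inl_ne_inr
  · exact absurd h Sum.inr_ne_inl
  · exact congrArg (Sum.inr ∘ Sum.inl) (Sum.inl.inj (Sum.inl.inj (Sum.inr.inj h)))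
  · exact absurd (Sum.inr.inj h) Sum.inl_ne_inr
  · exact absurd h Sum.inr_ne_inl
  · exact absurd (Sum.inr.inj h) Sum.inr_ne_inl
  · exact congrArg (Sum.inr ∘ Sum.inr) (Sum.inl.inj (Sum.inr.inj (Sum.inr.inj h)))

theorem fst_coord (α : D.Coord) : (fst D D').coord α = inFst D D' α := by
  rcases α with i | e | o <;> rfl

theorem snd_coord (α : D'.Coord) : (snd D D').coord α = inSnd D D' α := by
  rcases α with i | e | o <;> rfl

theorem deg_inFst (α : D.Coord) : (D.prod D').deg (inFst D D' α) = D.deg α := by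
  rcases α with i | e | o <;> rfl

theorem deg_inSnd (α : D'.Coord) : (D.prod D').deg (inSnd D D' α) = D'.deg α := by
  rcases α with i | e | o <;> rfl

theorem deg_qT (α : D.Coord) : D.T1.deg (D.qT α) = D.deg α := by
  rcases α with i | e | o <;> rfl

theorem deg_dqT (α : D.Coord) : D.T1.deg (D.dqT α) = D.deg α + 1 := by
  rcases α with i | e | o <;> rfl

theorem join_inFst (v : D.Coord → (D.prod D').Fn) (w : D'.Coord → (D.prod D').Fn) (α : D.Coord) :
    join D D' v w (inFst D D' α) = v α := by
  rcases α with i | e | o <;> rfl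

theorem join_inSnd (v : D.Coord → (D.prod D').Fn) (w : D'.Coord → (D.prod D').Fn)
    (α : D'.Coord) : join D D' v w (inSnd D D' α) = w α := by
  rcases α with i | e | o <;> rfl

theorem joinT_qT {R : Type} (v w : D.Coord → R) (α : D.Coord) :
    D.joinT v w (D.qT α) = v α := by
  rcases α with i | e | o <;> rfl

theorem joinT_dqT {R : Type} (v w : D.Coord → R) (α : D.Coord) :
    D.joinT v w (D.dqT α) = w α := by
  rcases α with i | e | o <;> rfl

theorem forall_prod_coord {p : (D.prod D').Coord → Prop} (h1 : ∀ α, p (inFst D D' α))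
    (h2 : ∀ β, p (inSnd D D' β)) (γ : (D.prod D').Coord) : p γ := by
  rcases γ with (i | i) | (e | e) | (o | o)
  exacts [h1 (.inl i), h2 (.inl i), h1 (.inr (.inl e)), h2 (.inr (.inl e)), h1 (.inr (.inr o)),
    h2 (.inr (.inr o))]

theorem forall_T1_coord {p : D.T1.Coord → Prop} (h1 : ∀ α, p (D.qT α))
    (h2 : ∀ β, p (D.dqT β)) (γ : D.T1.Coord) : p γ := by
  rcases γ with i | (e | o) | (o | i | e)
  exacts [h1 (.inl i), h1 (.inr (.inl e)), h2 (.inr (.inr o)), h1 (.inr (.inr o)), h2 (.inl i),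
    h2 (.inr (.inl e))]

theorem sum_prod_coord {R : Type*} [AddCommMonoid R] (f : (D.prod D').Coord → R) :
    ∑ γ, f γ = ∑ α, f (inFst D D' α) + ∑ β, f (inSnd D D' β) := by
  have e : ∑ γ, f γ = (∑ i, f (.inl (.inl i)) + ∑ i, f (.inl (.inr i))) +
      ((∑ e, f (.inr (.inl (.inl e))) + ∑ e, f (.inr (.inl (.inr e)))) +
        (∑ o, f (.inr (.inr (.inl o))) + ∑ o, f (.inr (.inr (.inr o))))) := by
    refine (Fintype.sum_sum_type _).trans ?_
    congr 1
    · exact Fintype.sum_sum_type _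
    · refine (Fintype.sum_sum_type _).trans ?_
      congr 1 <;> exact Fintype.sum_sum_type _
  rw [e]
  simp only [Fintype.sum_sum_type, inFst, inSnd]
  ac_rfl

theorem sum_T1_coord {R : Type*} [AddCommMonoid R] (f : D.T1.Coord → R) :
    ∑ γ, f γ = ∑ α, f (D.qT α) + ∑ β, f (D.dqT β) := by
  have e : ∑ γ, f γ = ∑ i : D.B, f (.inl i) +
      ((∑ e : D.E, f (.inr (.inl (.inl e))) + ∑ o : D.O, f (.inr (.inl (.inr o)))) +
        (∑ o : D.O, f (.inr (.inr (.inl o))) + (∑ i : D.B, f (.inr (.inr (.inr (.inl i)))) +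
          ∑ e : D.E, f (.inr (.inr (.inr (.inr e))))))) := by
    refine (Fintype.sum_sum_type _).trans ?_
    congr 1
    refine (Fintype.sum_sum_type _).trans ?_
    congr 1
    · exact Fintype.sum_sum_type _
    · refine (Fintype.sum_sum_type _).trans ?_
      congr 1
      exact Fintype.sum_sum_type _
  rw [e]
  simp only [Fintype.sum_sum_type, qT, dqT]
  ac_rfl

theorem hasDegree_join {v : D.Coord → (D.prod D').Fn} {w : D'.Coord → (D.prod D').Fn} {c : ℤ}
    (hv : ∀ α, IsHomog (D.deg α + c) (v α)) (hw : ∀ β, IsHomog (D'.deg β + c) (w β)) :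
    HasDegree (join D D' v w) c :=
  forall_prod_coord (fun α => by rw [join_inFst, deg_inFst]; exact hv α)
    (fun β => by rw [join_inSnd, deg_inSnd]; exact hw β)

theorem isMorphism_fst : IsMorphism (fst D D').pull :=
  (fst D D').isMorphism_pull fun α => by rw [fst_coord, deg_inFst]

theorem isMorphism_snd : IsMorphism (snd D D').pull :=
  (snd D D').isMorphism_pull fun α => by rw [snd_coord, deg_inSnd]

theorem hasDegree_sumField {v : D.VectorField} {w : D'.VectorField} {c : ℤ}
    (hv : HasDegree v c) (hw : HasDegree w c) : HasDegree (sumField v w) c :=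
  hasDegree_join (fun α => isMorphism_fst.isHomog (hv α))
    (fun β => isMorphism_snd.isHomog (hw β))

theorem deRham_qT (α : D.Coord) : D.deRham (D.qT α) = D.T1.q (D.dqT α) := joinT_qT _ _ α

theorem deRham_dqT (α : D.Coord) : D.deRham (D.dqT α) = 0 := joinT_dqT _ _ α

theorem hasDegree_deRham : HasDegree D.deRham 1 :=
  forall_T1_coord (fun α => by
      rw [deRham_qT, deg_qT]
      have := isHomog_q (D := D.T1) (D.dqT α)
      rwa [deg_dqT] at this)
    (fun α => by rw [deRham_dqT]; exact isHomog_zero _)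

theorem act_deRham_deRham (β : D.T1.Coord) : act D.deRham (D.deRham β) = 0 :=
  forall_T1_coord (p := fun β => act D.deRham (D.deRham β) = 0)
    (fun α => by rw [deRham_qT, act_q, deRham_dqT]) (fun α => by rw [deRham_dqT, map_zero]) β

theorem act_fst_pull {c : ℤ} {v : (D.prod D').VectorField} (hv : FieldPar c v) (f : D.Fn) :
    act v ((fst D D').pull f) = ∑ α, v (inFst D D' α) * (fst D D').pull (D.pd α f) := by
  rw [Proj.act_pull _ (fun α => by rw [fst_coord, deg_inFst]) hv]
  simp only [fst_coord]

theorem act_snd_pull {c : ℤ} {v : (D.prod D').VectorField} (hv : FieldPar c v) (f : D'.Fn) :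
    act v ((snd D D').pull f) = ∑ α, v (inSnd D D' α) * (snd D D').pull (D'.pd α f) := by
  rw [Proj.act_pull _ (fun α => by rw [snd_coord, deg_inSnd]) hv]
  simp only [snd_coord]

theorem act_sumField_fst {v : D.VectorField} {w : D'.VectorField} {c : ℤ}
    (hv : HasDegree v c) (hw : HasDegree w c) (f : D.Fn) :
    act (sumField v w) ((fst D D').pull f) = (fst D D').pull (act v f) := by
  rw [act_fst_pull (hasDegree_sumField hv hw).fieldPar, act_apply, map_sum]
  simp only [sumField, join_inFst, map_mul]

theorem act_sumField_snd {v : D.VectorField} {w : D'.VectorField} {c : ℤ}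
    (hv : HasDegree v c) (hw : HasDegree w c) (f : D'.Fn) :
    act (sumField v w) ((snd D D').pull f) = (snd D D').pull (act w f) := by
  rw [act_snd_pull (hasDegree_sumField hv hw).fieldPar, act_apply, map_sum]
  simp only [sumField, join_inSnd, map_mul]

/-- For odd `v` the operator `2v² = [v, v]` is again a vector field, with components `2v(v^α)`, so
it can be tested on coordinates. -/
theorem square_zero_of_components {c : ℤ} (hc : Odd c) {v : D.VectorField} (hv : FieldPar c v)
    (h : ∀ α, act v (v α) = 0) : SquareZero v := by
  have h1 := oddBracket_eq_act hc hv hv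
  simp only [h, add_zero] at h1
  unfold oddBracket at h1
  ext f
  have h2 := LinearMap.congr_fun h1 f
  rw [LinearMap.add_apply, ← two_smul ℝ] at h2
  have h3 : act (fun _ : D.Coord => (0 : D.Fn)) f = 0 := act_zero f
  rw [h3] at h2
  exact (smul_eq_zero.1 h2).resolve_left two_ne_zero

theorem SquareZero.apply {v : D.VectorField} (h : SquareZero v) (f : D.Fn) :
    act v (act v f) = 0 := LinearMap.congr_fun h f

end GradedDomain

/-! ### The field strength ideal and the action of d and δ -/

namespace HigherGauge

open GradedDomain

variable {M : GradedDomain} {d : ℕ} {W : Opens (Fin d → ℝ)} {Q : M.VectorField}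

theorem extD_extD (η : Forms W) : extD W (extD W η) = 0 :=
  (square_zero_of_components odd_one hasDegree_deRham.fieldPar act_deRham_deRham).apply η

theorem isHomog_extD {k : ℤ} {η : Forms W} (h : IsHomog k η) : IsHomog (k + 1) (extD W η) :=
  h.act hasDegree_deRham

theorem isHomog_dAlg {k : ℤ} {f : Alg M W} (h : IsHomog k f) : IsHomog (k + 1) (dAlg M W f) :=
  h.act (hasDegree_sumField hasDegree_deRham hasDegree_deRham)

theorem fieldPar_dAlg : FieldPar 1 (sumField M.deRham (ofOpen W).deRham) :=
  (hasDegree_sumField hasDegree_deRham hasDegree_deRham).fieldPar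

theorem jetToTot_coord_inFst (α : M.Coord) : (jetToTot M W).coord (inFst M (ofOpen W).T1 α) =
    inFst M.T1 (ofOpen W).T1 (M.qT α) := by
  rcases α with i | e | o <;> rfl

theorem jetToTot_coord_inSnd (β : (ofOpen W).T1.Coord) :
    (jetToTot M W).coord (inSnd M (ofOpen W).T1 β) = inSnd M.T1 (ofOpen W).T1 β := by
  rcases β with i | e | o <;> rfl

theorem deg_jetToTot_coord : ∀ γ : (Tot M W).Coord,
    (Jet M W).deg ((jetToTot M W).coord γ) = (Tot M W).deg γ :=
  forall_prod_coord (fun α => by rw [jetToTot_coord_inFst, deg_inFst, deg_inFst, deg_qT])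
    (fun β => by rw [jetToTot_coord_inSnd, deg_inSnd, deg_inSnd])

theorem isMorphism_jetToTot : IsMorphism (jetToTot M W).pull :=
  (jetToTot M W).isMorphism_pull deg_jetToTot_coord

theorem isHomog_onFields {k : ℤ} {f : M.Fn} (h : IsHomog k f) : IsHomog k (onFields M W f) :=
  isMorphism_jetToTot.isHomog (isMorphism_fst.isHomog h)

theorem jetToTot_formToTot (η : Forms W) :
    (jetToTot M W).pull (formToTot M W η) = (snd M.T1 (ofOpen W).T1).pull η := by
  have : ((jetToTot M W).pull).comp (formToTot M W) = (snd M.T1 (ofOpen W).T1).pull := by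
    refine Fn.hom_ext (fun s => ?_) (fun α => ?_)
    · rw [AlgHom.comp_apply, formToTot, Proj.pull_emb, Proj.pull_emb, Proj.pull_emb]
      rfl
    · rw [AlgHom.comp_apply, formToTot, Proj.pull_q, Proj.pull_q, Proj.pull_q, snd_coord,
        snd_coord, jetToTot_coord_inSnd]
  exact DFunLike.congr_fun this η

theorem act_jetToTot {c : ℤ} {v : (Jet M W).VectorField} (hv : FieldPar c v) (f : (Tot M W).Fn) :
    act v ((jetToTot M W).pull f) =
      ∑ α, v (inFst M.T1 (ofOpen W).T1 (M.qT α)) *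
        (jetToTot M W).pull ((Tot M W).pd (inFst M (ofOpen W).T1 α) f) +
      ∑ β, v (inSnd M.T1 (ofOpen W).T1 β) *
        (jetToTot M W).pull ((Tot M W).pd (inSnd M (ofOpen W).T1 β) f) := by
  rw [Proj.act_pull _ deg_jetToTot_coord hv, sum_prod_coord]
  simp only [jetToTot_coord_inFst, jetToTot_coord_inSnd]

theorem isHomog_genDA (α : M.Coord) : IsHomog (M.deg α + 1) (genDA M W α) := by
  have := isHomog_q (D := Jet M W) (inFst M.T1 (ofOpen W).T1 (M.dqT α))
  rwa [deg_inFst, deg_dqT] at this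

theorem isHomog_fieldStrength (hQ : HasDegree Q 1) (α : M.Coord) :
    IsHomog (M.deg α + 1) (fieldStrength W Q α) :=
  (isHomog_genDA α).sub (isHomog_onFields (hQ α))

/-- The field strength ideal is two-sided. -/
theorem fieldIdeal_mul_right (hQ : HasDegree Q 1) {x : Alg M W} (hx : x ∈ fieldIdeal W Q)
    (g : Alg M W) : x * g ∈ fieldIdeal W Q := by
  unfold fieldIdeal at *
  induction hx using Submodule.span_induction with
  | mem x hx =>
    obtain ⟨α, rfl⟩ := hx
    rw [(isHomog_fieldStrength hQ α).hasPar.mul_comm']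
    exact Ideal.mul_mem_left _ _ (Ideal.subset_span ⟨α, rfl⟩)
  | zero => rw [zero_mul]; exact Ideal.zero_mem _
  | add x y _ _ hx hy => rw [add_mul]; exact Ideal.add_mem _ hx hy
  | smul a x _ hx => rw [smul_eq_mul, mul_assoc]; exact Ideal.mul_mem_left _ _ hx

theorem fieldStrength_mem (α : M.Coord) : fieldStrength W Q α ∈ fieldIdeal W Q :=
  Ideal.subset_span ⟨α, rfl⟩

/-- A derivation preserves the field strength ideal if it maps the field strengths to it. -/
theorem act_mem_fieldIdeal {c : ℤ} {v : (Jet M W).VectorField} (hv : FieldPar c v)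
    (h : ∀ α, act v (fieldStrength W Q α) ∈ fieldIdeal W Q) {x : Alg M W}
    (hx : x ∈ fieldIdeal W Q) : act v x ∈ fieldIdeal W Q := by
  have key : ∀ x ∈ fieldIdeal W Q, x ∈ fieldIdeal W Q ∧ act v x ∈ fieldIdeal W Q := by
    intro x hx
    unfold fieldIdeal at hx
    induction hx using Submodule.span_induction with
    | mem x hx =>
      obtain ⟨α, rfl⟩ := hx
      exact ⟨fieldStrength_mem α, h α⟩
    | zero => rw [map_zero]; exact ⟨Ideal.zero_mem _, Ideal.zero_mem _⟩
    | add x y _ _ hx hy =>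
      rw [map_add]; exact ⟨Ideal.add_mem _ hx.1 hy.1, Ideal.add_mem _ hx.2 hy.2⟩
    | smul a x _ hx =>
      rw [smul_eq_mul, act_mul hv]
      exact ⟨Ideal.mul_mem_left _ _ hx.1,
        Ideal.add_mem _ (Ideal.mul_mem_left _ _ hx.1) (Ideal.mul_mem_left _ _ hx.2)⟩
  exact (key x hx).2

theorem hasDegree_Qtot (hQ : HasDegree Q 1) : HasDegree (Qtot W Q) 1 :=
  hasDegree_sumField hQ hasDegree_deRham

theorem Qtot_fst (hQ : HasDegree Q 1) (f : M.Fn) :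
    act (Qtot W Q) ((fst M (ofOpen W).T1).pull f) = (fst M (ofOpen W).T1).pull (act Q f) :=
  act_sumField_fst hQ hasDegree_deRham f

theorem Qtot_form (hQ : HasDegree Q 1) (η : Forms W) :
    act (Qtot W Q) (formToTot M W η) = formToTot M W (extD W η) :=
  act_sumField_snd hQ hasDegree_deRham η

theorem Qtot_inFst (α : M.Coord) :
    Qtot W Q (inFst M (ofOpen W).T1 α) = (fst M (ofOpen W).T1).pull (Q α) := by
  unfold Qtot sumField; rw [join_inFst]

theorem Qtot_inSnd (β : (ofOpen W).T1.Coord) :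
    Qtot W Q (inSnd M (ofOpen W).T1 β) = formToTot M W ((ofOpen W).deRham β) := by
  unfold Qtot sumField; rw [join_inSnd]; rfl

theorem squareZero_Qtot (hQ : HasDegree Q 1) (h : SquareZero Q) : SquareZero (Qtot W Q) := by
  refine square_zero_of_components odd_one (hasDegree_Qtot hQ).fieldPar
    (forall_prod_coord (fun α => ?_) (fun β => ?_))
  · rw [Qtot_inFst, Qtot_fst hQ, ← act_q Q α, h.apply, map_zero]
  · rw [Qtot_inSnd, Qtot_form hQ, extD, act_deRham_deRham, map_zero]

/-- The exterior derivative is `Q_tot`, up to field strengths. -/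
theorem dAlg_jetToTot (f : (Tot M W).Fn) :
    dAlg M W ((jetToTot M W).pull f) = (jetToTot M W).pull (act (Qtot W Q) f) +
      ∑ α, fieldStrength W Q α *
        (jetToTot M W).pull ((Tot M W).pd (inFst M (ofOpen W).T1 α) f) := by
  rw [dAlg, act_jetToTot fieldPar_dAlg, act_apply, sum_prod_coord, map_add, map_sum, map_sum]
  simp only [map_mul, Qtot_inFst, Qtot_inSnd, jetToTot_formToTot, sumField, join_inFst,
    join_inSnd, deRham_qT, fieldStrength, sub_mul, Finset.sum_sub_distrib]
  have e1 : ∀ α, (fst M.T1 (ofOpen W).T1).pull (M.T1.q (M.dqT α)) = genDA M W α := fun α => by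
    rw [Proj.pull_q, fst_coord]; rfl
  have e2 : ∀ α, (jetToTot M W).pull ((fst M (ofOpen W).T1).pull (Q α)) = onFields M W (Q α) :=
    fun α => rfl
  simp only [e1, e2]
  abel

theorem dAlg_jetToTot_sub_mem (hQ : HasDegree Q 1) (f : (Tot M W).Fn) :
    dAlg M W ((jetToTot M W).pull f) - (jetToTot M W).pull (act (Qtot W Q) f) ∈
      fieldIdeal W Q := by
  rw [dAlg_jetToTot (Q := Q), add_sub_cancel_left]
  exact Ideal.sum_mem _ fun α _ => fieldIdeal_mul_right hQ (fieldStrength_mem α) _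

theorem dAlg_genDA (α : M.Coord) : dAlg M W (genDA M W α) = 0 := by
  rw [dAlg, genDA, act_q, sumField, join_inFst, deRham_dqT, map_zero]

/-- The generalized Bianchi identities. -/
theorem bianchi (hQ : HasDegree Q 1) (h : SquareZero Q) : Bianchi W Q := by
  refine fun G hG => act_mem_fieldIdeal fieldPar_dAlg (fun α => ?_) hG
  change dAlg M W (genDA M W α - onFields M W (Q α)) ∈ _
  rw [map_sub, dAlg_genDA, zero_sub]
  refine Ideal.neg_mem_iff _ |>.2 ?_
  -- Modulo the ideal, d maps `Q^α(A)` to `(Q Q^α)(A)`, and `Q Q^α = Q² q^α = 0`.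
  have := dAlg_jetToTot_sub_mem (W := W) hQ ((fst M (ofOpen W).T1).pull (Q α))
  rwa [Qtot_fst hQ, ← act_q Q α, h.apply, map_zero, map_zero, sub_zero, act_q] at this

theorem isHomog_formToTot {k : ℤ} {η : Forms W} (h : IsHomog k η) :
    IsHomog k (formToTot M W η) := isMorphism_snd.isHomog h

theorem principal_inFst (ε : GaugeParam M W) (α : M.Coord) :
    principal V ε (inFst M (ofOpen W).T1 α) = formToTot M W (extD W (ε.form α)) +
      ∑ β, formToTot M W (ε.form β) * (fst M (ofOpen W).T1).pull (V α β) := join_inFst _ _ α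

theorem principal_inSnd (ε : GaugeParam M W) (β : (ofOpen W).T1.Coord) :
    principal V ε (inSnd M (ofOpen W).T1 β) = 0 := join_inSnd _ _ β

theorem isHomog_principal
    (hV : ∀ α β, IsHomog ((M.deg α : ℤ) - (M.deg β : ℤ) + 1) (V α β)) (ε : GaugeParam M W)
    (α : M.Coord) : IsHomog (M.deg α) (principal V ε (inFst M (ofOpen W).T1 α)) := by
  rw [principal_inFst]
  refine IsHomog.add ?_ (IsHomog.sum fun β _ => ?_)
  · have := isHomog_formToTot (M := M) (isHomog_extD (ε.homog α))
    rwa [sub_add_cancel] at this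
  · have := (isHomog_formToTot (M := M) (ε.homog β)).mul
      (isMorphism_fst (D' := (ofOpen W).T1).isHomog (hV α β))
    convert this using 1
    ring

theorem isHomog_variation
    (hV : ∀ α β, IsHomog ((M.deg α : ℤ) - (M.deg β : ℤ) + 1) (V α β)) (T : IdealTerms W Q)
    (ε : GaugeParam M W) (α : M.Coord) : IsHomog (M.deg α) (variation V T ε α) :=
  (isMorphism_jetToTot.isHomog (isHomog_principal hV ε α)).add (T.homog ε α)

/-- The components of the gauge transformation. -/
def gaugeField (V : M.Coord → M.Coord → M.Fn) (T : IdealTerms W Q) (ε : GaugeParam M W) :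
    (Jet M W).VectorField :=
  join M.T1 (ofOpen W).T1
    (M.joinT (fun α => variation V T ε α) (fun α => dAlg M W (variation V T ε α)))
    (fun _ => 0)

theorem gaugeField_qT (T : IdealTerms W Q) (ε : GaugeParam M W) (α : M.Coord) :
    gaugeField V T ε (inFst M.T1 (ofOpen W).T1 (M.qT α)) = variation V T ε α := by
  rw [gaugeField, join_inFst, joinT_qT]

theorem gaugeField_dqT (T : IdealTerms W Q) (ε : GaugeParam M W) (α : M.Coord) :
    gaugeField V T ε (inFst M.T1 (ofOpen W).T1 (M.dqT α)) = dAlg M W (variation V T ε α) := by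
  rw [gaugeField, join_inFst, joinT_dqT]

theorem gaugeField_inSnd (T : IdealTerms W Q) (ε : GaugeParam M W) (β : (ofOpen W).T1.Coord) :
    gaugeField V T ε (inSnd M.T1 (ofOpen W).T1 β) = 0 := by
  rw [gaugeField, join_inSnd]

theorem fieldPar_gaugeField
    (hV : ∀ α β, IsHomog ((M.deg α : ℤ) - (M.deg β : ℤ) + 1) (V α β)) (T : IdealTerms W Q)
    (ε : GaugeParam M W) : FieldPar 0 (gaugeField V T ε) := by
  refine HasDegree.fieldPar (hasDegree_join (forall_T1_coord (fun α => ?_) (fun α => ?_))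
    fun β => isHomog_zero _)
  · rw [joinT_qT, deg_qT, add_zero]; exact isHomog_variation hV T ε α
  · rw [joinT_dqT, deg_dqT, add_zero]
    exact_mod_cast isHomog_dAlg (isHomog_variation hV T ε α)

theorem gaugeTrafo_jetToTot
    (hV : ∀ α β, IsHomog ((M.deg α : ℤ) - (M.deg β : ℤ) + 1) (V α β)) (T : IdealTerms W Q)
    (ε : GaugeParam M W) (f : (Tot M W).Fn) :
    gaugeTrafo V T ε ((jetToTot M W).pull f) = ∑ α, variation V T ε α *
      (jetToTot M W).pull ((Tot M W).pd (inFst M (ofOpen W).T1 α) f) := by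
  change act (gaugeField V T ε) _ = _
  rw [act_jetToTot (fieldPar_gaugeField hV T ε)]
  simp only [gaugeField_qT, gaugeField_inSnd, zero_mul, Finset.sum_const_zero, add_zero]

theorem gaugeTrafo_genDA (T : IdealTerms W Q) (ε : GaugeParam M W) (α : M.Coord) :
    gaugeTrafo V T ε (genDA M W α) = dAlg M W (variation V T ε α) := by
  change act (gaugeField V T ε) _ = _
  rw [genDA, act_q, gaugeField_dqT]

/-- The derivative is the action of the constant vector field with the single component 1, so the
chain rule for `fst` applies to it. -/
theorem pd_fst_pull (α : M.Coord) (f : M.Fn) :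
    (Tot M W).pd (inFst M (ofOpen W).T1 α) ((fst M (ofOpen W).T1).pull f) =
      (fst M (ofOpen W).T1).pull (M.pd α f) := by
  classical
  have h : FieldPar (D := Tot M W) (-(Tot M W).deg (inFst M (ofOpen W).T1 α))
      (Pi.single (inFst M (ofOpen W).T1 α) 1) := by
    intro γ
    by_cases hγ : γ = inFst M (ofOpen W).T1 α
    · subst hγ
      rw [Pi.single_eq_same, add_neg_cancel]
      exact isHomog_one.hasPar
    · rw [Pi.single_eq_of_ne hγ]; exact hasPar_zero _
  have e : ∀ f, act (Pi.single (inFst M (ofOpen W).T1 α) 1 : (Tot M W).VectorField) f =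
      (Tot M W).pd (inFst M (ofOpen W).T1 α) f := by
    intro f
    rw [act_apply, Finset.sum_eq_single (inFst M (ofOpen W).T1 α)]
    · rw [Pi.single_eq_same, one_mul]
    · intro γ _ hγ; rw [Pi.single_eq_of_ne hγ, zero_mul]
    · simp
  rw [← e, act_fst_pull h, Finset.sum_eq_single α]
  · rw [Pi.single_eq_same, one_mul]
  · intro γ _ hγ; rw [Pi.single_eq_of_ne (fun h => hγ (inFst_injective h)), zero_mul]
  · simp

theorem gaugeTrafo_fieldStrength
    (hV : ∀ α β, IsHomog ((M.deg α : ℤ) - (M.deg β : ℤ) + 1) (V α β)) (T : IdealTerms W Q)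
    (ε : GaugeParam M W) (α : M.Coord) :
    gaugeTrafo V T ε (fieldStrength W Q α) = dAlg M W (variation V T ε α) -
      ∑ β, variation V T ε β * onFields M W (M.pd β (Q α)) := by
  rw [fieldStrength, map_sub, gaugeTrafo_genDA]
  change _ - gaugeTrafo V T ε ((jetToTot M W).pull ((fst M (ofOpen W).T1).pull (Q α))) = _
  rw [gaugeTrafo_jetToTot hV]
  simp only [pd_fst_pull]
  rfl

theorem preservesIdeal_of_fieldStrength
    (hV : ∀ α β, IsHomog ((M.deg α : ℤ) - (M.deg β : ℤ) + 1) (V α β)) {T : IdealTerms W Q}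
    (h : ∀ ε α, gaugeTrafo V T ε (fieldStrength W Q α) ∈ fieldIdeal W Q) : PreservesIdeal V T :=
  fun ε _ hG => act_mem_fieldIdeal (fieldPar_gaugeField hV T ε) (h ε) hG

/-! ### Inner automorphisms -/

/-- The components of the graded commutator of `Q_tot` with a vertical vector field. -/
theorem oddBracket_Qtot (hQ : HasDegree Q 1) {v : (Tot M W).VectorField} (hv : IsVertical v)
    (hd : HasDegree v (-1)) : ∃ u : (Tot M W).VectorField,
      oddBracket (Qtot W Q) v = act u ∧ (∀ β, u (inSnd M (ofOpen W).T1 β) = 0) ∧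
      ∀ α, u (inFst M (ofOpen W).T1 α) = act (Qtot W Q) (v (inFst M (ofOpen W).T1 α)) +
        ∑ β, v (inFst M (ofOpen W).T1 β) * (fst M (ofOpen W).T1).pull (M.pd β (Q α)) := by
  -- Only parity enters the formula for the commutator, and degree -1 has the same parity as degree
  -- 1.
  have hv1 : FieldPar 1 v := fun γ => (hd.fieldPar γ).of_sub_even ⟨-1, by ring⟩
  refine ⟨_, oddBracket_eq_act odd_one (hasDegree_Qtot hQ).fieldPar hv1, fun β => ?_, fun α => ?_⟩
  · rw [hv, map_zero, zero_add, Qtot_inSnd, formToTot, act_snd_pull hv1]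
    exact Finset.sum_eq_zero fun β _ => by rw [hv, zero_mul]
  · rw [Qtot_inFst, act_fst_pull hv1]

/-- With `u = [Q_tot, v]`, modulo the ideal: `d δA^α ≡ d(u q^α) ≡ Q_tot u q^α = u Q_tot q^α = u Q^α
≡ δ(Q^α(A))`. The first congruence uses the Bianchi identities. The difference of the two ends is
`δF^α`. -/
theorem preservesIdeal_of_isInnerModIdeal (hQ : HasDegree Q 1) (hQ2 : SquareZero Q)
    (hV : ∀ α β, IsHomog ((M.deg α : ℤ) - (M.deg β : ℤ) + 1) (V α β)) {T : IdealTerms W Q}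
    (h : IsInnerModIdeal V T) : PreservesIdeal V T := by
  refine preservesIdeal_of_fieldStrength hV fun ε α => ?_
  obtain ⟨v, hv, hdv, hvar⟩ := h ε
  obtain ⟨u, hu, hu2, -⟩ := oddBracket_Qtot hQ hv hdv
  rw [hu] at hvar
  -- Since `Q_tot² = 0`, both sides equal `Q_tot v Q_tot f`.
  have hcomm : ∀ f, act (Qtot W Q) (act u f) = act u (act (Qtot W Q) f) := by
    intro f
    have h2 := squareZero_Qtot (W := W) hQ hQ2
    have e : ∀ f, act u f = act (Qtot W Q) (act v f) + act v (act (Qtot W Q) f) := fun f => by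
      rw [← hu]; rfl
    rw [e, e, map_add, h2.apply, h2.apply, map_zero, zero_add, add_zero]
  have h1 : ∀ f, gaugeTrafo V T ε ((jetToTot M W).pull f) - (jetToTot M W).pull (act u f) ∈
      fieldIdeal W Q := by
    intro f
    rw [gaugeTrafo_jetToTot hV, act_apply, sum_prod_coord]
    simp only [hu2, zero_mul, Finset.sum_const_zero, add_zero, map_sum, map_mul,
      ← Finset.sum_sub_distrib, ← sub_mul]
    refine Ideal.sum_mem _ fun β _ => fieldIdeal_mul_right hQ ?_ _
    have := hvar β
    rwa [act_q] at this
  have h2 := bianchi hQ hQ2 _ (hvar α)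
  have h3 := dAlg_jetToTot_sub_mem (W := W) hQ (act u ((Tot M W).q (inFst M (ofOpen W).T1 α)))
  have h4 := h1 ((fst M (ofOpen W).T1).pull (Q α))
  rw [hcomm, act_q, act_q (Qtot W Q), Qtot_inFst] at h3
  rw [map_sub, act_q u] at h2
  rw [fieldStrength, map_sub, gaugeTrafo_genDA]
  have h5 := Ideal.sub_mem _ (Ideal.add_mem _ h2 h3) h4
  convert h5 using 1
  change _ - gaugeTrafo V T ε ((jetToTot M W).pull ((fst M (ofOpen W).T1).pull (Q α))) = _
  abel

theorem IsInner.isInnerModIdeal (h : IsInner W Q V) (T : IdealTerms W Q) :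
    IsInnerModIdeal V T := by
  intro ε
  obtain ⟨v, hv, hd, he⟩ := h ε
  refine ⟨v, hv, hd, fun α => ?_⟩
  rw [← he, act_q, variation, add_sub_cancel_left]
  exact T.mem ε α

theorem isVertical_paramField (ε : GaugeParam M W) : IsVertical (paramField ε) :=
  fun μ => join_inSnd _ _ μ

theorem paramField_inFst (ε : GaugeParam M W) (α : M.Coord) :
    paramField ε (inFst M (ofOpen W).T1 α) = formToTot M W (ε.form α) := join_inFst _ _ α

theorem hasDegree_paramField (ε : GaugeParam M W) : HasDegree (paramField ε) (-1) :=
  hasDegree_join (fun α => isHomog_formToTot (ε.homog α)) (fun _ => isHomog_zero _)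

theorem IsInnerByParam.isInner (h : IsInnerByParam W Q V) : IsInner W Q V :=
  fun ε => ⟨paramField ε, isVertical_paramField ε, hasDegree_paramField ε, h ε⟩

theorem form_eq_zero_of_deg_eq_zero (ε : GaugeParam M W) {β : M.Coord} (hβ : M.deg β = 0) :
    ε.form β = 0 :=
  (ε.homog β).eq_zero_of_neg (by rw [hβ]; norm_num)

/-- In components, `Q_tot` on `ε^α` gives `dε^α` and `ε^β ∂_β` on `Q^α` gives the rest. Coefficients
with |β| = 0 do not matter, because there `ε^β` has degree -1 and vanishes. -/
theorem CoeffsAgree.isInnerByParam (hQ : HasDegree Q 1) (h : CoeffsAgree Q V) :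
    IsInnerByParam W Q V := by
  intro ε
  obtain ⟨u, hu, hu2, hu1⟩ := oddBracket_Qtot hQ (isVertical_paramField ε) (hasDegree_paramField ε)
  rw [hu]
  congr 1
  refine funext (forall_prod_coord (fun α => ?_) (fun β => ?_))
  · rw [principal_inFst, hu1, paramField_inFst, Qtot_form hQ]
    congr 1
    refine Finset.sum_congr rfl fun β _ => ?_
    rw [paramField_inFst]
    rcases Nat.eq_zero_or_pos (M.deg β) with h0 | h0
    · rw [form_eq_zero_of_deg_eq_zero ε h0, map_zero, zero_mul, zero_mul]
    · rw [h α β h0]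
  · rw [principal_inSnd, hu2]

/-! ### Variations of the field strengths on shell -/

/-- Evaluation of a configuration at σ is an algebra homomorphism whose kernel contains all F, hence
the whole ideal. -/
theorem PreservesIdeal.vanishesOnShell {T : IdealTerms W Q} (h : PreservesIdeal V T) :
    VanishesOnShell V T := by
  intro ε a σ ha α
  have hle : fieldIdeal W Q ≤
      RingHom.ker (((ofOpen W).T1.evalAt σ).comp a.hom : Alg M W →ₐ[ℝ] _) :=
    Ideal.span_le.2 (by rintro _ ⟨β, rfl⟩; exact ha β)
  exact hle (h ε _ (fieldStrength_mem α))

/-- The terms in the variation of `F^α` that do not belong to the field strength ideal. -/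
def onShellVariation (Q : M.VectorField) (V : M.Coord → M.Coord → M.Fn) (ε : GaugeParam M W)
    (α : M.Coord) : (Tot M W).Fn :=
  ∑ β, formToTot M W (extD W (ε.form β)) *
      (fst M (ofOpen W).T1).pull (V α β - M.pd β (Q α)) +
    ∑ β, formToTot M W (ε.form β) * (fst M (ofOpen W).T1).pull
      (koszulSign 1 (M.deg β - 1) • act Q (V α β) - ∑ γ, V γ β * M.pd γ (Q α))

/-- The terms `d²ε` vanish, and the sign before `Q V` comes from moving `Q_tot` past `ε^β`, a form
of degree |β| - 1. -/
theorem onShellVariation_eq (hQ : HasDegree Q 1) (ε : GaugeParam M W) (α : M.Coord) :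
    onShellVariation Q V ε α =
      act (Qtot W Q) (principal V ε (inFst M (ofOpen W).T1 α)) -
        ∑ β, principal V ε (inFst M (ofOpen W).T1 β) *
          (fst M (ofOpen W).T1).pull (M.pd β (Q α)) := by
  simp only [principal_inFst, map_add, map_sum, Qtot_form hQ, extD_extD, map_zero, zero_add,
    act_mul (hasDegree_Qtot (W := W) hQ).fieldPar, Qtot_fst hQ,
    (isHomog_formToTot (M := M) (ε.homog _)).hasPar.tw, onShellVariation, map_sub, mul_sub,
    Finset.sum_sub_distrib, Finset.sum_add_distrib, add_mul, Finset.sum_mul, map_mul,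
    Finset.mul_sum, map_smul, mul_smul_comm, smul_mul_assoc, mul_assoc]
  rw [Finset.sum_comm (f := fun x y => formToTot M W (ε.form x) *
    ((fst M (ofOpen W).T1).pull (V y x) * (fst M (ofOpen W).T1).pull (M.pd y (Q α))))]
  abel

/-- The assumption `hT` replaces `Q² = 0`, so that the formula can also be used to derive the
latter. -/
theorem gaugeTrafo_fieldStrength_sub_mem (hQ : HasDegree Q 1)
    (hV : ∀ α β, IsHomog ((M.deg α : ℤ) - (M.deg β : ℤ) + 1) (V α β)) (T : IdealTerms W Q)
    (hT : ∀ ε α, dAlg M W (T.term ε α) ∈ fieldIdeal W Q) (ε : GaugeParam M W) (α : M.Coord) :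
    gaugeTrafo V T ε (fieldStrength W Q α) -
      (jetToTot M W).pull (onShellVariation Q V ε α) ∈ fieldIdeal W Q := by
  have h1 := dAlg_jetToTot_sub_mem (W := W) hQ (principal V ε (inFst M (ofOpen W).T1 α))
  have h2 : ∑ β, T.term ε β * onFields M W (M.pd β (Q α)) ∈ fieldIdeal W Q :=
    Ideal.sum_mem _ fun β _ => fieldIdeal_mul_right hQ (T.mem ε β) _
  have h3 := Ideal.sub_mem _ (Ideal.add_mem _ h1 (hT ε α)) h2
  convert h3 using 1
  rw [gaugeTrafo_fieldStrength hV, onShellVariation_eq hQ]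
  simp only [variation, map_add, map_sub, map_sum, map_mul, add_mul, Finset.sum_add_distrib]
  have e : ∀ β, (jetToTot M W).pull ((fst M (ofOpen W).T1).pull (M.pd β (Q α))) =
    onFields M W (M.pd β (Q α)) := fun β => rfl
  simp only [e]
  abel

/-- The on-shell vanishing of the variations of the field strengths, spelled out. -/
theorem VanishesOnShell.sum_eq_zero (hQ : HasDegree Q 1)
    (hV : ∀ α β, IsHomog ((M.deg α : ℤ) - (M.deg β : ℤ) + 1) (V α β)) {T : IdealTerms W Q}
    (hT : ∀ ε α, dAlg M W (T.term ε α) ∈ fieldIdeal W Q) (h : VanishesOnShell V T)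
    (ε : GaugeParam M W) (a : FieldConfig M W) (σ : (ofOpen W).T1.U)
    (ha : ∀ β, (ofOpen W).T1.constAt σ (a.hom (fieldStrength W Q β)) = 0) (α : M.Coord) :
    ∑ β, (ofOpen W).T1.constAt σ (extD W (ε.form β)) *
        (ofOpen W).T1.constAt σ (a.hom (onFields M W (V α β - M.pd β (Q α)))) +
      ∑ β, (ofOpen W).T1.constAt σ (ε.form β) *
        (ofOpen W).T1.constAt σ (a.hom (onFields M W
          (koszulSign 1 (M.deg β - 1) • act Q (V α β) - ∑ γ, V γ β * M.pd γ (Q α)))) = 0 := by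
  have hle : fieldIdeal W Q ≤
      RingHom.ker (((ofOpen W).T1.constAt σ).comp a.hom : Alg M W →ₐ[ℝ] _) :=
    Ideal.span_le.2 (by rintro _ ⟨β, rfl⟩; exact ha β)
  have h1 := hle (gaugeTrafo_fieldStrength_sub_mem hQ hV T hT ε α)
  have h2 := (evalAt_eq_zero_iff _ _).1
    (h ε a σ (fun β => (evalAt_eq_zero_iff _ _).2 (ha β)) α)
  have h3 : (ofOpen W).T1.constAt σ
      (a.hom ((jetToTot M W).pull (onShellVariation Q V ε α))) = 0 := by
    rw [RingHom.mem_ker] at h1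
    change (ofOpen W).T1.constAt σ (a.hom _) = 0 at h1
    rw [map_sub, map_sub, h2, zero_sub] at h1
    exact neg_eq_zero.1 h1
  rw [← h3]
  have e1 : ∀ η : Forms W, a.hom ((jetToTot M W).pull (formToTot M W η)) = η := fun η => by
    rw [jetToTot_formToTot, a.map_form]
  have e2 : ∀ f : M.Fn, (jetToTot M W).pull ((fst M (ofOpen W).T1).pull f) =
    onFields M W f := fun f => rfl
  simp only [onShellVariation, map_add, map_sum (jetToTot M W).pull, map_sum a.hom,
    map_sum ((ofOpen W).T1.constAt σ), map_mul (jetToTot M W).pull, map_mul a.hom,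
    map_mul ((ofOpen W).T1.constAt σ), e1, e2]

end HigherGauge

/-! ### Test functions and first-order shifts of evaluations -/

/-- Small smooth functions with prescribed first order behaviour at a point. -/
theorem exists_small_coordinates {B : Type} [Fintype B] [DecidableEq B] {U : Opens (B → ℝ)}
    (x : U) {r : ℝ} (hr : 0 < r) : ∃ g : B → smoothFns U, (∀ i, (g i : U → ℝ) x = 0) ∧
      (∀ i y, |(g i : U → ℝ) y| ≤ r) ∧
      ∀ i j, (smoothPd i (g j) : U → ℝ) x = if i = j then 1 else 0 := by
  have hc : ∀ j : B, ContDiff ℝ ∞ (fun y : B → ℝ => r * Real.sin ((y j - (x : B → ℝ) j) / r)) :=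
    fun j => contDiff_const.mul (Real.contDiff_sin.comp
      (((contDiff_apply ℝ ℝ j).sub contDiff_const).div_const r))
  -- The function `r sin(t/r)` has derivative 1 at 0 and is bounded by `r` everywhere; `W` may be
  -- unbounded, so the coordinate itself would not do.
  refine ⟨fun j => ⟨fun y => r * Real.sin (((y : B → ℝ) j - (x : B → ℝ) j) / r),
    (hc j).contDiffOn.congr fun y hy => extend_eqOn U _ hy⟩, fun i => by simp, fun i y => ?_,
    fun i j => ?_⟩
  · simp only [abs_mul, abs_of_pos hr]
    exact mul_le_of_le_one_right hr.le (Real.abs_sin_le_one _)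
  · rw [smoothPd_of_contDiff i _
      (fun y : B → ℝ => r * Real.sin ((y j - (x : B → ℝ) j) / r)) (fun y => rfl) x]
    have h1 : HasFDerivAt (fun y : B → ℝ => y j)
      (ContinuousLinearMap.proj (R := ℝ) (φ := fun _ : B => ℝ) j) (x : B → ℝ) :=
      (ContinuousLinearMap.proj (R := ℝ) (φ := fun _ : B => ℝ) j).hasFDerivAt
    have h2 := (((h1.sub_const ((x : B → ℝ) j)).mul_const r⁻¹).sin).const_mul r
    simp only [← div_eq_mul_inv] at h2
    rw [h2.fderiv]
    by_cases h : i = j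
    · subst h; simp [hr.ne']
    · simp [h, Ne.symm h]

namespace GradedDomain

variable {D D' : GradedDomain}

theorem pd_constAt_inl (x : D.U) (i : D.B) (f : D.Fn) : D.pd (.inl i) (D.constAt x f) = 0 := by
  refine pure_induction (p := fun f => D.pd (.inl i) (D.constAt x f) = 0) (fun f g hf hg => ?_)
    (fun s m y => ?_) f
  · rw [map_add, map_add, hf, hg, add_zero]
  · rw [constAt_pure, map_smul, pd_inl_pure, smoothPd_one, pure_zero_left, smul_zero]

theorem pd_constAt_inr (x : D.U) (α : D.E ⊕ D.O) (f : D.Fn) :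
    D.pd (.inr α) (D.constAt x f) = D.constAt x (D.pd (.inr α) f) := by
  refine pure_induction (p := fun f => D.pd (.inr α) (D.constAt x f) =
    D.constAt x (D.pd (.inr α) f)) (fun f g hf hg => ?_) (fun s m y => ?_) f
  · simp only [map_add, hf, hg]
  · rcases α with e | o
    · rw [constAt_pure, map_smul, pd_even_pure, pd_even_pure, constAt_pure]
    · rw [constAt_pure, map_smul, pd_odd_pure, pd_odd_pure, constAt_pure]

/-- A homogeneous function of nonzero degree vanishes if its derivatives along the coordinates of
positive degree do. -/
theorem IsHomog.eq_zero_of_pd {k : ℤ} (hk : k ≠ 0) {f : D.Fn} (hf : IsHomog k f)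
    (h : ∀ α : D.E ⊕ D.O, D.pd (.inr α) f = 0) : f = 0 := by
  rw [isHomog_iff, act_apply, Fintype.sum_sum_type] at hf
  simp only [h, mul_zero, Finset.sum_const_zero, add_zero, euler, deg, Nat.cast_zero, zero_smul,
    zero_mul] at hf
  exact (smul_eq_zero.1 hf.symm).resolve_left (by exact_mod_cast hk)

open Classical in
/-- Shifting the value of one coordinate by a function of square zero. -/
theorem lift_add_single (b : D.B → smoothFns D'.U)
    (hb : ∀ y : D'.U, (fun i => (b i : D'.U → ℝ) y) ∈ D.U) (a a' : D.E ⊕ D.O → D'.Fn)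
    (ha : ∀ α, IsHomog (D.deg (.inr α)) (a α)) (ha' : ∀ α, IsHomog (D.deg (.inr α)) (a' α))
    (γ : D.E ⊕ D.O) (η : D'.Fn) (hη : IsHomog (D.deg (.inr γ)) η) (h0 : η * η = 0)
    (haa' : ∀ α, a' α = a α + if α = γ then η else 0) (f : D.Fn) :
    lift b hb a' ha' f = lift b hb a ha f + η * lift b hb a ha (D.pd (.inr γ) f) := by
  refine Fn.induction (p := fun f => lift b hb a' ha' f = lift b hb a ha f +
    η * lift b hb a ha (D.pd (.inr γ) f)) (fun f g hf hg => ?_) (fun s => ?_) (fun β f hf => ?_) f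
  · simp only [map_add, hf, hg, mul_add]; abel
  · rw [lift_emb, lift_emb, pd_inr_emb, map_zero, mul_zero, add_zero]
  · have hc : a β * η = koszulSign (D.deg (.inr γ)) (D.deg (.inr β)) • (η * a β) := by
      rw [(ha β).hasPar.mul_comm hη.hasPar, koszulSign_comm]
    rw [map_mul, map_mul, hf, lift_q, lift_q, haa', pd_q_mul, map_add, map_smul, map_mul, lift_q,
      mul_add, add_mul, add_mul, ← mul_assoc (a β), hc]
    by_cases h : β = γ
    · subst h
      simp only [if_true, smul_mul_assoc, mul_assoc, mul_add, mul_smul_comm]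
      -- The Taylor expansion in `η` stops after the linear term because `η² = 0`.
      rw [← mul_assoc η η, h0, zero_mul, add_zero]
      abel
    · have h' : (Sum.inr γ : D.Coord) ≠ Sum.inr β := fun e => h (Sum.inr.inj e).symm
      simp only [h, h', if_false, zero_mul, add_zero, map_zero, zero_add, smul_mul_assoc,
        mul_smul_comm, mul_assoc]

end GradedDomain

namespace HigherGauge

open GradedDomain

variable {M : GradedDomain} {d : ℕ} {W : Opens (Fin d → ℝ)} {Q : M.VectorField}
  {V : M.Coord → M.Coord → M.Fn}

/-! ### Differential forms -/

/-- The coordinate differential `dσ^μ`. -/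
def dCoord (W : Opens (Fin d → ℝ)) (μ : (ofOpen W).B) : Forms W :=
  (ofOpen W).T1.q ((ofOpen W).dqT (.inl μ))

theorem sum_ofOpen_coord {R : Type*} [AddCommMonoid R] (f : (ofOpen W).Coord → R) :
    ∑ γ, f γ = ∑ μ : (ofOpen W).B, f (.inl μ) := by
  have h : IsEmpty ((ofOpen W).E ⊕ (ofOpen W).O) :=
    inferInstanceAs (IsEmpty (Empty ⊕ Empty))
  refine (Fintype.sum_sum_type _).trans ?_
  rw [Finset.univ_eq_empty (α := (ofOpen W).E ⊕ (ofOpen W).O), Finset.sum_empty, add_zero]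

theorem extD_eq_sum (η : Forms W) : extD W η =
    ∑ μ : (ofOpen W).B, dCoord W μ * (ofOpen W).T1.pd ((ofOpen W).qT (.inl μ)) η := by
  rw [extD, act_apply, sum_T1_coord, sum_ofOpen_coord]
  simp only [deRham_qT, deRham_dqT, zero_mul, Finset.sum_const_zero, add_zero]
  rfl

theorem euler_forms (η : Forms W) : act (ofOpen W).T1.euler η =
    ∑ μ : (ofOpen W).B, dCoord W μ * (ofOpen W).T1.pd ((ofOpen W).dqT (.inl μ)) η := by
  rw [act_apply, sum_T1_coord, sum_ofOpen_coord, sum_ofOpen_coord]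
  simp only [euler, deg_qT, deg_dqT]
  simp only [deg, Nat.cast_zero, zero_smul, zero_mul,
    Finset.sum_const_zero, zero_add, Nat.cast_one, one_smul]
  rfl

theorem isHomog_dCoord (μ : (ofOpen W).B) : IsHomog 1 (dCoord W μ) :=
  isHomog_q (D := (ofOpen W).T1) ((ofOpen W).dqT (.inl μ))

theorem constAt_dCoord (σ : (ofOpen W).T1.U) (μ : (ofOpen W).B) :
    (ofOpen W).T1.constAt σ (dCoord W μ) = dCoord W μ := constAt_q _ _

theorem extD_constAt (σ : (ofOpen W).T1.U) (η : Forms W) :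
    extD W ((ofOpen W).T1.constAt σ η) = 0 := by
  rw [extD_eq_sum]
  exact Finset.sum_eq_zero fun μ _ => (congrArg (dCoord W μ * ·) (pd_constAt_inl _ _ _)).trans
    (mul_zero _)

theorem extD_emb_mul (s : smoothFns (ofOpen W).T1.U) (η : Forms W) :
    extD W ((ofOpen W).T1.emb s * η) =
      extD W ((ofOpen W).T1.emb s) * η + (ofOpen W).T1.emb s * extD W η := act_emb_mul _ _ _

theorem constAt_extD_emb (σ : (ofOpen W).T1.U) (s : smoothFns (ofOpen W).T1.U) :
    (ofOpen W).T1.constAt σ (extD W ((ofOpen W).T1.emb s)) =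
      ∑ μ : (ofOpen W).T1.B, ((smoothPd μ s : (ofOpen W).T1.U → ℝ) σ) • dCoord W μ := by
  rw [extD_eq_sum, map_sum]
  refine Finset.sum_congr rfl fun μ _ => ?_
  rw [map_mul, constAt_dCoord]
  refine (congrArg (dCoord W μ * ·) (constAt_emb σ (smoothPd μ s))).trans ?_
  rw [Algebra.algebraMap_eq_smul_one]
  exact (mul_smul_comm _ _ _).trans (by rw [mul_one]; rfl)

/-! ### Field configurations -/

/-- The gauge fields with scalar fields `b` and forms `a` of positive degree, as a family indexed by
all coordinates of `M`. -/
def fieldsOf (b : M.B → smoothFns (ofOpen W).T1.U) (a : M.E ⊕ M.O → Forms W) : M.Coord → Forms W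
  | .inl i => (ofOpen W).T1.emb (b i)
  | .inr α => a α

theorem lift_q_eq_fieldsOf (b : M.B → smoothFns (ofOpen W).T1.U)
    (hb : ∀ y : (ofOpen W).T1.U, (fun i => (b i : (ofOpen W).T1.U → ℝ) y) ∈ M.U)
    (a : M.E ⊕ M.O → Forms W) (ha : ∀ α, IsHomog (M.deg (.inr α)) (a α)) (α : M.Coord) :
    lift b hb a ha (M.q α) = fieldsOf b a α := by
  rcases α with i | α
  · rw [q_inl, lift_emb, smoothComp_coord]; rfl
  · rw [lift_q]; rfl

/-- The values on the generators of positive degree of the evaluation on gauge fields. -/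
def configValues (A : M.Coord → Forms W) : (Jet M W).E ⊕ (Jet M W).O → Forms W
  | .inl (.inl x) => M.joinT A (fun α => extD W (A α)) (.inr (.inl x))
  | .inl (.inr x) => (ofOpen W).T1.q (.inr (.inl x))
  | .inr (.inl x) => M.joinT A (fun α => extD W (A α)) (.inr (.inr x))
  | .inr (.inr x) => (ofOpen W).T1.q (.inr (.inr x))

theorem isHomog_configValues {A : M.Coord → Forms W} (hA : ∀ α, IsHomog (M.deg α) (A α)) :
    ∀ γ, IsHomog ((Jet M W).deg (.inr γ)) (configValues A γ) := by
  have h : ∀ γ, IsHomog (M.T1.deg γ) (M.joinT A (fun α => extD W (A α)) γ) :=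
    forall_T1_coord (fun α => by rw [joinT_qT, deg_qT]; exact hA α)
      (fun α => by rw [joinT_dqT, deg_dqT]; exact_mod_cast isHomog_extD (hA α))
  rintro ((x | x) | (x | x))
  exacts [h (.inr (.inl x)), isHomog_q (D := (ofOpen W).T1) (.inr (.inl x)), h (.inr (.inr x)),
    isHomog_q (D := (ofOpen W).T1) (.inr (.inr x))]

/-- Field configurations exist for arbitrary gauge fields. -/
theorem exists_fieldConfig (b : M.B → smoothFns (ofOpen W).T1.U)
    (hb : ∀ y : (ofOpen W).T1.U, (fun i => (b i : (ofOpen W).T1.U → ℝ) y) ∈ M.U)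
    (a : M.E ⊕ M.O → Forms W) (ha : ∀ α, IsHomog (M.deg (.inr α)) (a α)) :
    ∃ F : FieldConfig M W, (∀ f, F.hom (onFields M W f) = lift b hb a ha f) ∧
      ∀ α, F.hom (genDA M W α) = extD W (fieldsOf b a α) := by
  have hA : ∀ α, IsHomog (M.deg α) (fieldsOf b a α) := fun α => by
    rw [← lift_q_eq_fieldsOf b hb a ha]
    exact (isMorphism_lift b hb a ha).isHomog_q α
  set b' : (Jet M W).B → smoothFns (ofOpen W).T1.U := Sum.elim b smoothCoord with hb'_def
  have hb' : ∀ y : (ofOpen W).T1.U,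
      (fun i => (b' i : (ofOpen W).T1.U → ℝ) y) ∈ (Jet M W).U := fun y => ⟨hb y, y.2⟩
  set φ := lift (D := Jet M W) b' hb' (configValues (fieldsOf b a)) (isHomog_configValues hA)
  have hφ : IsMorphism φ := isMorphism_lift _ _ _ _
  have h1 : ∀ γ, φ ((Jet M W).q (inFst M.T1 (ofOpen W).T1 γ)) =
      M.joinT (fieldsOf b a) (fun α => extD W (fieldsOf b a α)) γ := by
    rintro (i | e | o)
    · exact lift_emb b' hb' _ _ (smoothCoord (Sum.inl i : M.T1.B ⊕ (ofOpen W).T1.B))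
    · exact lift_q b' hb' _ _ (.inl (.inl e))
    · exact lift_q b' hb' _ _ (.inr (.inl o))
  have h2 : ∀ γ, φ ((Jet M W).q (inSnd M.T1 (ofOpen W).T1 γ)) = (ofOpen W).T1.q γ := by
    rintro (i | e | o)
    · exact lift_emb b' hb' _ _ (smoothCoord (Sum.inr i : M.T1.B ⊕ (ofOpen W).T1.B))
    · exact lift_q b' hb' _ _ (.inl (.inr e))
    · exact lift_q b' hb' _ _ (.inr (.inr o))
  have h3 : ∀ η : Forms W, φ ((snd M.T1 (ofOpen W).T1).pull η) = η := by
    have : φ.comp (snd M.T1 (ofOpen W).T1).pull = AlgHom.id ℝ _ := by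
      refine Fn.hom_ext (fun s => ?_) (fun α => ?_)
      · rw [AlgHom.comp_apply, Proj.pull_emb, lift_emb]
        rfl
      · rw [AlgHom.comp_apply, Proj.pull_q, snd_coord, h2]
        rfl
    exact fun η => DFunLike.congr_fun this η
  refine ⟨⟨φ, fun k G hG => hφ.isHomog hG, fun G => ?_, h3⟩, fun f => ?_, fun α => ?_⟩
  -- By the chain rule, commuting with d need only be checked on coordinates.
  · rw [extD, hφ.act_map hasDegree_deRham.fieldPar, dAlg, act_apply, map_sum]
    simp only [map_mul]
    refine Finset.sum_congr rfl fun γ _ => congrArg (· * _) ?_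
    refine forall_prod_coord (p := fun γ => φ (sumField M.deRham (ofOpen W).deRham γ) =
      act (ofOpen W).deRham (φ ((Jet M W).q γ))) (forall_T1_coord (fun α => ?_) (fun α => ?_))
      (fun β => ?_) γ
    · rw [sumField, join_inFst, deRham_qT, Proj.pull_q, fst_coord, h1, h1, joinT_qT, joinT_dqT]
      rfl
    · rw [sumField, join_inFst, deRham_dqT, map_zero, map_zero, h1, joinT_dqT]
      exact (extD_extD _).symm
    · rw [sumField, join_inSnd, h3, h2, act_q]
  · have : φ.comp (onFields M W) = lift b hb a ha := by
      refine Fn.hom_ext (fun s => ?_) (fun α => ?_)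
      · rw [AlgHom.comp_apply, onFields, AlgHom.comp_apply, Proj.pull_emb, Proj.pull_emb,
          lift_emb, lift_emb]
        rfl
      · rw [AlgHom.comp_apply, onFields, AlgHom.comp_apply, Proj.pull_q, Proj.pull_q, fst_coord,
          jetToTot_coord_inFst, h1, joinT_qT, lift_q]
        rfl
    exact DFunLike.congr_fun this f
  · change φ (genDA M W α) = _
    rw [genDA, h1, joinT_dqT]

/-- Evaluation of functions on `M` at a point `x` of the body and values `a` of the coordinates of
positive degree. -/
def pointMap (W : Opens (Fin d → ℝ)) (x : M.U) (a : M.E ⊕ M.O → Forms W)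
    (ha : ∀ α, IsHomog (M.deg (.inr α)) (a α)) : M.Fn →ₐ[ℝ] Forms W :=
  lift (fun i => algebraMap ℝ _ ((x : M.B → ℝ) i)) (fun _ => x.2) a ha

theorem pointMap_emb (x : M.U) (a : M.E ⊕ M.O → Forms W)
    (ha : ∀ α, IsHomog (M.deg (.inr α)) (a α)) (s : smoothFns M.U) :
    pointMap W x a ha (M.emb s) = algebraMap ℝ (Forms W) ((s : M.U → ℝ) x) := by
  refine (lift_emb _ _ _ _ _).trans ?_
  rw [← AlgHom.commutes (ofOpen W).T1.emb]
  rfl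

theorem pointMap_q (x : M.U) (a : M.E ⊕ M.O → Forms W)
    (ha : ∀ α, IsHomog (M.deg (.inr α)) (a α)) (α : M.E ⊕ M.O) :
    pointMap W x a ha (M.q (.inr α)) = a α := lift_q _ _ _ _ _

theorem isMorphism_pointMap (x : M.U) (a : M.E ⊕ M.O → Forms W)
    (ha : ∀ α, IsHomog (M.deg (.inr α)) (a α)) : IsMorphism (pointMap W x a ha) :=
  isMorphism_lift _ _ _ _

theorem constAt_pointMap (σ : (ofOpen W).T1.U) (x : M.U) (a : M.E ⊕ M.O → Forms W)
    (ha : ∀ α, IsHomog (M.deg (.inr α)) (a α))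
    (hc : ∀ α, (ofOpen W).T1.constAt σ (a α) = a α) (f : M.Fn) :
    (ofOpen W).T1.constAt σ (pointMap W x a ha f) = pointMap W x a ha f := by
  have : ((ofOpen W).T1.constAt σ).comp (pointMap W x a ha) = pointMap W x a ha := by
    refine Fn.hom_ext (fun s => ?_) (fun α => ?_)
    · rw [AlgHom.comp_apply, pointMap_emb, AlgHom.commutes]
    · rw [AlgHom.comp_apply, pointMap_q, hc]
  exact DFunLike.congr_fun this f

/-- Small functions on `W` whose differentials at a given point are the coordinate differentials. -/
theorem exists_small_forms (σ : (ofOpen W).T1.U) {r : ℝ} (hr : 0 < r) :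
    ∃ g : (ofOpen W).B → smoothFns (ofOpen W).T1.U,
      (∀ μ, (g μ : (ofOpen W).T1.U → ℝ) σ = 0) ∧
      (∀ μ y, |(g μ : (ofOpen W).T1.U → ℝ) y| ≤ r) ∧
      ∀ μ, (ofOpen W).T1.constAt σ (extD W ((ofOpen W).T1.emb (g μ))) = dCoord W μ := by
  classical
  obtain ⟨g, hg0, hgs, hgd⟩ := exists_small_coordinates (U := (ofOpen W).T1.U) σ hr
  have hgd' : ∀ μ : (ofOpen W).T1.B,
      (ofOpen W).T1.constAt σ (extD W ((ofOpen W).T1.emb (g μ))) = dCoord W μ := by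
    intro μ
    rw [constAt_extD_emb]
    refine (Finset.sum_eq_single μ (fun ν _ hν => ?_) (fun h => ?_)).trans ?_
    · rw [hgd, if_neg hν]; exact zero_smul ℝ (dCoord W ν)
    · exact absurd (Finset.mem_univ _) h
    · rw [hgd, if_pos rfl]; exact one_smul ℝ (dCoord W μ)
  exact ⟨g, hg0, hgs, hgd'⟩

/-- A form with constant coefficients of positive degree is the exterior derivative at a given
point of a form that vanishes there. -/
theorem constAt_extD_homotopy (σ : (ofOpen W).T1.U) (g : (ofOpen W).B → smoothFns (ofOpen W).T1.U)
    (hg0 : ∀ μ, (g μ : (ofOpen W).T1.U → ℝ) σ = 0)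
    (hg : ∀ μ, (ofOpen W).T1.constAt σ (extD W ((ofOpen W).T1.emb (g μ))) = dCoord W μ)
    {k : ℕ} {c : Forms W} (hc : IsHomog (k + 1) c) (hcσ : (ofOpen W).T1.constAt σ c = c) :
    (ofOpen W).T1.constAt σ (extD W (((k : ℝ) + 1)⁻¹ • ∑ μ, (ofOpen W).T1.emb (g μ) *
      (ofOpen W).T1.pd ((ofOpen W).dqT (.inl μ)) c)) = c := by
  have hk : (k : ℝ) + 1 ≠ 0 := by positivity
  -- As `g μ` vanishes at σ, only `dg ∧ ∂c` survives there. The sum over μ is the Euler field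
  -- applied to `c`, that is, `(k + 1) c`, which explains the normalization.
  rw [map_smul, map_smul, inv_smul_eq_iff₀ hk, map_sum, map_sum]
  rw [isHomog_iff, euler_forms] at hc
  push_cast at hc
  rw [← hc]
  refine Finset.sum_congr rfl fun μ _ => ?_
  have h0 : (ofOpen W).T1.constAt σ ((ofOpen W).T1.emb (g μ)) = 0 := by
    rw [constAt_emb, hg0, map_zero]
  have h1 : (ofOpen W).T1.constAt σ ((ofOpen W).T1.pd ((ofOpen W).dqT (.inl μ)) c) =
      (ofOpen W).T1.pd ((ofOpen W).dqT (.inl μ)) c := by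
    refine (pd_constAt_inr σ _ c).symm.trans ?_
    rw [hcσ]
    rfl
  rw [extD_emb_mul, map_add, map_mul, map_mul, hg, h0, zero_mul, add_zero, h1]

/-- For every point of the body and all values of the coordinates of positive degree there is a
field configuration with these values at `σ` whose field strengths vanish at `σ`. -/
theorem exists_fieldConfig_onShell (hQ : HasDegree Q 1) (σ : (ofOpen W).T1.U) (x : M.U)
    (a : M.E ⊕ M.O → Forms W) (ha : ∀ α, IsHomog (M.deg (.inr α)) (a α))
    (hc : ∀ α, (ofOpen W).T1.constAt σ (a α) = a α) :
    ∃ F : FieldConfig M W,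
      (∀ β, (ofOpen W).T1.constAt σ (F.hom (fieldStrength W Q β)) = 0) ∧
      ∀ f, (ofOpen W).T1.constAt σ (F.hom (onFields M W f)) = pointMap W x a ha f := by
  classical
  -- The value that `dA^α` must have at σ in order that `F^α` vanishes there.
  set c : M.Coord → Forms W := fun α => pointMap W x a ha (Q α) with hcdef
  have hcσ : ∀ α, (ofOpen W).T1.constAt σ (c α) = c α := fun α => constAt_pointMap σ x a ha hc _
  have hchom : ∀ α, IsHomog (M.deg α + 1) (c α) :=
    fun α => (isMorphism_pointMap x a ha).isHomog (hQ α)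
  -- For scalar fields the coefficients of the one-form `c` are needed as real numbers, since the
  -- fields must be actual functions with values in `M.U`.
  have hs : ∀ i μ, ∃ r : ℝ, (ofOpen W).T1.pd ((ofOpen W).dqT (.inl μ)) (c (.inl i)) =
      algebraMap ℝ (Forms W) r := by
    intro i μ
    have h1 := (hchom (.inl i)).pd ((ofOpen W).dqT (.inl μ))
    have e : ((M.deg (.inl i) : ℤ) + 1 - (ofOpen W).T1.deg ((ofOpen W).dqT (.inl μ))) = 0 := by
      rw [deg_dqT]; simp [deg]
    rw [e] at h1
    obtain ⟨s, hs⟩ := h1.exists_emb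
    refine ⟨(s : (ofOpen W).T1.U → ℝ) σ, ?_⟩
    rw [← constAt_emb σ s, ← hs]
    refine Eq.trans ?_ (pd_constAt_inr σ _ (c (.inl i)))
    rw [hcσ]
    rfl
  choose r hr using hs
  obtain ⟨δ, hδ, hball⟩ := Metric.isOpen_iff.1 M.U.isOpen x x.2
  set R : ℝ := ∑ i, ∑ μ, |r i μ| with hR
  have hR0 : 0 ≤ R := Finset.sum_nonneg fun i _ => Finset.sum_nonneg fun μ _ => abs_nonneg _
  -- With this bound every scalar field stays within `R δ / (R + 1) < δ` of `x` on all of `W`;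
  -- adding 1 gives strict inequality and covers `R = 0`.
  obtain ⟨g, hg0, hgs, hgd'⟩ := exists_small_forms (W := W) σ (r := δ / (R + 1)) (by positivity)
  set b : M.B → smoothFns (ofOpen W).T1.U := fun i =>
    algebraMap ℝ _ ((x : M.B → ℝ) i) + ∑ μ : (ofOpen W).B, r i μ • g μ with hbdef
  have hbval : ∀ i y, (b i : (ofOpen W).T1.U → ℝ) y = (x : M.B → ℝ) i +
      ∑ μ : (ofOpen W).B, r i μ * (g μ : (ofOpen W).T1.U → ℝ) y := by
    intro i y
    rw [hbdef]
    have e : ((∑ μ : (ofOpen W).B, r i μ • g μ : smoothFns (ofOpen W).T1.U) :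
        (ofOpen W).T1.U → ℝ) y = ∑ μ : (ofOpen W).B, r i μ * (g μ : (ofOpen W).T1.U → ℝ) y := by
      rw [AddSubmonoidClass.coe_finsetSum, Finset.sum_apply]
      rfl
    rw [← e]
    rfl
  have hb : ∀ y : (ofOpen W).T1.U, (fun i => (b i : (ofOpen W).T1.U → ℝ) y) ∈ M.U := by
    intro y
    refine hball ?_
    rw [Metric.mem_ball, dist_pi_lt_iff hδ]
    intro i
    rw [Real.dist_eq, hbval, add_sub_cancel_left]
    calc |∑ μ : (ofOpen W).B, r i μ * (g μ : (ofOpen W).T1.U → ℝ) y|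
        ≤ ∑ μ : (ofOpen W).B, |r i μ| * (δ / (R + 1)) := by
          refine (Finset.abs_sum_le_sum_abs _ _).trans (Finset.sum_le_sum fun μ _ => ?_)
          rw [abs_mul]
          exact mul_le_mul_of_nonneg_left (hgs μ y) (abs_nonneg _)
      _ = (∑ μ, |r i μ|) * (δ / (R + 1)) := by rw [Finset.sum_mul]
      _ ≤ R * (δ / (R + 1)) := by
          refine mul_le_mul_of_nonneg_right ?_ (by positivity)
          exact Finset.single_le_sum (f := fun i => ∑ μ, |r i μ|)
            (fun i _ => Finset.sum_nonneg fun μ _ => abs_nonneg _) (Finset.mem_univ i)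
      _ < δ := by
          rw [mul_div_assoc', div_lt_iff₀ (by positivity)]
          nlinarith
  have hbσ : (fun i => (b i : (ofOpen W).T1.U → ℝ) σ) = x := by
    funext i
    rw [hbval]
    simp only [hg0, mul_zero, Finset.sum_const_zero, add_zero]
  -- The correction to the constant fields: it vanishes at σ and has differential `c α` there.
  set B : M.Coord → Forms W := fun α => ((M.deg α : ℝ) + 1)⁻¹ • ∑ μ : (ofOpen W).B,
    (ofOpen W).T1.emb (g μ) * (ofOpen W).T1.pd ((ofOpen W).dqT (.inl μ)) (c α) with hBdef
  have hBd : ∀ α, (ofOpen W).T1.constAt σ (extD W (B α)) = c α :=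
    fun α => constAt_extD_homotopy σ g hg0 hgd' (hchom α) (hcσ α)
  have hB0 : ∀ α, (ofOpen W).T1.constAt σ (B α) = 0 := by
    intro α
    rw [hBdef, map_smul, map_sum]
    refine smul_eq_zero_of_right _ (Finset.sum_eq_zero fun μ _ => ?_)
    rw [map_mul, constAt_emb, hg0, map_zero, zero_mul]
  have hBhom : ∀ α, IsHomog (M.deg α) (B α) := by
    intro α
    refine IsHomog.smul _ (IsHomog.sum fun μ _ => ?_)
    have := (isHomog_emb (g μ)).mul ((hchom α).pd ((ofOpen W).dqT (.inl μ)))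
    rw [deg_dqT] at this
    convert this using 1
    simp [deg]
  obtain ⟨F, hF1, hF2⟩ := exists_fieldConfig b hb (fun α => a α + B (.inr α))
    (fun α => (ha α).add (hBhom _))
  have hval : ∀ f, (ofOpen W).T1.constAt σ (F.hom (onFields M W f)) = pointMap W x a ha f := by
    intro f
    have : (((ofOpen W).T1.constAt σ).comp F.hom).comp (onFields M W) = pointMap W x a ha := by
      refine Fn.hom_ext (fun s => ?_) (fun α => ?_)
      · rw [AlgHom.comp_apply, AlgHom.comp_apply, hF1, lift_emb, constAt_emb, pointMap_emb,
          smoothComp_apply]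
        exact congrArg (algebraMap ℝ (Forms W)) (congrArg (s : M.U → ℝ) (Subtype.ext hbσ))
      · rw [AlgHom.comp_apply, AlgHom.comp_apply, hF1, lift_q, pointMap_q, map_add, hc, hB0,
          add_zero]
    exact DFunLike.congr_fun this f
  -- All fields, the scalar ones included, are a constant-coefficient value plus `B`; d annihilates
  -- the former.
  have hfields : ∀ α, fieldsOf b (fun α => a α + B (.inr α)) α =
      (ofOpen W).T1.constAt σ (pointMap W x a ha (M.q α)) + B α := by
    rintro (i | α)
    · rw [constAt_pointMap σ x a ha hc, q_inl, pointMap_emb]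
      change (ofOpen W).T1.emb (b i) = _
      rw [hbdef, map_add, AlgHom.commutes, map_sum]
      congr 1
      rw [hBdef]
      simp only [hr, deg, Nat.cast_zero, zero_add, inv_one, one_smul, map_smul]
      refine Finset.sum_congr rfl fun μ _ => ?_
      rw [Algebra.algebraMap_eq_smul_one, mul_smul_comm, mul_one]
    · rw [pointMap_q, hc]; rfl
  refine ⟨F, fun β => ?_, hval⟩
  rw [fieldStrength, map_sub, map_sub, hval, hF2, hfields, map_add, extD_constAt, zero_add, hBd,
    sub_self]

/-! ### Exterior monomials -/

/-- The product of the coordinate differentials in a list. -/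
def wedge (W : Opens (Fin d → ℝ)) (J : List (ofOpen W).B) : Forms W := (J.map (dCoord W)).prod

theorem wedge_nil : wedge W [] = 1 := rfl

theorem wedge_cons (j : (ofOpen W).B) (J : List (ofOpen W).B) :
    wedge W (j :: J) = dCoord W j * wedge W J := by simp [wedge]

theorem wedge_append (J J' : List (ofOpen W).B) :
    wedge W (J ++ J') = wedge W J * wedge W J' := by simp [wedge]

theorem isHomog_wedge (J : List (ofOpen W).B) : IsHomog J.length (wedge W J) := by
  induction J with
  | nil => exact isHomog_one
  | cons j J ih =>
    rw [wedge_cons, List.length_cons, Nat.cast_succ, add_comm]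
    exact (isHomog_dCoord j).mul ih

theorem constAt_wedge (σ : (ofOpen W).T1.U) (J : List (ofOpen W).B) :
    (ofOpen W).T1.constAt σ (wedge W J) = wedge W J := by
  induction J with
  | nil => rw [wedge_nil, map_one]
  | cons j J ih => rw [wedge_cons, map_mul, ih, constAt_dCoord]

/-- A differential is repeated. This holds in even degree too, so that even coordinates can be
shifted to first order as well; the empty monomial is 1 and must be excluded. -/
theorem wedge_mul_self {J : List (ofOpen W).B} (hJ : J ≠ []) : wedge W J * wedge W J = 0 := by
  obtain ⟨j, J, rfl⟩ := List.exists_cons_of_ne_nil hJ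
  rw [wedge_cons, ← mul_assoc, mul_assoc (dCoord W j), (isHomog_wedge J).hasPar.mul_comm
    (isHomog_dCoord j).hasPar, mul_smul_comm, ← mul_assoc,
    (isHomog_dCoord j).hasPar.mul_self odd_one, zero_mul, smul_zero, zero_mul]

theorem pd_dCoord [DecidableEq (ofOpen W).B] (i j : (ofOpen W).B) :
    (ofOpen W).T1.pd ((ofOpen W).dqT (.inl i)) (dCoord W j) = if i = j then 1 else 0 := by
  classical
  rw [dCoord, pd_q]
  by_cases h : i = j
  · subst h; simp
  · rw [if_neg h, if_neg]
    intro e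
    exact h (Sum.inl.inj (Sum.inr.inj (Sum.inr.inj (Sum.inr.inj e))))

theorem pd_dCoord_mul [DecidableEq (ofOpen W).B] (i j : (ofOpen W).B) (η : Forms W) :
    (ofOpen W).T1.pd ((ofOpen W).dqT (.inl i)) (dCoord W j * η) =
      (if i = j then η else 0) - dCoord W j * (ofOpen W).T1.pd ((ofOpen W).dqT (.inl i)) η := by
  have h : ((ofOpen W).T1.deg ((ofOpen W).dqT (.inl i)) : ℤ) = 1 := by
    rw [deg_dqT]; simp [deg]
  rw [pd_mul, pd_dCoord, h, (isHomog_dCoord j).hasPar.tw, koszulSign_one_one, neg_one_smul,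
    neg_mul, ← sub_eq_add_neg, ite_mul, one_mul, zero_mul]

theorem pd_wedge_of_notMem {j : (ofOpen W).B} {J : List (ofOpen W).B} (h : j ∉ J) :
    (ofOpen W).T1.pd ((ofOpen W).dqT (.inl j)) (wedge W J) = 0 := by
  classical
  induction J with
  | nil =>
    rw [wedge_nil, ← map_one (ofOpen W).T1.emb]
    exact pd_inr_emb _ _
  | cons i J ih =>
    rw [List.mem_cons, not_or] at h
    rw [wedge_cons, pd_dCoord_mul, if_neg h.1, ih h.2, mul_zero, sub_zero]

/-- Contraction strips the first differential as it does not recur, down to the function 1, which is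
nonzero because `W` has a point. -/
theorem wedge_ne_zero (hW : (W : Set (Fin d → ℝ)).Nonempty) {J : List (ofOpen W).B}
    (hJ : J.Nodup) : wedge W J ≠ 0 := by
  classical
  induction J with
  | nil =>
    intro h
    rw [wedge_nil, ← map_one (ofOpen W).T1.emb, ← map_zero (ofOpen W).T1.emb] at h
    have h1 := emb_injective h
    obtain ⟨x, hx⟩ := hW
    exact one_ne_zero (α := ℝ) (congrArg
      (fun s : smoothFns (ofOpen W).T1.U => (s : (ofOpen W).T1.U → ℝ) ⟨x, hx⟩) h1)
  | cons j J ih =>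
    intro h
    rw [List.nodup_cons] at hJ
    refine ih hJ.2 ?_
    have h1 := congrArg ((ofOpen W).T1.pd ((ofOpen W).dqT (.inl j))) h
    rwa [wedge_cons, pd_dCoord_mul, pd_wedge_of_notMem hJ.1, if_pos rfl, mul_zero, sub_zero,
      map_zero] at h1

theorem exists_nodup_append (J : List (ofOpen W).B) (hJ : J.Nodup) (n : ℕ)
    (h : J.length + n ≤ d) :
    ∃ J' : List (ofOpen W).B, J'.length = n ∧ (J ++ J').Nodup := by
  classical
  have hcard : Fintype.card (ofOpen W).B = d := Fintype.card_fin d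
  have h1 : n ≤ (Finset.univ \ J.toFinset).card := by
    rw [Finset.card_sdiff_of_subset (Finset.subset_univ _), Finset.card_univ, hcard,
      List.toFinset_card_of_nodup hJ]
    omega
  obtain ⟨s, hs, hsn⟩ := Finset.exists_subset_card_eq h1
  refine ⟨s.toList, by rw [Finset.length_toList, hsn], ?_⟩
  rw [List.nodup_append]
  refine ⟨hJ, s.nodup_toList, fun a ha b hb hab => ?_⟩
  subst hab
  have := hs (Finset.mem_toList.1 hb)
  simp [ha] at this

/-- Functions on `M` of degree `k` are determined by their values on forms, if the dimension is
large enough. -/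
theorem eq_zero_of_pointMap (hW : (W : Set (Fin d → ℝ)).Nonempty) (σ : (ofOpen W).T1.U) (k : ℕ) :
    ∀ (f : M.Fn), IsHomog (k : ℤ) f → ∀ J : List (ofOpen W).B, J.Nodup → J.length + k ≤ d →
      (∀ (x : M.U) (a : M.E ⊕ M.O → Forms W) (ha : ∀ α, IsHomog (M.deg (.inr α)) (a α)),
        (∀ α, (ofOpen W).T1.constAt σ (a α) = a α) →
          wedge W J * pointMap W x a ha f = 0) → f = 0 := by
  classical
  induction k using Nat.strong_induction_on with
  | _ k ih =>
    intro f hf J hJ hd h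
    rcases Nat.eq_zero_or_pos k with rfl | hk
    · obtain ⟨s, rfl⟩ := IsHomog.exists_emb (by exact_mod_cast hf)
      have hs : s = 0 := by
        ext x
        have h1 := h x (fun _ => 0) (fun _ => isHomog_zero _) (fun _ => map_zero _)
        rw [pointMap_emb, Algebra.algebraMap_eq_smul_one, mul_smul_comm, mul_one] at h1
        exact (smul_eq_zero.1 h1).resolve_right (wedge_ne_zero hW hJ)
      rw [hs, map_zero]
    -- By Euler's identity it suffices that the derivatives along coordinates of positive degree
    -- vanish, and these have smaller degree than `f`.
    · refine hf.eq_zero_of_pd (by exact_mod_cast hk.ne') fun γ => ?_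
      have hpd := hf.pd (.inr γ)
      by_cases hγ : k < M.deg (.inr γ)
      · exact hpd.eq_zero_of_neg (by omega)
      · have hpos : 0 < M.deg (.inr γ) := by
          rcases γ with e | o
          · exact M.degE_pos e
          · exact (M.degO_odd o).pos
        rw [← Nat.cast_sub (not_lt.1 hγ)] at hpd
        -- The degree |γ| lost by differentiating is spent on new differentials, so |J| + k is
        -- preserved.
        obtain ⟨J', hJ', hnd⟩ := exists_nodup_append J hJ (M.deg (.inr γ)) (by omega)
        refine ih _ (by omega) _ hpd (J ++ J') hnd (by rw [List.length_append, hJ']; omega) ?_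
        intro x a ha hc
        have hη : IsHomog (M.deg (.inr γ)) (wedge W J') := by
          rw [← hJ']; exact isHomog_wedge J'
        have hne : J' ≠ [] := by rintro rfl; rw [← hJ'] at hpos; exact absurd hpos (by simp)
        have ha' : ∀ α, IsHomog (M.deg (.inr α)) (a α + if α = γ then wedge W J' else 0) := by
          intro α
          refine (ha α).add ?_
          split_ifs with hα
          · subst hα; exact hη
          · exact isHomog_zero _
        have h1 := h x (fun α => a α + if α = γ then wedge W J' else 0) ha' (fun α => by
          rw [map_add, hc]
          split_ifs
          · rw [constAt_wedge]
          · rw [map_zero])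
        -- Subtracting the hypothesis at `a` from that at the shifted values leaves `dσ^J dσ^J' (∂_γ
        -- f)(a) = 0`.
        have h2 : pointMap W x (fun α => a α + if α = γ then wedge W J' else 0) ha' f =
            pointMap W x a ha f + wedge W J' * pointMap W x a ha (M.pd (.inr γ) f) :=
          lift_add_single _ _ a _ ha ha' γ _ hη (wedge_mul_self hne) (fun α => by congr!) f
        rw [h2, mul_add, h x a ha hc, zero_add, ← mul_assoc, ← wedge_append] at h1
        exact h1

/-! ### Consequences of the on-shell vanishing -/

open Classical in
/-- The gauge parameter with a single nonzero component. -/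
def GaugeParam.single (β : M.Coord) (ζ : Forms W) (hζ : IsHomog ((M.deg β : ℤ) - 1) ζ) :
    GaugeParam M W where
  form := Pi.single β ζ
  homog := fun α => by
    by_cases h : α = β
    · subst h; rwa [Pi.single_eq_same]
    · rw [Pi.single_eq_of_ne h]; exact isHomog_zero _

theorem GaugeParam.single_form_same (β : M.Coord) (ζ : Forms W)
    (hζ : IsHomog ((M.deg β : ℤ) - 1) ζ) : (GaugeParam.single β ζ hζ).form β = ζ := by
  classical
  exact Pi.single_eq_same (M := fun _ => Forms W) β ζ

theorem GaugeParam.single_form_of_ne {β γ : M.Coord} (ζ : Forms W)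
    (hζ : IsHomog ((M.deg β : ℤ) - 1) ζ) (h : γ ≠ β) :
    (GaugeParam.single β ζ hζ).form γ = 0 := by
  classical
  exact Pi.single_eq_of_ne (M := fun _ => Forms W) h ζ

/-- The fields at σ are arbitrary on shell, and one nonzero component of ε isolates one β. The
values of `ζ` and `dζ` at σ can then be chosen separately. -/
theorem VanishesOnShell.single (hQ : HasDegree Q 1)
    (hV : ∀ α β, IsHomog ((M.deg α : ℤ) - (M.deg β : ℤ) + 1) (V α β)) {T : IdealTerms W Q}
    (hT : ∀ ε α, dAlg M W (T.term ε α) ∈ fieldIdeal W Q) (h : VanishesOnShell V T)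
    (σ : (ofOpen W).T1.U) (α β : M.Coord) (ζ : Forms W) (hζ : IsHomog ((M.deg β : ℤ) - 1) ζ)
    (x : M.U) (a : M.E ⊕ M.O → Forms W) (ha : ∀ α, IsHomog (M.deg (.inr α)) (a α))
    (hc : ∀ α, (ofOpen W).T1.constAt σ (a α) = a α) :
    (ofOpen W).T1.constAt σ (extD W ζ) * pointMap W x a ha (V α β - M.pd β (Q α)) +
      (ofOpen W).T1.constAt σ ζ * pointMap W x a ha
        (koszulSign 1 (M.deg β - 1) • act Q (V α β) - ∑ γ, V γ β * M.pd γ (Q α)) = 0 := by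
  obtain ⟨F, hF, hval⟩ := exists_fieldConfig_onShell hQ σ x a ha hc
  have h1 := h.sum_eq_zero hQ hV hT (GaugeParam.single β ζ hζ) F σ hF α
  simp only [hval] at h1
  rw [Finset.sum_eq_single β, Finset.sum_eq_single β] at h1
  · simpa only [GaugeParam.single_form_same] using h1
  · intro γ _ hγ
    simp only [GaugeParam.single_form_of_ne ζ hζ hγ, map_zero, zero_mul]
  · simp
  · intro γ _ hγ
    simp only [GaugeParam.single_form_of_ne ζ hζ hγ, map_zero, zero_mul]
  · simp

/-- Functions on `M` are determined by their products with exterior monomials and their values on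
forms. -/
theorem eq_zero_of_wedge_mul (hW : (W : Set (Fin d → ℝ)).Nonempty) (σ : (ofOpen W).T1.U) {k : ℤ}
    {f : M.Fn} (hf : IsHomog k f) {J : List (ofOpen W).B} (hJ : J.Nodup)
    (hd : (J.length : ℤ) + k ≤ d)
    (h : ∀ (x : M.U) (a : M.E ⊕ M.O → Forms W) (ha : ∀ α, IsHomog (M.deg (.inr α)) (a α)),
      (∀ α, (ofOpen W).T1.constAt σ (a α) = a α) → wedge W J * pointMap W x a ha f = 0) :
    f = 0 := by
  rcases lt_or_ge k 0 with hk | hk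
  · exact hf.eq_zero_of_neg hk
  · obtain ⟨n, rfl⟩ := Int.eq_ofNat_of_zero_le hk
    exact eq_zero_of_pointMap hW σ n f hf J hJ (by omega) h

/-- A parameter with `ζ(σ) = 0` and `dζ(σ) = dσ^J`, |J| = |β|, removes the second term of
`VanishesOnShell.single` and leaves `dσ^J` times the difference of coefficients. -/
theorem VanishesOnShell.coeffsAgree {p : ℕ} (hd : p + 1 ≤ d)
    (hW : (W : Set (Fin d → ℝ)).Nonempty) (hp : ∀ α, M.deg α ≤ p) (hQ : HasDegree Q 1)
    (hV : ∀ α β, IsHomog ((M.deg α : ℤ) - (M.deg β : ℤ) + 1) (V α β)) {T : IdealTerms W Q}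
    (hT : ∀ ε α, dAlg M W (T.term ε α) ∈ fieldIdeal W Q) (h : VanishesOnShell V T) :
    CoeffsAgree Q V := by
  intro α β hβ
  have σ : (ofOpen W).T1.U := ⟨hW.some, hW.some_mem⟩
  have hα := hp α
  have hβp := hp β
  obtain ⟨J, hJlen, hJ⟩ := exists_nodup_append (W := W) [] List.nodup_nil (M.deg β)
    (by simp; omega)
  rw [List.nil_append] at hJ
  obtain ⟨j, J, rfl⟩ := List.exists_cons_of_ne_nil
    (show J ≠ [] by rintro rfl; rw [← hJlen] at hβ; exact absurd hβ (by simp))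
  obtain ⟨g, hg0, -, hg⟩ := exists_small_forms (W := W) σ one_pos
  -- The parameter is `g_j dσ^J`, where `j` was split off from the monomial so that `dg_j` restores
  -- it at σ.
  have hhom : IsHomog ((M.deg β : ℤ) - 1) ((ofOpen W).T1.emb (g j) * wedge W J) := by
    have h1 := (isHomog_emb (g j)).mul (isHomog_wedge (W := W) J)
    rw [← hJlen, List.length_cons]
    convert h1 using 1
    push_cast
    ring
  have hζ_zero : (ofOpen W).T1.constAt σ ((ofOpen W).T1.emb (g j) * wedge W J) = 0 := by
    rw [map_mul, constAt_emb, hg0, map_zero, zero_mul]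
  have hζ_one : (ofOpen W).T1.constAt σ (extD W ((ofOpen W).T1.emb (g j) * wedge W J)) =
      wedge W (j :: J) := by
    rw [extD_emb_mul, map_add, map_mul, map_mul, hg, constAt_emb, hg0, map_zero, zero_mul,
      add_zero, constAt_wedge, wedge_cons]
  -- Degree count: |β| + (|α| - |β| + 1) = |α| + 1 ≤ p + 1 ≤ d.
  refine sub_eq_zero.1 (eq_zero_of_wedge_mul hW σ (k := (M.deg α : ℤ) - M.deg β + 1)
    (J := j :: J) ((hV α β).sub ?_) hJ (by rw [hJlen]; omega) fun x a ha hc => ?_)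
  · have := (hQ α).pd β
    convert this using 1
    ring
  · have h1 := h.single hQ hV hT σ α β _ hhom x a ha hc
    rwa [hζ_zero, hζ_one, zero_mul, add_zero] at h1

/-- Once the coefficients agree, the terms with dε are gone and the remaining coefficient of `ε^β`
is `-∂_β(Q Q^α)`. A monomial of length |β| - 1 as parameter detects it. -/
theorem VanishesOnShell.squareZero {p : ℕ} (hd : p + 1 ≤ d)
    (hW : (W : Set (Fin d → ℝ)).Nonempty) (hp : ∀ α, M.deg α ≤ p) (hQ : HasDegree Q 1)
    (hV : ∀ α β, IsHomog ((M.deg α : ℤ) - (M.deg β : ℤ) + 1) (V α β)) {T : IdealTerms W Q}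
    (hT : ∀ ε α, dAlg M W (T.term ε α) ∈ fieldIdeal W Q) (h : VanishesOnShell V T) :
    SquareZero Q := by
  have hcoeff := h.coeffsAgree hd hW hp hQ hV hT
  have σ : (ofOpen W).T1.U := ⟨hW.some, hW.some_mem⟩
  refine square_zero_of_components odd_one hQ.fieldPar fun α => ?_
  have hQQ : IsHomog ((M.deg α : ℤ) + 1 + 1) (act Q (Q α)) := (hQ α).act hQ
  -- The degree |α| + 2 is positive, so derivatives along coordinates with |β| ≥ 1 suffice; these
  -- are the ones with a nontrivial parameter.
  refine hQQ.eq_zero_of_pd (by positivity) fun β' => ?_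
  set β : M.Coord := .inr β' with hβdef
  have hβ : 1 ≤ M.deg β := by
    rcases β' with e | o
    · exact M.degE_pos e
    · exact (M.degO_odd o).pos
  have hα := hp α
  have hβp := hp β
  obtain ⟨J, hJlen, hJ⟩ := exists_nodup_append (W := W) [] List.nodup_nil (M.deg β - 1)
    (by simp; omega)
  rw [List.nil_append] at hJ
  have hhom : IsHomog ((M.deg β : ℤ) - 1) (wedge W J) := by
    have h1 := isHomog_wedge (W := W) J
    rwa [hJlen, Nat.cast_sub hβ, Nat.cast_one] at h1
  -- Degree count: (|β| - 1) + (|α| + 2 - |β|) = |α| + 1 ≤ d.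
  refine eq_zero_of_wedge_mul hW σ (J := J) (hQQ.pd β) hJ (by rw [hJlen]; omega)
    fun x a ha hc => ?_
  have h1 := h.single hQ hV hT σ α β _ hhom x a ha hc
  -- With `V = ∂Q` this is the Leibniz rule for `∂_β(Q^γ ∂_γ Q^α)`, up to an overall sign.
  have e : koszulSign 1 (M.deg β - 1) • act Q (V α β) - ∑ γ, V γ β * M.pd γ (Q α) =
      -M.pd β (act Q (Q α)) := by
    have hs : koszulSign 1 ((M.deg β : ℤ) - 1) = -koszulSign 1 (M.deg β) := by
      rw [sub_eq_add_neg, koszulSign_add_right]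
      simp [koszulSign]
    rw [pd_act hQ.fieldPar, act_apply (fun γ => M.pd β (Q γ)), hs, hcoeff α β hβ,
      Finset.sum_congr rfl fun γ _ => by rw [hcoeff γ β hβ], neg_smul]
    abel
  rw [e, hcoeff α β hβ, sub_self, map_zero, mul_zero, zero_add, constAt_wedge, map_neg, mul_neg,
    neg_eq_zero] at h1
  exact h1

end HigherGauge

end

/-! ### The equivalences -/

theorem theorem2 (p d : ℕ) (hd : p + 1 ≤ d) (W : TopologicalSpace.Opens (Fin d → ℝ))
    (hW : (W : Set (Fin d → ℝ)).Nonempty) (M : GradedDomain) (hp : ∀ α, M.deg α ≤ p)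
    (Q : M.VectorField) (hQ : GradedDomain.HasDegree Q 1)
    (V : M.Coord → M.Coord → M.Fn)
    (hV : ∀ α β, GradedDomain.IsHomog ((M.deg α : ℤ) - (M.deg β : ℤ) + 1) (V α β)) :
    (GradedDomain.SquareZero Q → ∀ T : HigherGauge.IdealTerms W Q,
      List.TFAE [HigherGauge.PreservesIdeal V T,
        HigherGauge.VanishesOnShell V T,
        HigherGauge.CoeffsAgree Q V,
        HigherGauge.IsInnerByParam W Q V,
        HigherGauge.IsInner W Q V,
        HigherGauge.IsInnerModIdeal V T]) ∧
    List.TFAE [HigherGauge.PreservesIdeal V (HigherGauge.noTerms W Q),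
      HigherGauge.VanishesOnShell V (HigherGauge.noTerms W Q),
      GradedDomain.SquareZero Q ∧ HigherGauge.CoeffsAgree Q V,
      GradedDomain.SquareZero Q ∧ HigherGauge.IsInner W Q V] ∧
    (HigherGauge.PreservesIdeal V (HigherGauge.noTerms W Q) →
      GradedDomain.SquareZero Q ∧ HigherGauge.Bianchi W Q) := by

  have hnoT : ∀ ε α, HigherGauge.dAlg M W ((HigherGauge.noTerms W Q).term ε α) ∈
      HigherGauge.fieldIdeal W Q := fun ε α => by
    change HigherGauge.dAlg M W 0 ∈ _
    rw [map_zero]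
    exact Ideal.zero_mem _
  have hsq : HigherGauge.VanishesOnShell V (HigherGauge.noTerms W Q) →
      GradedDomain.SquareZero Q := fun h => h.squareZero hd hW hp hQ hV hnoT
  refine ⟨fun hQ2 T => ?_, ?_, fun h => ?_⟩
  · tfae_have 1 → 2 := fun h => h.vanishesOnShell
    -- Here `Q² = 0` is needed for general terms: the Bianchi identities keep their differentials in
    -- the ideal.
    tfae_have 2 → 3 := fun h => h.coeffsAgree hd hW hp hQ hV
      fun ε α => HigherGauge.bianchi hQ hQ2 _ (T.mem ε α)
    tfae_have 3 → 4 := fun h => h.isInnerByParam hQ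
    tfae_have 4 → 5 := fun h => h.isInner
    tfae_have 5 → 6 := fun h => h.isInnerModIdeal T
    tfae_have 6 → 1 := fun h => HigherGauge.preservesIdeal_of_isInnerModIdeal hQ hQ2 hV h
    tfae_finish
  · tfae_have 1 → 2 := fun h => h.vanishesOnShell
    tfae_have 2 → 3 := fun h => ⟨hsq h, h.coeffsAgree hd hW hp hQ hV hnoT⟩
    tfae_have 3 → 4 := fun h => ⟨h.1, (h.2.isInnerByParam hQ).isInner⟩
    tfae_have 4 → 1 := fun h =>
      HigherGauge.preservesIdeal_of_isInnerModIdeal hQ h.1 hV (h.2.isInnerModIdeal _)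
    tfae_finish
  · exact ⟨hsq h.vanishesOnShell, HigherGauge.bianchi hQ (hsq h.vanishesOnShell)⟩
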